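/- All graphs are finite and non-empty. **Galled-trees and GaTEx graphs.** A galled-tree on a leaf set $X$ is a finite DAG $N$ that either consists of a single vertex $x$, with $X=\{x\}$, or satisfies: (N1) there is a unique root $\rho_N$ of indegree $0$, and it has outdegree at least $2$; (N2) $x\in X$ iff $x$ has outdegree $0$ and indegree $1$; (N3) every other vertex has either indegree $1$ and outdegree at least $2$, or indegree $2$ and outdegree at least $1$ (a hybrid-vertex); (N4) each biconnected component contains at most one hybrid-vertex both of whose parents lie in that component. A cycle $C$ of $N$ consists of two different directed paths (its sides) from a vertex $\rho_C$ (its root) to a vertex $\eta_C$ (its hybrid-vertex) with no common inner vertices. A labeling of $N$ is a map $t\colon V(N)\to\{0,1,\odot\}$ with $t(v)=\odot$ iff $v\in X$. The graph explained by $(N,t)$ has vertex set $X$, and $x\ne y$ are adjacent iff $t(\mathrm{lca}_N(x,y))=1$. A graph is GaTEx if it is explained by some labeled galled-tree. A galled-tree on $X$ is elementary if it consists of one cycle $C$ of length $|X|+1$ with $\rho_C=\rho_N$, together with exactly one pendant leaf at each vertex of $C$ other than $\rho_C$. It is strong if no cycle has a side without inner vertices or two sides with exactly one inner vertex each. The labeling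 is quasi-discriminating if $t(u)\neq t(v)$ for every edge $(u,v)$ with $v$ not a hybrid-vertex. **Pvr-networks.** A module of $G$ is a set $M\subseteq V(G)$ all of whose elements have the same neighbors outside $M$; it is strong if for every module $M'$ the set $M\cap M'$ is one of $M,M',\emptyset$. The modular decomposition tree $\mathscr T_G$ has the non-empty strong modules as vertices, ordered by inclusion (its root is $V(G)$, its leaves are the singletons). Its labels are $t_G(M)=\odot$ if $|M|=1$; otherwise $0$ if $G[M]$ is disconnected, $1$ if the complement of $G[M]$ is disconnected, and "prime" in all other cases. A pvr-network $(N,t)$ of $G$ arises from $(\mathscr T_G,t_G)$ as follows: for each prime vertex $M$, choose a labeled strong quasi-discriminating elementary galled-tree $(N_M,t_M)$ that explains the quotient of $G[M]$ by its inclusion-maximal strong modules other than $M$; replace the edges from $M$ to its children by $N_M$, identifying the root of $N_M$ with $M$ and the leaves of $N_M$ with the children of $M$ in $\mathscr T_G$. The label $t$ equals $t_M$ on the non-leaf vertices of $N_M$, and $t_G$ on the non-prime vertices of $\mathscr T_G$. **Algorithm.** Given a GaTEx graph $G$ and a pvr-network $(N,t)$ of $G$, put $\zeta(x):=x$ for each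 leaf $x$ and process the non-leaf vertices $v$ of $\mathscr T_G$ in postorder. If $t_G(v)\in\{0,1\}$, let $\zeta(v)$ be the concatenation, in an arbitrary order, of the sequences $\zeta(v_i)$ of the children $v_i$ of $v$ in $\mathscr T_G$. If $v$ is prime, let $C$ be the unique cycle of $N$ with $\rho_C=v$; for each $w\in V(C)\setminus\{\rho_C\}$ put $\zeta(w):=\zeta(w')$, where $w'$ is the unique child of $w$ in $N$ outside $C$; let $\zeta^*(v)$ be the concatenation, in an arbitrary order, of the sequences $\zeta(w)$ with $w\in V(C)\setminus\{\rho_C,\eta_C\}$; and put $\zeta(v):=\zeta(\eta_C)\zeta^*(v)$ if $t(\rho_C)=0$ and $\zeta(v):=\zeta^*(v)\zeta(\eta_C)$ if $t(\rho_C)=1$. Return $\zeta(v)$ for the root $v$ of $\mathscr T_G$. **Proposition.** The algorithm determines a perfect ordering of every GaTEx graph. That is, let $G$ be a GaTEx graph. Then $G$ has a pvr-network, and for every pvr-network of $G$ the algorithm can be carried out and every sequence $\zeta$ that it can return (whatever arbitrary choices it makes) is a perfect order of $G$: $\zeta$ lists every vertex of $G$ exactly once and, for each induced subgraph $H$ of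 $G$, the greedy coloring that scans the vertices of $H$ in the order given by $\zeta$, giving each vertex the smallest positive integer not assigned to an earlier neighbor, uses exactly $\chi(H)$ colors. -/

import Mathlib

namespace GaTEx

open Set

/-! ### Directed graphs, least common ancestors, biconnected components -/

section Networks

variable {W : Type*}

/-- Number of parents of `v`. -/
noncomputable def indeg (N : Digraph W) (v : W) : ℕ := {u | N.Adj u v}.ncard

/-- Number of children of `v`. -/
noncomputable def outdeg (N : Digraph W) (v : W) : ℕ := {u | N.Adj v u}.ncard

/-- There is no directed cycle (in particular, no loop). -/
def IsDAG (N : Digraph W) : Prop := ∀ v, ¬ Relation.TransGen N.Adj v v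

/-- `IsAncestor N u v`: there is a directed path, possibly of length zero, from `u` to `v`. -/
def IsAncestor (N : Digraph W) (u v : W) : Prop := Relation.ReflTransGen N.Adj u v

/-- `w` is a lowest vertex among the common ancestors of all vertices in `A`. -/
def IsLCA (N : Digraph W) (A : Set W) (w : W) : Prop :=
  (∀ a ∈ A, IsAncestor N w a) ∧
    ∀ w', (∀ a ∈ A, IsAncestor N w' a) → IsAncestor N w w' → w' = w

/-- The subgraph induced by `S` is connected and has no vertex whose removal disconnects it
(edge directions are ignored). -/
def IsBiconnected (N : Digraph W) (S : Set W) : Prop :=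
  ((SimpleGraph.fromRel N.Adj).induce S).Connected ∧
    ∀ v ∈ S, ((SimpleGraph.fromRel N.Adj).induce (S \ {v})).Preconnected

/-- Vertex sets of biconnected components. An inclusion-maximal biconnected subgraph is an
induced subgraph, hence is determined by its vertex set. -/
def IsBiconnectedComponent (N : Digraph W) (S : Set W) : Prop := Maximal (IsBiconnected N) S

def IsHybrid (N : Digraph W) (v : W) : Prop := indeg N v = 2 ∧ 1 ≤ outdeg N v

def IsTreeVertex (N : Digraph W) (v : W) : Prop := indeg N v = 1 ∧ 2 ≤ outdeg N v

/-! ### Galled-trees -/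

/-- Conditions (N1)–(N4), for the vertex set `W` and the leaf set `X`. -/
structure IsProperGalledTree (N : Digraph W) (X : Set W) : Prop where
  root : ∃ ρ, indeg N ρ = 0 ∧ 2 ≤ outdeg N ρ ∧ ∀ v, indeg N v = 0 → v = ρ
  leaves : ∀ x, x ∈ X ↔ outdeg N x = 0 ∧ indeg N x = 1
  inner : ∀ v, v ∉ X → indeg N v ≠ 0 → IsTreeVertex N v ∨ IsHybrid N v
  level_one : ∀ S, IsBiconnectedComponent N S → ∀ v ∈ S, ∀ v' ∈ S,
    IsHybrid N v → IsHybrid N v' →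
    (∀ u, N.Adj u v → u ∈ S) → (∀ u, N.Adj u v' → u ∈ S) → v = v'

/-- `N` is a galled-tree with leaf set `X`. -/
def IsGalledTree (N : Digraph W) (X : Set W) : Prop :=
  IsDAG N ∧ ((∃ x : W, (univ : Set W) = {x} ∧ X = {x}) ∨ IsProperGalledTree N X)

/-- A rooted cycle: two directed paths from `root` to `hybrid` that have no inner vertex in
common. The lists `inner₁`, `inner₂` are the inner vertices of the two paths in their order;
not both are empty, so the two paths are different. -/
structure RootedCycle (N : Digraph W) where
  root : W
  hybrid : W
  inner₁ : List W
  inner₂ : List W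
  path₁ : List.IsChain N.Adj (root :: (inner₁ ++ [hybrid]))
  path₂ : List.IsChain N.Adj (root :: (inner₂ ++ [hybrid]))
  nodup : (root :: hybrid :: (inner₁ ++ inner₂)).Nodup
  nontrivial : inner₁ ≠ [] ∨ inner₂ ≠ []

/-- The vertex set of a rooted cycle. -/
def RootedCycle.verts {N : Digraph W} (C : RootedCycle N) : Set W :=
  {v | v ∈ C.root :: C.hybrid :: (C.inner₁ ++ C.inner₂)}

/-- `(u, v)` is an edge of one of the two sides. -/
def RootedCycle.IsEdge {N : Digraph W} (C : RootedCycle N) (u v : W) : Prop :=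
  [u, v] <:+: C.root :: (C.inner₁ ++ [C.hybrid]) ∨
    [u, v] <:+: C.root :: (C.inner₂ ++ [C.hybrid])

/-- Elementary galled-trees: a single rooted cycle of length `|X| + 1` through the root, plus
one pendant leaf at every vertex of the cycle other than the root. -/
def IsElementary (N : Digraph W) (X : Set W) : Prop :=
  IsGalledTree N X ∧ ∃ C : RootedCycle N,
    indeg N C.root = 0 ∧
    C.verts.ncard = X.ncard + 1 ∧
    C.verts ∪ X = univ ∧
    (∀ v ∈ C.verts, v ≠ C.root → ∃! x, x ∈ X ∧ N.Adj v x) ∧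
    ∀ u v, N.Adj u v → C.IsEdge u v ∨ (u ∈ C.verts ∧ u ≠ C.root ∧ v ∈ X)

/-- No rooted cycle has a side without inner vertices, or two sides with exactly one inner
vertex each. -/
def IsStrong (N : Digraph W) : Prop :=
  ∀ C : RootedCycle N, C.inner₁ ≠ [] ∧ C.inner₂ ≠ [] ∧
    ¬ (C.inner₁.length = 1 ∧ C.inner₂.length = 1)

end Networks

/-! ### Labelings and explained graphs -/

/-- Vertex labels. The label `prime` occurs only in modular decomposition trees. -/
inductive VLabel
  | zero
  | one
  | leaf
  | prime

/-- `t` is a labeling by `0`, `1`, `⊙` whose value is `⊙` exactly on the leaf set `X`. -/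
def IsLabeling {W : Type*} (X : Set W) (t : W → VLabel) : Prop :=
  (∀ v, t v = VLabel.leaf ↔ v ∈ X) ∧ ∀ v, t v ≠ VLabel.prime

def IsQuasiDiscriminating {W : Type*} (N : Digraph W) (t : W → VLabel) : Prop :=
  ∀ u v, N.Adj u v → ¬ IsHybrid N v → t u ≠ t v

/-- The graph explained by `(N, t)`, where `ℓ` identifies the vertices of the graph with the
leaves of `N`. -/
def explainedGraph {W X : Type*} (N : Digraph W) (t : W → VLabel) (ℓ : X → W) :
    SimpleGraph X :=
  SimpleGraph.fromRel fun x y => ∃ w, IsLCA N {ℓ x, ℓ y} w ∧ t w = VLabel.one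

/-- `G` is galled-tree explainable. -/
def IsGaTEx {X : Type*} (G : SimpleGraph X) : Prop :=
  ∃ (W : Type) (_ : Finite W) (N : Digraph W) (t : W → VLabel) (ℓ : X → W),
    Function.Injective ℓ ∧ IsGalledTree N (range ℓ) ∧ IsLabeling (range ℓ) t ∧
      explainedGraph N t ℓ = G

/-! ### Modular decomposition -/

section Modules

variable {X : Type*}

/-- `S` is a module of the induced subgraph `G[M]`. -/
def IsModuleOn (G : SimpleGraph X) (M S : Set X) : Prop :=
  S ⊆ M ∧ ∀ x ∈ S, ∀ y ∈ S, ∀ z ∈ M, z ∉ S → (G.Adj x z ↔ G.Adj y z)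

/-- `S` is a strong module of the induced subgraph `G[M]`. -/
def IsStrongModuleOn (G : SimpleGraph X) (M S : Set X) : Prop :=
  IsModuleOn G M S ∧ ∀ S', IsModuleOn G M S' → S ∩ S' = S ∨ S ∩ S' = S' ∨ S ∩ S' = ∅

/-- Vertices of the modular decomposition tree of `G`: the nonempty strong modules of `G`,
ordered by inclusion. `c` is a child of `M` in the tree iff `c ⋖ M`. -/
abbrev MDVertex (G : SimpleGraph X) : Type _ :=
  {M : Set X // M.Nonempty ∧ IsStrongModuleOn G univ M}

open Classical in
/-- The labels of the modular decomposition tree. -/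
noncomputable def mdLabel (G : SimpleGraph X) (M : MDVertex G) : VLabel :=
  if M.1.ncard = 1 then VLabel.leaf
  else if ¬ (G.induce M.1).Connected then VLabel.zero
  else if ¬ (G.induce M.1)ᶜ.Connected then VLabel.one
  else VLabel.prime

/-- The inclusion-maximal strong modules of `G[M]` other than `M`. -/
def maxStrong (G : SimpleGraph X) (M : Set X) : Set (Set X) :=
  {S | Maximal (fun S => S.Nonempty ∧ IsStrongModuleOn G M S ∧ S ≠ M) S}

/-- The quotient of `G[M]` by its maximal strong modules. -/
def quotientGraph (G : SimpleGraph X) (M : Set X) : SimpleGraph (maxStrong G M) :=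
  SimpleGraph.fromRel fun S T => ∃ x ∈ S.1, ∃ y ∈ T.1, G.Adj x y

/-- Strong modules of `G[M]`, for `M` a strong module of `G`, are strong modules of `G`. -/
theorem IsStrongModuleOn.trans {G : SimpleGraph X} {M S : Set X}
    (hM : IsStrongModuleOn G univ M) (hS : IsStrongModuleOn G M S) :
    IsStrongModuleOn G univ S := by
  refine ⟨⟨subset_univ _, fun x hx y hy z _ hz => ?_⟩, fun S' hS' => ?_⟩
  · by_cases hzM : z ∈ M
    · exact hS.1.2 x hx y hy z hzM hz
    · exact hM.1.2 x (hS.1.1 hx) y (hS.1.1 hy) z (mem_univ _) hzM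
  · rcases hM.2 S' hS' with h | h | h
    · exact Or.inl (inter_eq_left.2 (hS.1.1.trans (inter_eq_left.1 h)))
    · exact hS.2 S' ⟨inter_eq_right.1 h,
        fun x hx y hy z _ hz => hS'.2 x hx y hy z (mem_univ _) hz⟩
    · refine Or.inr (Or.inr (subset_eq_empty ?_ h))
      exact inter_subset_inter_left _ hS.1.1

/-- A maximal strong module of `G[M]` as a vertex of the modular decomposition tree of `G`. -/
def childVertex {G : SimpleGraph X} (M : MDVertex G) (S : maxStrong G M.1) : MDVertex G :=
  ⟨S.1, S.2.1.1, M.2.2.trans S.2.1.2.1⟩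

/-- Prime vertices of the modular decomposition tree. -/
abbrev PrimeVertex (G : SimpleGraph X) : Type _ :=
  {M : MDVertex G // mdLabel G M = VLabel.prime}

end Modules

/-! ### Prime-vertex replacement networks -/

section Pvr

variable {X : Type*} {G : SimpleGraph X}

/-- A strong quasi-discriminating elementary galled-tree, together with its root, that explains
the quotient of `G[M]` by its maximal strong modules. -/
structure Replacement (G : SimpleGraph X) (M : Set X) where
  W : Type
  finite : Finite W
  N : Digraph W
  t : W → VLabel
  root : W
  leaf : maxStrong G M → W
  leaf_injective : Function.Injective leaf
  indeg_root : indeg N root = 0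
  elementary : IsElementary N (range leaf)
  strong : IsStrong N
  labeling : IsLabeling (range leaf) t
  quasiDiscriminating : IsQuasiDiscriminating N t
  explains : explainedGraph N t leaf = quotientGraph G M

/-- The choices made in building a prime-vertex replacement (pvr) network of `G`: one
replacement for every prime vertex of the modular decomposition tree. -/
def PvrChoice (G : SimpleGraph X) : Type _ := ∀ P : PrimeVertex G, Replacement G P.1.1

/-- Vertices of the pvr-network: those of the modular decomposition tree, and those vertices of
the replacements that are neither the root nor a leaf. -/
abbrev PvrVertex (R : PvrChoice G) : Type _ :=
  MDVertex G ⊕ (Σ P : PrimeVertex G, {w : (R P).W // w ≠ (R P).root ∧ w ∉ range (R P).leaf})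

/-- `Glue R P w a`: the vertex `w` of the replacement of `P` becomes the vertex `a` of the
pvr-network. The root is identified with `P`, and a leaf with the child of `P` that is the same
module. -/
inductive Glue (R : PvrChoice G) (P : PrimeVertex G) : (R P).W → PvrVertex R → Prop
  | root : Glue R P (R P).root (Sum.inl P.1)
  | leaf (S : maxStrong G P.1.1) : Glue R P ((R P).leaf S) (Sum.inl (childVertex P.1 S))
  | inner (w : {w : (R P).W // w ≠ (R P).root ∧ w ∉ range (R P).leaf}) :
      Glue R P w.1 (Sum.inr ⟨P, w⟩)

/-- Edges of the pvr-network: the tree edges below non-prime vertices, and the edges of the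
replacements. -/
inductive PvrAdj (R : PvrChoice G) : PvrVertex R → PvrVertex R → Prop
  | tree (M c : MDVertex G) : mdLabel G M ≠ VLabel.prime → c ⋖ M →
      PvrAdj R (Sum.inl M) (Sum.inl c)
  | replaced (P : PrimeVertex G) (w w' : (R P).W) (a b : PvrVertex R) :
      (R P).N.Adj w w' → Glue R P w a → Glue R P w' b → PvrAdj R a b

/-- The pvr-network as a directed graph. -/
def pvrNetwork (R : PvrChoice G) : Digraph (PvrVertex R) where
  Adj := PvrAdj R

open Classical in
/-- The labeling of the pvr-network. -/
noncomputable def pvrLabel (R : PvrChoice G) : PvrVertex R → VLabel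
  | Sum.inl M =>
      if h : mdLabel G M = VLabel.prime then (R ⟨M, h⟩).t (R ⟨M, h⟩).root else mdLabel G M
  | Sum.inr ⟨P, w⟩ => (R P).t w.1

end Pvr

/-! ### The algorithm -/

section Algorithm

variable {X : Type*} {G : SimpleGraph X}

/-- The list `l` contains every element of `s` exactly once, and nothing else. -/
def Enumerates {α : Type*} (l : List α) (s : Set α) : Prop := l.Nodup ∧ ∀ a, a ∈ l ↔ a ∈ s

/-- `Postorder M l`: the list `l` is a postorder of the subtree of the modular decomposition
tree that is rooted at `M` (the children are visited in an arbitrary order). -/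
inductive Postorder : MDVertex G → List (MDVertex G) → Prop
  | mk (M : MDVertex G) (cs : List (MDVertex G)) (f : MDVertex G → List (MDVertex G)) :
      Enumerates cs {c | c ⋖ M} → (∀ c ∈ cs, Postorder c (f c)) →
      Postorder M (cs.flatMap f ++ [M])

/-- The state of the algorithm: the current value of `ζ(w)` for every vertex `w` of the
pvr-network. -/
abbrev AlgState (R : PvrChoice G) : Type _ := PvrVertex R → List X

open Classical in
/-- `Step R M ζ ζ'`: processing the vertex `M` can turn the state `ζ` into `ζ'`. Leaves are
skipped. At a prime vertex, `C` is the cycle of the network with root `M`, the state `ζ₁` is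
reached after copying to each vertex `w ≠ M` of `C` the value at its child outside `C`, and `vs`
is the arbitrary order of the vertices of `C` other than its root and its hybrid-vertex. -/
inductive Step (R : PvrChoice G) : MDVertex G → AlgState R → AlgState R → Prop
  | leaf (M : MDVertex G) (ζ : AlgState R) : mdLabel G M = VLabel.leaf → Step R M ζ ζ
  | nonprime (M : MDVertex G) (ζ : AlgState R) (cs : List (MDVertex G)) :
      (mdLabel G M = VLabel.zero ∨ mdLabel G M = VLabel.one) →
      Enumerates cs {c | c ⋖ M} →
      Step R M ζ (Function.update ζ (Sum.inl M) (cs.flatMap fun c => ζ (Sum.inl c)))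
  | prime (M : MDVertex G) (ζ ζ₁ : AlgState R) (C : RootedCycle (pvrNetwork R))
      (vs : List (PvrVertex R)) :
      mdLabel G M = VLabel.prime →
      C.root = Sum.inl M →
      (∀ w ∈ C.verts, w ≠ C.root →
        ∃ w', (pvrNetwork R).Adj w w' ∧ w' ∉ C.verts ∧ ζ₁ w = ζ w') →
      (∀ w, ¬ (w ∈ C.verts ∧ w ≠ C.root) → ζ₁ w = ζ w) →
      Enumerates vs (C.verts \ {C.root, C.hybrid}) →
      Step R M ζ (Function.update ζ₁ (Sum.inl M)
        (if pvrLabel R C.root = VLabel.zero then ζ₁ C.hybrid ++ vs.flatMap ζ₁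
          else vs.flatMap ζ₁ ++ ζ₁ C.hybrid))

/-- The loop over a list of vertices. -/
inductive Loop (R : PvrChoice G) : List (MDVertex G) → AlgState R → AlgState R → Prop
  | nil (ζ : AlgState R) : Loop R [] ζ ζ
  | cons (M : MDVertex G) (l : List (MDVertex G)) (ζ ζ' ζ'' : AlgState R) :
      Step R M ζ ζ' → Loop R l ζ' ζ'' → Loop R (M :: l) ζ ζ''

/-- `AlgReturns R o`: the algorithm, run with the pvr-network given by `R`, can return the
sequence `o`. Initially `ζ(x) = x` for every leaf `x`; the other values are arbitrary. The root
of the modular decomposition tree is the module of all vertices. -/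
def AlgReturns (R : PvrChoice G) (o : List X) : Prop :=
  ∃ (root : MDVertex G) (l : List (MDVertex G)) (ζ ζ' : AlgState R),
    root.1 = univ ∧ Postorder root l ∧
    (∀ (x : X) (M : MDVertex G), M.1 = {x} → ζ (Sum.inl M) = [x]) ∧
    Loop R l ζ ζ' ∧ o = ζ' (Sum.inl root)

end Algorithm

/-! ### Perfect orders -/

section PerfectOrder

open Classical in
/-- Greedy coloring of `H` along a sequence of vertices. Colors are positive integers; the value
`0` stands for a vertex that is not colored yet. -/
noncomputable def greedyColoring {Y : Type*} (H : SimpleGraph Y) (l : List Y) : Y → ℕ :=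
  l.foldl (fun c v => Function.update c v (sInf {k | 0 < k ∧ ∀ w, H.Adj v w → c w ≠ k}))
    fun _ => 0

open Classical in
/-- The restriction of a sequence of vertices to the elements of `Y`. -/
noncomputable def restrictOrder {X : Type*} (o : List X) (Y : Set X) : List Y :=
  o.filterMap fun x => if h : x ∈ Y then some ⟨x, h⟩ else none

/-- The sequence `o` is a total order of the vertices of `G` along which the greedy algorithm
colors every induced subgraph with the minimum number of colors. -/
def IsPerfectOrder {X : Type*} (G : SimpleGraph X) (o : List X) : Prop :=
  Enumerates o univ ∧ ∀ Y : Set X,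
    ((range (greedyColoring (G.induce Y) (restrictOrder o Y))).ncard : ℕ∞) =
      (G.induce Y).chromaticNumber

end PerfectOrder

end GaTEx

namespace GaTEx

open Set
open scoped List

/-! ### Obstruction-free sequences are perfect orders -/

/-! ### Order of entries in duplicate-free sequences. -/

section Lists

variable {α : Type*}

/-! Call an induced path a - b - c - d an obstruction for a sequence if a precedes b and d precedes
c. By Chvátal's theorem a sequence without obstructions is a perfect order: starting from a vertex
of the largest greedy color n, a clique is grown downward through the colors n - 1, ..., 1, each new
vertex being supplied by `exists_common_neighbor`, so that n is at most the clique number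
(`greedyColoring_optimal`). Since obstructions in an induced subgraph are obstructions in G, it
suffices that the returned sequence has none.

This is proved upward along the modular decomposition tree. An induced path on four vertices of M
with two vertices in a module of G[M] lies inside that module (`IsP4.mem_module`), so concatenating
good sequences of the maximal strong modules can only create obstructions that meet four different
modules (`isGoodOrder_flatMap`). At a non-prime vertex no induced path does that. At a prime vertex
such a path lives in the quotient, which is explained by an elementary galled-tree. There, two
leaves on one side (hybrid-vertex included) are adjacent according to the label above the upper one,
so no side carries an induced path on four vertices; leaves on opposite sides are adjacent according
to the label of the root. Hence every such path uses the leaf below the hybrid-vertex, as an end if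
the root has label 1 and as an inner vertex if it has label 0 (`IsElementaryWith.hybrid_of_isP4`).
In an obstruction both ends precede their neighbors, so putting the hybrid block last, respectively
first, excludes it. `pvr_cycle` ensures that the cycle found in the network is the one of the
replacement.

For the existence of a pvr-network, (N4) makes least common ancestors unique, so the ancestor order
is a semilattice, and it restricts overlaps of incomparable elements (`ancestor_of_overlap`,
`not_three_overlap`). One representative of each child of a prime vertex is placed in this order;
primality of the quotient then forces two chains and one common vertex (`exists_isTwoCaterpillar`),
which are the two sides and the hybrid-vertex of the required elementary galled-tree. The absence of
nontrivial modules makes it strong and quasi-discriminating. -/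

theorem pair_sublist_trans {l : List α} (hl : l.Nodup) {a b c : α}
    (hab : [a, b] <+ l) (hbc : [b, c] <+ l) : [a, c] <+ l := by
  induction l with
  | nil => simp at hab
  | cons x l ih =>
    rw [List.nodup_cons] at hl
    rw [List.sublist_cons_iff] at hab hbc ⊢
    rcases hbc with hbc | ⟨r, hr, hbc⟩
    · have hc : c ∈ l := hbc.subset (by simp)
      rcases hab with hab | ⟨r, hr, hab⟩
      · exact Or.inl (ih hl.2 hab hbc)
      · simp only [List.cons.injEq] at hr
        exact Or.inr ⟨[c], by simp [hr.1], by simpa using hc⟩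
    · simp only [List.cons.injEq] at hr
      obtain ⟨rfl, rfl⟩ := hr
      rcases hab with hab | ⟨r, hr, hab⟩
      · exact absurd (hab.subset (by simp)) hl.1
      · simp only [List.cons.injEq] at hr
        obtain ⟨rfl, rfl⟩ := hr
        exact absurd (hab.subset (by simp)) hl.1

theorem exists_first_mem (l : List α) (C : Set α) (hC : ∃ x ∈ C, x ∈ l) :
    ∃ v ∈ C, v ∈ l ∧ ∀ w ∈ C, w ∈ l → w ≠ v → [v, w] <+ l := by
  induction l with
  | nil => simp at hC
  | cons x l ih =>
    by_cases hx : x ∈ C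
    · refine ⟨x, hx, by simp, fun w _ hwl hne => ?_⟩
      have : w ∈ l := by simpa [hne] using hwl
      simpa using this
    · obtain ⟨v, hv, hvl, h⟩ := ih (by
        obtain ⟨y, hy, hyl⟩ := hC
        refine ⟨y, hy, ?_⟩
        rcases List.mem_cons.1 hyl with rfl | h
        · exact absurd hy hx
        · exact h)
      refine ⟨v, hv, by simp [hvl], fun w hw hwl hne => ?_⟩
      rcases List.mem_cons.1 hwl with rfl | h'
      · exact absurd hw hx
      · exact (h w hw h' hne).cons _

end Lists

/-- `a - b - c - d` is an induced path. -/
structure IsP4 {X : Type*} (G : SimpleGraph X) (a b c d : X) : Prop where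
  ab : G.Adj a b
  bc : G.Adj b c
  cd : G.Adj c d
  ac : ¬ G.Adj a c
  bd : ¬ G.Adj b d
  ad : ¬ G.Adj a d

/-- No induced path `a - b - c - d` has `a` before `b` and `d` before `c` in the sequence. -/
def ObstructionFree {X : Type*} (G : SimpleGraph X) (l : List X) : Prop :=
  ∀ a b c d, IsP4 G a b c d → [a, b] <+ l → ¬ [d, c] <+ l

/-! ### Chvátal's theorem: greedy coloring along an obstruction-free sequence is optimal. -/

section Chvatal

variable {Y : Type*} {H : SimpleGraph Y} {l : List Y}

/-- Induction on the size of C. If the claim fails for C, the induction hypothesis for C without w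
yields f w in C whose p-value is adjacent to all of C except w. The missed vertex determines w, so f
is injective, hence a permutation of C, and following it back twice from the first vertex of C
produces an obstruction. -/
theorem exists_common_neighbor (hl : l.Nodup) (hH : ObstructionFree H l) (p : Y → Y) (n : ℕ) :
    ∀ C : Finset Y, C.card = n → C.Nonempty →
      (∀ u ∈ C, ∀ v ∈ C, u ≠ v → H.Adj u v) →
      (∀ w ∈ C, H.Adj w (p w) ∧ [p w, w] <+ l) →
      (∀ u ∈ C, ∀ v ∈ C, ¬ H.Adj (p u) (p v)) →
      ∃ w ∈ C, ∀ v ∈ C, H.Adj (p w) v := by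
  classical
  induction n with
  | zero => intro C hC hne; simp_all
  | succ n ih =>
    intro C hcard hne hclique hp hstable
    by_contra! hcon
    have hf : ∀ w : C, ∃ u : C, u ≠ w ∧ (∀ v ∈ C, v ≠ w → H.Adj (p u) v) ∧
        ¬ H.Adj (p u) w := by
      rintro ⟨w, hw⟩
      have hne' : (C.erase w).Nonempty := by
        rw [Finset.nonempty_iff_ne_empty]
        intro he
        have hCw : ∀ v ∈ C, v = w := fun v hv => by
          by_contra h
          have : v ∈ C.erase w := Finset.mem_erase.2 ⟨h, hv⟩
          simp [he] at this
        obtain ⟨v, hv, h⟩ := hcon w hw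
        rw [hCw v hv] at h
        exact h (hp w hw).1.symm
      obtain ⟨u, hu, h⟩ := ih (C.erase w) (by rw [Finset.card_erase_of_mem hw, hcard]; rfl) hne'
        (fun u hu v hv => hclique u (Finset.mem_of_mem_erase hu) v (Finset.mem_of_mem_erase hv))
        (fun u hu => hp u (Finset.mem_of_mem_erase hu))
        (fun u hu v hv => hstable u (Finset.mem_of_mem_erase hu) v (Finset.mem_of_mem_erase hv))
      rw [Finset.mem_erase] at hu
      have h' : ∀ v ∈ C, v ≠ w → H.Adj (p u) v := fun v hv hvw =>
        h v (Finset.mem_erase.2 ⟨hvw, hv⟩)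
      refine ⟨⟨u, hu.2⟩, fun e => hu.1 (congrArg Subtype.val e), h', fun hadj => ?_⟩
      obtain ⟨v, hv, hnv⟩ := hcon u hu.2
      by_cases hvw : v = w
      · exact hnv (hvw ▸ hadj)
      · exact hnv (h' v hv hvw)
    choose f hfne hfadj hfnot using hf
    have hinj : Function.Injective f := by
      intro w w' e
      by_contra hww
      exact hfnot w' (e ▸ hfadj w w' w'.2 fun e' => hww (Subtype.ext e'.symm))
    have hsurj : Function.Surjective f := Finite.surjective_of_injective hinj
    obtain ⟨x, hx⟩ := hne
    obtain ⟨v, hvC, hvl, hmin⟩ := exists_first_mem l (C : Set Y)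
      ⟨x, hx, (hp x hx).2.subset (by simp)⟩
    -- With f w = v and f b = w, the vertex p v misses only w and p w misses only b, so p v - b - w
    -- - p w is an induced path. As v comes first in C, p v precedes b as well as v.
    obtain ⟨w, hw⟩ := hsurj ⟨v, hvC⟩
    obtain ⟨b, hb⟩ := hsurj w
    have hbw : b ≠ w := fun e => hfne b (by rw [hb, e])
    have hbw' : b.1 ≠ w.1 := fun e => hbw (Subtype.ext e)
    have h1 := hfadj w b b.2 hbw'
    have h2 := hfnot w
    have h3 := hfnot b
    rw [hw] at h1 h2
    rw [hb] at h3
    refine hH (p v) b w (p w) ⟨h1, hclique _ b.2 _ w.2 hbw', (hp w w.2).1, h2,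
      fun e => h3 e.symm, hstable v hvC w w.2⟩ ?_ (hp w w.2).2
    by_cases hbv : b.1 = v
    · rw [hbv]; exact (hp v hvC).2
    · exact pair_sublist_trans hl (hp v hvC).2
        (hmin b b.2 ((hp b b.2).2.subset (by simp)) hbv)

/-- The color that the greedy algorithm gives to `v` when the coloring so far is `c`. -/
noncomputable def nextColor (H : SimpleGraph Y) (c : Y → ℕ) (v : Y) : ℕ :=
  sInf {k | 0 < k ∧ ∀ w, H.Adj v w → c w ≠ k}

open Classical in
theorem greedyColoring_concat (l : List Y) (v : Y) :
    greedyColoring H (l ++ [v]) =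
      Function.update (greedyColoring H l) v (nextColor H (greedyColoring H l) v) := by
  simp [greedyColoring, nextColor, List.foldl_append]

theorem nextColor_spec [Finite Y] (c : Y → ℕ) (v : Y) :
    0 < nextColor H c v ∧ ∀ w, H.Adj v w → c w ≠ nextColor H c v := by
  have hne : {k | 0 < k ∧ ∀ w, H.Adj v w → c w ≠ k}.Nonempty := by
    obtain ⟨B, hB⟩ := (Set.finite_range c).bddAbove
    refine ⟨B + 1, by omega, fun w _ e => ?_⟩
    have := hB ⟨w, rfl⟩
    omega
  exact Nat.sInf_mem hne

theorem exists_of_lt_nextColor (c : Y → ℕ) (v : Y) {k : ℕ} (hk : 0 < k)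
    (h : k < nextColor H c v) : ∃ w, H.Adj v w ∧ c w = k := by
  have := Nat.notMem_of_lt_sInf h
  simp only [mem_ofPred_eq, not_and, not_forall, not_not] at this
  obtain ⟨w, hw, e⟩ := this hk
  exact ⟨w, hw, e⟩

/-- Induction on the end of the list: coloring the last vertex changes no earlier value. In the last
clause, minimality of the new color provides a neighbor of color k, and it already occurs in the
list because uncolored vertices have value 0. -/
theorem greedyColoring_spec [Finite Y] (l : List Y) (hl : l.Nodup) :
    (∀ v, v ∉ l → greedyColoring H l v = 0) ∧
    (∀ v ∈ l, 0 < greedyColoring H l v) ∧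
    (∀ v ∈ l, ∀ w ∈ l, H.Adj v w → greedyColoring H l v ≠ greedyColoring H l w) ∧
    ∀ v ∈ l, ∀ k, 0 < k → k < greedyColoring H l v →
      ∃ w, H.Adj v w ∧ greedyColoring H l w = k ∧ [w, v] <+ l := by
  classical
  induction l using List.reverseRecOn with
  | nil => simp [greedyColoring]
  | append_singleton l v ih =>
    rw [List.nodup_append] at hl
    obtain ⟨hl, -, hlv⟩ := hl
    have hv : v ∉ l := fun h => hlv v h v (by simp) rfl
    obtain ⟨h0, hpos, hproper, hprev⟩ := ih hl
    have hold : ∀ u ∈ l, greedyColoring H (l ++ [v]) u = greedyColoring H l u := by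
      intro u hu
      rw [greedyColoring_concat, Function.update_of_ne]
      rintro rfl
      exact hv hu
    have hnew : greedyColoring H (l ++ [v]) v = nextColor H (greedyColoring H l) v := by
      rw [greedyColoring_concat, Function.update_self]
    obtain ⟨hs1, hs2⟩ := nextColor_spec (H := H) (greedyColoring H l) v
    refine ⟨fun u hu => ?_, fun u hu => ?_, fun u hu w hw huw => ?_, fun u hu k hk hlt => ?_⟩
    · simp only [List.mem_append, List.mem_singleton, not_or] at hu
      rw [greedyColoring_concat, Function.update_of_ne hu.2, h0 u hu.1]
    · rcases List.mem_append.1 hu with hu | hu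
      · rw [hold u hu]; exact hpos u hu
      · rw [List.mem_singleton.1 hu, hnew]; exact hs1
    · rcases List.mem_append.1 hu with hu' | hu' <;> rcases List.mem_append.1 hw with hw' | hw'
      · rw [hold u hu', hold w hw']; exact hproper u hu' w hw' huw
      · rw [List.mem_singleton] at hw'
        subst hw'
        rw [hold u hu', hnew]; exact hs2 u huw.symm
      · rw [List.mem_singleton] at hu'
        subst hu'
        rw [hold w hw', hnew]; exact (hs2 w huw).symm
      · rw [List.mem_singleton] at hu' hw'
        exact absurd (hu'.trans hw'.symm) huw.ne
    · rcases List.mem_append.1 hu with hu | hu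
      · rw [hold u hu] at hlt
        obtain ⟨w, hw, hwk, hs⟩ := hprev u hu k hk hlt
        exact ⟨w, hw, by rw [hold w (hs.subset (by simp)), hwk],
          hs.trans (List.sublist_append_left _ _)⟩
      · rw [List.mem_singleton] at hu
        subst hu
        rw [hnew] at hlt
        obtain ⟨w, hw, hwk⟩ := exists_of_lt_nextColor _ _ hk hlt
        have hwl : w ∈ l := by
          by_contra h
          rw [h0 w h] at hwk
          omega
        exact ⟨w, hw, by rw [hold w hwl, hwk],
          List.Sublist.append (List.singleton_sublist.2 hwl) (List.Sublist.refl [u])⟩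

theorem exists_clique_of_greedy [Finite Y] (hl : Enumerates l univ) (hH : ObstructionFree H l)
    {v : Y} {n : ℕ} (hn : greedyColoring H l v = n) :
    ∃ C : Finset Y, H.IsClique (C : Set Y) ∧ C.card = n := by
  classical
  obtain ⟨-, hpos, hproper, hprev⟩ := greedyColoring_spec (H := H) l hl.1
  have hmem : ∀ u, u ∈ l := fun u => (hl.2 u).2 (mem_univ u)
  -- The clique of size m + 1 uses only colors at least n - m, stated without truncated subtraction.
  -- Hence each of its vertices has an earlier neighbor of color n - (m + 1), and these neighbors
  -- are pairwise nonadjacent because they share a color.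
  have key : ∀ m, m < n → ∃ C : Finset Y, H.IsClique (C : Set Y) ∧ C.card = m + 1 ∧
      ∀ u ∈ C, n < greedyColoring H l u + m + 1 := by
    intro m
    induction m with
    | zero =>
      intro _
      exact ⟨{v}, by simp, by simp, by simp [hn]⟩
    | succ m ih =>
      intro hm
      obtain ⟨C, hC, hcard, hcol⟩ := ih (by omega)
      have hex : ∀ w, ∃ p, w ∈ C →
          H.Adj w p ∧ greedyColoring H l p = n - (m + 1) ∧ [p, w] <+ l := by
        intro w
        by_cases hw : w ∈ C
        · obtain ⟨p, hp⟩ := hprev w (hmem w) (n - (m + 1)) (by omega)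
            (by have := hcol w hw; omega)
          exact ⟨p, fun _ => hp⟩
        · exact ⟨w, fun h => absurd h hw⟩
      choose p hp using hex
      obtain ⟨w, hw, hwC⟩ := exists_common_neighbor hl.1 hH p _ C rfl
        (by rw [← Finset.card_pos]; omega)
        (fun u hu x hx hne => hC hu hx hne)
        (fun w hw => ⟨(hp w hw).1, (hp w hw).2.2⟩)
        (fun u hu x hx hadj => hproper _ (hmem _) _ (hmem _) hadj
          ((hp u hu).2.1.trans (hp x hx).2.1.symm))
      refine ⟨insert (p w) C, ?_, ?_, ?_⟩
      · rw [Finset.coe_insert]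
        exact hC.insert fun b hb _ => hwC b hb
      · rw [Finset.card_insert_of_notMem, hcard]
        intro h
        exact (hwC _ h).ne rfl
      · intro u hu
        rcases Finset.mem_insert.1 hu with rfl | hu
        · rw [(hp w hw).2.1]; omega
        · have := hcol u hu; omega
  have hn' := hpos v (hmem v)
  obtain ⟨C, hC, hcard, -⟩ := key (n - 1) (by omega)
  exact ⟨C, hC, by omega⟩

/-- The number of colors is squeezed: it is at most the largest color, which is the size of a
clique, and at least the chromatic number because the coloring is proper. -/
theorem greedyColoring_optimal [Finite Y] (hl : Enumerates l univ) (hH : ObstructionFree H l) :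
    ((range (greedyColoring H l)).ncard : ℕ∞) = H.chromaticNumber := by
  classical
  obtain ⟨-, hpos, hproper, hprev⟩ := greedyColoring_spec (H := H) l hl.1
  have hmem : ∀ u, u ∈ l := fun u => (hl.2 u).2 (mem_univ u)
  have hfin : (range (greedyColoring H l)).Finite := Set.finite_range _
  apply le_antisymm
  · rcases isEmpty_or_nonempty Y with hY | hY
    · simp [hY]
    · obtain ⟨v, hv⟩ := Finite.exists_max (greedyColoring H l)
      obtain ⟨C, hC, hcard⟩ := exists_clique_of_greedy hl hH (v := v) rfl
      have hle : (range (greedyColoring H l)).ncard ≤ C.card := by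
        rw [hcard]
        have hsub : range (greedyColoring H l) ⊆ Set.Icc 1 (greedyColoring H l v) := by
          rintro _ ⟨u, rfl⟩
          exact ⟨hpos u (hmem u), hv u⟩
        refine (Set.ncard_le_ncard hsub (Set.finite_Icc _ _)).trans ?_
        rw [← Finset.coe_Icc, Set.ncard_coe_finset]
        simp
      exact le_trans (by exact_mod_cast hle) hC.card_le_chromaticNumber
  · have : Fintype (range (greedyColoring H l)) := hfin.fintype
    let c : H.Coloring (range (greedyColoring H l)) := SimpleGraph.Coloring.mk
      (fun v => ⟨greedyColoring H l v, v, rfl⟩)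
      (fun {u v} huv e => hproper u (hmem u) v (hmem v) huv (congrArg Subtype.val e))
    have := c.colorable.chromaticNumber_le
    rwa [← Nat.card_eq_fintype_card, Nat.card_coe_set_eq] at this

end Chvatal

/-- The sequence `l` enumerates `S` without obstructions. -/
def IsGoodOrder {X : Type*} (G : SimpleGraph X) (S : Set X) (l : List X) : Prop :=
  Enumerates l S ∧ ObstructionFree G l

theorem restrictOrder_map_val {X : Type*} (o : List X) (Y : Set X) :
    (restrictOrder o Y).map Subtype.val <+ o := by
  classical
  induction o with
  | nil => simp [restrictOrder]
  | cons x o ih =>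
    by_cases hx : x ∈ Y
    · simp only [restrictOrder, List.filterMap_cons, hx, dite_true, List.map_cons] at ih ⊢
      exact ih.cons_cons x
    · simp only [restrictOrder, List.filterMap_cons, hx, dite_false] at ih ⊢
      exact ih.cons x

theorem IsGoodOrder.isPerfectOrder {X : Type*} [Finite X] {G : SimpleGraph X} {o : List X}
    (h : IsGoodOrder G univ o) : IsPerfectOrder G o := by
  classical
  refine ⟨h.1, fun Y => greedyColoring_optimal ⟨?_, fun a => ?_⟩ ?_⟩
  · exact List.Nodup.of_map _ ((restrictOrder_map_val o Y).nodup h.1.1)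
  · simp only [restrictOrder, List.mem_filterMap, mem_univ, iff_true]
    exact ⟨a, (h.1.2 a).2 (mem_univ _), by simp⟩
  · intro a b c d hP hab hdc
    have hsub : ∀ {u v : Y}, [u, v] <+ restrictOrder o Y → [u.1, v.1] <+ o := fun huv =>
      ((huv.map Subtype.val).trans (restrictOrder_map_val o Y))
    exact h.2 a b c d ⟨hP.ab, hP.bc, hP.cd, hP.ac, hP.bd, hP.ad⟩ (hsub hab) (hsub hdc)

end GaTEx

namespace GaTEx

open Set
open scoped List

/-! ### Strong modules -/

section Modules

variable {X : Type*} {G : SimpleGraph X} {M : Set X}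

theorem isStrongModuleOn_singleton {x : X} (hx : x ∈ M) : IsStrongModuleOn G M {x} := by
  refine ⟨⟨by simpa using hx, ?_⟩, fun S' _ => ?_⟩
  · rintro a rfl b rfl z - -
    exact Iff.rfl
  · by_cases h : x ∈ S'
    · exact Or.inl (inter_eq_left.2 (by simpa using h))
    · exact Or.inr (Or.inr (by simpa using h))

theorem isStrongModuleOn_self : IsStrongModuleOn G M M :=
  ⟨⟨subset_rfl, fun _ _ _ _ _ hz hz' => absurd hz hz'⟩,
    fun _ hS' => Or.inr (Or.inl (inter_eq_right.2 hS'.1))⟩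

theorem IsStrongModuleOn.restrict {S : Set X} (hM : IsStrongModuleOn G univ M)
    (hS : IsStrongModuleOn G univ S) (hSM : S ⊆ M) : IsStrongModuleOn G M S := by
  refine ⟨⟨hSM, fun x hx y hy z _ hz => hS.1.2 x hx y hy z (mem_univ _) hz⟩, fun S' hS' => ?_⟩
  refine hS.2 S' ⟨subset_univ _, fun x hx y hy z _ hz => ?_⟩
  by_cases hzM : z ∈ M
  · exact hS'.2 x hx y hy z hzM hz
  · exact hM.1.2 x (hS'.1 hx) y (hS'.1 hy) z (mem_univ _) hzM

theorem maxStrong_subset {S : Set X} (hS : S ∈ maxStrong G M) : S ⊆ M := hS.1.2.1.1.1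

theorem maxStrong_nonempty {S : Set X} (hS : S ∈ maxStrong G M) : S.Nonempty := hS.1.1

theorem maxStrong_module {S : Set X} (hS : S ∈ maxStrong G M) : IsModuleOn G M S := hS.1.2.1.1

theorem maxStrong_ne {S : Set X} (hS : S ∈ maxStrong G M) : S ≠ M := hS.1.2.2

theorem maxStrong_eq_of_mem {S T : Set X} (hS : S ∈ maxStrong G M) (hT : T ∈ maxStrong G M)
    {x : X} (hxS : x ∈ S) (hxT : x ∈ T) : S = T := by
  rcases hS.1.2.1.2 T hT.1.2.1.1 with h | h | h
  · exact subset_antisymm (inter_eq_left.1 h) (hS.2 hT.1 (inter_eq_left.1 h))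
  · exact subset_antisymm (hT.2 hS.1 (inter_eq_right.1 h)) (inter_eq_right.1 h)
  · exact absurd (h ▸ ⟨hxS, hxT⟩ : x ∈ (∅ : Set X)) (notMem_empty x)

theorem exists_maxStrong_superset [Finite X] {S : Set X} (hne : S.Nonempty)
    (hS : IsStrongModuleOn G M S) (hSM : S ≠ M) : ∃ T ∈ maxStrong G M, S ⊆ T := by
  obtain ⟨T, hST, hT⟩ := (Set.toFinite
    {S | S.Nonempty ∧ IsStrongModuleOn G M S ∧ S ≠ M}).exists_le_maximal ⟨hne, hS, hSM⟩
  exact ⟨T, hT, hST⟩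

theorem exists_maxStrong_mem [Finite X] (hM : M.ncard ≠ 1) {x : X} (hx : x ∈ M) :
    ∃ S ∈ maxStrong G M, x ∈ S := by
  obtain ⟨T, hT, hxT⟩ := exists_maxStrong_superset (singleton_nonempty x)
    (isStrongModuleOn_singleton (G := G) hx) (by rintro rfl; simp at hM)
  exact ⟨T, hT, hxT rfl⟩

/-- Identifies the children in the tree with the blocks of the quotient. It rests on the fact that,
inside a strong module M, being strong in G and being strong in G[M] are the same. -/
theorem covBy_iff_mem_maxStrong (c M : MDVertex G) : c ⋖ M ↔ c.1 ∈ maxStrong G M.1 := by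
  constructor
  · rintro ⟨hlt, h⟩
    refine ⟨⟨c.2.1, M.2.2.restrict c.2.2 hlt.le, fun e => hlt.ne (Subtype.ext e)⟩, ?_⟩
    rintro S ⟨hne, hS, hSM⟩ hcS
    by_contra hnot
    let d : MDVertex G := ⟨S, hne, M.2.2.trans hS⟩
    exact h (c := d) (lt_of_le_not_ge hcS hnot)
      (lt_of_le_of_ne hS.1.1 fun e => hSM (congrArg Subtype.val e))
  · intro h
    refine ⟨lt_of_le_of_ne h.1.2.1.1.1 fun e => h.1.2.2 (congrArg Subtype.val e), ?_⟩
    intro d hcd hdM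
    exact hcd.not_ge (h.2 ⟨d.2.1, M.2.2.restrict d.2.2 hdM.le, fun e => hdM.ne (Subtype.ext e)⟩
      hcd.le)

theorem maxStrong_compl : maxStrong Gᶜ M = maxStrong G M := by
  have h : ∀ S, IsModuleOn Gᶜ M S ↔ IsModuleOn G M S := by
    intro S
    unfold IsModuleOn
    refine and_congr_right fun _ => forall₄_congr fun x hx y hy => forall₃_congr fun z _ hz => ?_
    have hx' : x ≠ z := fun e => hz (e ▸ hx)
    have hy' : y ≠ z := fun e => hz (e ▸ hy)
    simp only [SimpleGraph.compl_adj, ne_eq, hx', hy', not_false_eq_true, true_and]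
    exact not_iff_not
  simp only [maxStrong, IsStrongModuleOn, h]

/-- A connected graph has an edge across every cut. -/
theorem exists_adj_across (H : SimpleGraph M) {x y : M} (hxy : H.Reachable x y) {T : Set X}
    (hx : x.1 ∈ T) (hy : y.1 ∉ T) : ∃ a b : M, a.1 ∈ T ∧ b.1 ∉ T ∧ H.Reachable x a ∧ H.Adj a b := by
  rw [SimpleGraph.reachable_iff_reflTransGen] at hxy
  induction hxy with
  | refl => exact absurd hx hy
  | @tail b c hb hbc ih =>
    by_cases hbT : b.1 ∈ T
    · exact ⟨b, c, hbT, hy, (SimpleGraph.reachable_iff_reflTransGen _ _).2 hb, hbc⟩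
    · exact ih hbT

/-- The connected component K of x is a strong module. If a module S' meets K without containing it,
some edge of K leaves S'; its outer end is then adjacent to all of S', so S' lies in K. As K is
proper, it lies in a single maximal strong module, which would contain both ends of an edge from x
to y. -/
theorem not_adj_of_not_connected [Finite X] (hcon : ¬ (G.induce M).Connected) {S T : Set X} (hS : S ∈ maxStrong G M)
    (hT : T ∈ maxStrong G M) (hST : S ≠ T) {x y : X} (hx : x ∈ S) (hy : y ∈ T) :
    ¬ G.Adj x y := by
  intro hadj
  have hxM := maxStrong_subset hS hx
  have hyM := maxStrong_subset hT hy
  let K : Set X := {z | ∃ hz : z ∈ M, (G.induce M).Reachable ⟨x, hxM⟩ ⟨z, hz⟩}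
  have hxK : x ∈ K := ⟨hxM, SimpleGraph.Reachable.refl _⟩
  have hstep : ∀ z z' (hz' : z' ∈ M), z ∈ K → G.Adj z z' → z' ∈ K := by
    rintro z z' hz' ⟨hz, hr⟩ h
    exact ⟨hz', hr.trans (SimpleGraph.Adj.reachable (G := G.induce M) (u := ⟨z, hz⟩)
      (v := ⟨z', hz'⟩) h)⟩
  have hyK : y ∈ K := hstep x y hyM hxK hadj
  have hKM : K ⊆ M := fun z hz => hz.1
  have hK : IsStrongModuleOn G M K := by
    refine ⟨⟨hKM, fun a ha b hb z hz hzK => ?_⟩, fun S' hS' => ?_⟩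
    · exact ⟨fun h => absurd (hstep a z hz ha h) hzK, fun h => absurd (hstep b z hz hb h) hzK⟩
    · by_cases hsub : K ⊆ S'
      · exact Or.inl (inter_eq_left.2 hsub)
      by_cases hemp : K ∩ S' = ∅
      · exact Or.inr (Or.inr hemp)
      refine Or.inr (Or.inl (inter_eq_right.2 fun s hs => ?_))
      obtain ⟨k', hk', hk'S⟩ := not_subset.1 hsub
      obtain ⟨k, hk, hkS⟩ := nonempty_iff_ne_empty.2 hemp
      obtain ⟨a, b, haS, hbS, hr, hab⟩ := exists_adj_across (G.induce M)
        (hk.2.symm.trans hk'.2) (T := S') hkS hk'S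
      have haK : a.1 ∈ K := ⟨a.2, hk.2.trans hr⟩
      have hbK : b.1 ∈ K := hstep a b b.2 haK hab
      exact hstep b s (hS'.1 hs) hbK ((hS'.2 a haS s hs b b.2 hbS).1 hab).symm
  have hne : K ≠ M := by
    rintro e
    apply hcon
    have : Nonempty M := ⟨⟨x, hxM⟩⟩
    refine ⟨fun a b => ?_⟩
    have ha : a.1 ∈ K := e.ge a.2
    have hb : b.1 ∈ K := e.ge b.2
    exact ha.2.symm.trans hb.2
  obtain ⟨U, hU, hKU⟩ := exists_maxStrong_superset ⟨x, hxK⟩ hK hne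
  exact hST ((maxStrong_eq_of_mem hS hU hx (hKU hxK)).trans
    (maxStrong_eq_of_mem hU hT (hKU hyK) hy))

theorem adj_of_not_compl_connected [Finite X] (hcon : ¬ (G.induce M)ᶜ.Connected) {S T : Set X} (hS : S ∈ maxStrong G M)
    (hT : T ∈ maxStrong G M) (hST : S ≠ T) {x y : X} (hx : x ∈ S) (hy : y ∈ T) :
    G.Adj x y := by
  have he : (G.induce M)ᶜ = Gᶜ.induce M := by
    ext a b
    simp [SimpleGraph.compl_adj, Subtype.ext_iff]
  rw [he] at hcon
  rw [← maxStrong_compl] at hS hT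
  have := not_adj_of_not_connected hcon hS hT hST hx hy
  rw [SimpleGraph.compl_adj] at this
  by_contra h
  refine this ⟨?_, h⟩
  rintro rfl
  exact hST (maxStrong_eq_of_mem hS hT hx hy)

/-- For prime M, even an arbitrary proper module lies in a block: a maximal proper module A is
strong, since a module B overlapping it would disconnect G[M] or its complement. -/
theorem exists_maxStrong_superset_of_module [Finite X] (hcon : (G.induce M).Connected)
    (hco : (G.induce M)ᶜ.Connected) {U : Set X} (hne : U.Nonempty) (hU : IsModuleOn G M U)
    (hUM : U ≠ M) : ∃ S ∈ maxStrong G M, U ⊆ S := by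
  obtain ⟨A, hUA, hA⟩ := (Set.toFinite
    {S | IsModuleOn G M S ∧ S ≠ M}).exists_le_maximal ⟨hU, hUM⟩
  obtain ⟨⟨hAM, hAmod⟩, hAne⟩ := hA.1
  suffices h : IsStrongModuleOn G M A by
    obtain ⟨S, hS, hAS⟩ := exists_maxStrong_superset (hne.mono hUA) h hAne
    exact ⟨S, hS, hUA.trans hAS⟩
  refine ⟨hA.1.1, fun B hB => ?_⟩
  by_contra! hov
  obtain ⟨hnA, hnB, hne'⟩ := hov
  obtain ⟨i, hiA, hiB⟩ := hne'
  obtain ⟨z, hzA, hzB⟩ : ∃ z ∈ A, z ∉ B := not_subset.1 fun h => hnA (inter_eq_left.2 h)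
  obtain ⟨b, hbB, hbA⟩ : ∃ b ∈ B, b ∉ A := not_subset.1 fun h => hnB (inter_eq_right.2 h)
  -- The union of overlapping modules is a module (compare both through the common vertex i), so
  -- maximality of A leaves only M.
  have hun : A ∪ B = M := by
    by_contra hAB
    refine hbA (hA.2 (y := A ∪ B) ⟨⟨union_subset hAM hB.1, ?_⟩, hAB⟩ subset_union_left
      (Or.inr hbB))
    have key : ∀ x ∈ A ∪ B, ∀ w ∈ M, w ∉ A ∪ B → (G.Adj x w ↔ G.Adj i w) := by
      rintro x (hx | hx) w hw hwAB
      · exact hAmod x hx i hiA w hw fun h => hwAB (Or.inl h)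
      · exact hB.2 x hx i hiB w hw fun h => hwAB (Or.inr h)
    exact fun x hx y hy w hw hwAB => (key x hx w hw hwAB).trans (key y hy w hw hwAB).symm
  -- All pairs across the cut between A \ B and B behave alike: first move the end in B, using that
  -- B is a module, then the end in A. Connectedness of G[M] gives an adjacent pair across this cut,
  -- that of the complement a nonadjacent one.
  have hconst : ∀ z' ∈ A, z' ∉ B → ∀ b' ∈ B, (G.Adj z' b' ↔ G.Adj z b) := by
    intro z' hz' hz'B b' hb'
    have h1 := hB.2 b' hb' b hbB z' (hAM hz') hz'B
    have h2 := hAmod z' hz' z hzA b (hB.1 hbB) hbA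
    rw [G.adj_comm z' b', h1, G.adj_comm b z', h2]
  have hcross : ∀ H : SimpleGraph M, H.Connected →
      ∃ a' b' : M, (a'.1 ∈ A ∧ a'.1 ∉ B) ∧ b'.1 ∈ B ∧ H.Adj a' b' := by
    intro H hH
    obtain ⟨a', b', ha', hb', -, hadj⟩ := exists_adj_across H
      (hH.preconnected ⟨z, hAM hzA⟩ ⟨b, hB.1 hbB⟩) (T := A \ B) ⟨hzA, hzB⟩ (fun h => hbA h.1)
    refine ⟨a', b', ha', ?_, hadj⟩
    have : b'.1 ∈ A ∪ B := hun ▸ b'.2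
    by_contra h
    exact hb' ⟨this.resolve_right h, h⟩
  obtain ⟨a₁, b₁, ⟨h1, h1'⟩, h2, h3⟩ := hcross _ hcon
  obtain ⟨a₂, b₂, ⟨h4, h4'⟩, h5, h6⟩ := hcross _ hco
  rw [SimpleGraph.compl_adj] at h6
  exact h6.2 ((hconst a₂ h4 h4' b₂ h5).2 ((hconst a₁ h1 h1' b₁ h2).1 h3))

/-- The path on four vertices is prime: its only modules with more than one vertex are the whole
path. The proof checks every possible trace of S on the path. -/
theorem IsP4.mem_module {S : Set X} (hS : IsModuleOn G M S) {a b c d : X}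
    (h : IsP4 G a b c d) (ha : a ∈ M) (hb : b ∈ M) (hc : c ∈ M) (hd : d ∈ M)
    (h2 : (a ∈ S ∧ b ∈ S) ∨ (a ∈ S ∧ c ∈ S) ∨ (a ∈ S ∧ d ∈ S) ∨ (b ∈ S ∧ c ∈ S) ∨
      (b ∈ S ∧ d ∈ S) ∨ (c ∈ S ∧ d ∈ S)) : a ∈ S ∧ b ∈ S ∧ c ∈ S ∧ d ∈ S := by
  obtain ⟨hab, hbc, hcd, hac, hbd, had⟩ := h
  have hS' := hS.2
  have e1 := G.adj_comm a b
  have e2 := G.adj_comm b c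
  have e3 := G.adj_comm c d
  have e4 := G.adj_comm a c
  have e5 := G.adj_comm b d
  have e6 := G.adj_comm a d
  by_cases hA : a ∈ S <;> by_cases hB : b ∈ S <;> by_cases hC : c ∈ S <;>
    by_cases hD : d ∈ S <;> grind

end Modules

/-! ### Concatenating good orders of the blocks -/

/-- The order of two entries of a concatenation of disjoint blocks is decided inside their block if
they share it, and by the order of the blocks otherwise. -/
theorem pair_sublist_flatMap {ι X : Type*} {ks : List ι} {g : ι → List X} (hnd : ks.Nodup)
    (hdis : ∀ i ∈ ks, ∀ j ∈ ks, ∀ x, x ∈ g i → x ∈ g j → i = j) {i j : ι} (hi : i ∈ ks)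
    (hj : j ∈ ks) {a b : X} (ha : a ∈ g i) (hb : b ∈ g j) (h : [a, b] <+ ks.flatMap g) :
    (i = j → [a, b] <+ g i) ∧ (i ≠ j → [i, j] <+ ks) := by
  induction ks with
  | nil => simp at hi
  | cons k ks ih =>
    rw [List.nodup_cons] at hnd
    have hrest : ∀ {x m}, m ∈ k :: ks → x ∈ g m → x ∈ ks.flatMap g → m ∈ ks := by
      intro x m hm hx hx'
      obtain ⟨m', hm', hxm'⟩ := List.mem_flatMap.1 hx'
      rwa [hdis m hm m' (List.mem_cons_of_mem _ hm') x hx hxm']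
    have hk : ∀ {x m}, m ∈ k :: ks → x ∈ g m → x ∈ g k → m = k := fun {x m} hm hx hx' =>
      hdis m hm k (by simp) x hx hx'
    rw [List.flatMap_cons, List.sublist_append_iff] at h
    obtain ⟨l₁, l₂, he, h1, h2⟩ := h
    match l₁, he with
    | [], he =>
      simp only [List.nil_append] at he
      subst he
      have hi' := hrest hi ha (h2.subset (by simp))
      have hj' := hrest hj hb (h2.subset (by simp))
      obtain ⟨h3, h4⟩ := ih hnd.2
        (fun i hi j hj => hdis i (List.mem_cons_of_mem _ hi) j (List.mem_cons_of_mem _ hj))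
        hi' hj' h2
      exact ⟨h3, fun hne => (h4 hne).cons k⟩
    | [x], he =>
      simp only [List.cons_append, List.nil_append, List.cons.injEq] at he
      obtain ⟨rfl, rfl⟩ := he
      have hik := hk hi ha (h1.subset (by simp))
      have hj' := hrest hj hb (h2.subset (by simp))
      subst hik
      exact ⟨fun e => absurd (e ▸ hj') hnd.1, fun _ => by simpa using hj'⟩
    | x :: y :: l, he =>
      simp only [List.cons_append, List.cons.injEq, List.nil_eq,
        List.append_eq_nil_iff] at he
      obtain ⟨rfl, rfl, rfl, rfl⟩ := he
      have hik := hk hi ha (h1.subset (by simp))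
      have hjk := hk hj hb (h1.subset (by simp))
      subst hik
      exact ⟨fun _ => h1, fun hne => absurd hjk.symm hne⟩

/-- An obstruction lies either in one block, where the given sequence excludes it, or in four
different blocks, because blocks are modules. Only the second kind is left to the hypothesis `hobs`,
which sees just the order of the blocks. -/
theorem isGoodOrder_flatMap {ι X : Type*} {G : SimpleGraph X} {M : Set X} {ks : List ι}
    {S : ι → Set X} {g : ι → List X} (hnd : (ks.map S).Nodup)
    (hks : ∀ T, T ∈ ks.map S ↔ T ∈ maxStrong G M)
    (hcov : ∀ x ∈ M, ∃ T ∈ maxStrong G M, x ∈ T)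
    (hg : ∀ i ∈ ks, IsGoodOrder G (S i) (g i))
    (hobs : ∀ i ∈ ks, ∀ j ∈ ks, ∀ k ∈ ks, ∀ m ∈ ks, [S i, S j, S k, S m].Nodup →
      [i, j] <+ ks → [m, k] <+ ks → ∀ a ∈ S i, ∀ b ∈ S j, ∀ c ∈ S k, ∀ d ∈ S m,
        ¬ IsP4 G a b c d) :
    IsGoodOrder G M (ks.flatMap g) := by
  have hinj := List.inj_on_of_nodup_map hnd
  have hmax : ∀ i ∈ ks, S i ∈ maxStrong G M := fun i hi =>
    (hks _).1 (List.mem_map_of_mem hi)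
  have hmem : ∀ i ∈ ks, ∀ x, x ∈ g i ↔ x ∈ S i := fun i hi => (hg i hi).1.2
  have hdis : ∀ i ∈ ks, ∀ j ∈ ks, ∀ x, x ∈ g i → x ∈ g j → i = j := fun i hi j hj x hx hx' =>
    hinj hi hj (maxStrong_eq_of_mem (hmax i hi) (hmax j hj) ((hmem i hi x).1 hx)
      ((hmem j hj x).1 hx'))
  have hblock : ∀ x ∈ M, ∃ i ∈ ks, x ∈ S i := by
    intro x hx
    obtain ⟨T, hT, hxT⟩ := hcov x hx
    obtain ⟨i, hi, rfl⟩ := List.mem_map.1 ((hks T).2 hT)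
    exact ⟨i, hi, hxT⟩
  have hmemM : ∀ x, x ∈ ks.flatMap g ↔ x ∈ M := by
    intro x
    rw [List.mem_flatMap]
    constructor
    · rintro ⟨i, hi, hx⟩
      exact maxStrong_subset (hmax i hi) ((hmem i hi x).1 hx)
    · intro hx
      obtain ⟨i, hi, hxi⟩ := hblock x hx
      exact ⟨i, hi, (hmem i hi x).2 hxi⟩
  have hksnd : ks.Nodup := hnd.of_map
  refine ⟨⟨?_, hmemM⟩, ?_⟩
  · rw [List.nodup_flatMap]
    refine ⟨fun i hi => (hg i hi).1.1, ?_⟩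
    refine List.Pairwise.imp_of_mem ?_ hksnd
    intro i j hi hj hne x hx hx'
    exact hne (hdis i hi j hj x hx hx')
  · intro a b c d hP hab hdc
    have haM := (hmemM a).1 (hab.subset (by simp))
    have hbM := (hmemM b).1 (hab.subset (by simp))
    have hcM := (hmemM c).1 (hdc.subset (by simp))
    have hdM := (hmemM d).1 (hdc.subset (by simp))
    obtain ⟨i, hi, hai⟩ := hblock a haM
    obtain ⟨j, hj, hbj⟩ := hblock b hbM
    obtain ⟨k, hk, hck⟩ := hblock c hcM
    obtain ⟨m, hm, hdm⟩ := hblock d hdM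
    have hij := pair_sublist_flatMap hksnd hdis hi hj ((hmem i hi a).2 hai)
      ((hmem j hj b).2 hbj) hab
    have hmk := pair_sublist_flatMap hksnd hdis hm hk ((hmem m hm d).2 hdm)
      ((hmem k hk c).2 hck) hdc
    by_cases hall : ∃ n ∈ ks, a ∈ S n ∧ b ∈ S n ∧ c ∈ S n ∧ d ∈ S n
    · obtain ⟨n, hn, h1, h2, h3, h4⟩ := hall
      have hu : ∀ {x p}, p ∈ ks → x ∈ S p → x ∈ S n → p = n := fun {x p} hp hx hx' =>
        hinj hp hn (maxStrong_eq_of_mem (hmax p hp) (hmax n hn) hx hx')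
      obtain rfl := hu hi hai h1
      obtain rfl := hu hj hbj h2
      obtain rfl := hu hk hck h3
      obtain rfl := hu hm hdm h4
      exact (hg _ hn).2 a b c d hP (hij.1 rfl) (hmk.1 rfl)
    · have hno : ∀ n ∈ ks, ¬ ((a ∈ S n ∧ b ∈ S n) ∨ (a ∈ S n ∧ c ∈ S n) ∨ (a ∈ S n ∧ d ∈ S n) ∨
          (b ∈ S n ∧ c ∈ S n) ∨ (b ∈ S n ∧ d ∈ S n) ∨ (c ∈ S n ∧ d ∈ S n)) := fun n hn h =>
        hall ⟨n, hn, hP.mem_module (maxStrong_module (hmax n hn)) haM hbM hcM hdM h⟩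
      have hni := hno i hi
      have hnj := hno j hj
      have hnk := hno k hk
      have h1 : S i ≠ S j := fun e => hni (Or.inl ⟨hai, e ▸ hbj⟩)
      have h2 : S i ≠ S k := fun e => hni (Or.inr (Or.inl ⟨hai, e ▸ hck⟩))
      have h3 : S i ≠ S m := fun e => hni (Or.inr (Or.inr (Or.inl ⟨hai, e ▸ hdm⟩)))
      have h4 : S j ≠ S k := fun e => hnj (Or.inr (Or.inr (Or.inr (Or.inl ⟨hbj, e ▸ hck⟩))))
      have h5 : S j ≠ S m := fun e =>
        hnj (Or.inr (Or.inr (Or.inr (Or.inr (Or.inl ⟨hbj, e ▸ hdm⟩)))))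
      have h6 : S k ≠ S m := fun e =>
        hnk (Or.inr (Or.inr (Or.inr (Or.inr (Or.inr ⟨hck, e ▸ hdm⟩)))))
      exact hobs i hi j hj k hk m hm (by simp [h1, h2, h3, h4, h5, h6])
        (hij.2 fun e => h1 (e ▸ rfl)) (hmk.2 fun e => h6 (e ▸ rfl)) a hai b hbj c hck d hdm hP

end GaTEx

namespace GaTEx

open Set
open scoped List

/-! ### Consecutive pairs in lists -/

section Infix

variable {α : Type*}

theorem pair_infix_cons_concat {a b u v : α} {l : List α} (h : [u, v] <:+: a :: (l ++ [b])) :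
    u ∈ a :: l ∧ v ∈ l ++ [b] := by
  induction l generalizing a with
  | nil =>
    rw [List.nil_append, List.infix_cons_iff] at h
    rcases h with h | h
    · obtain ⟨t, ht⟩ := h
      simp only [List.cons_append, List.nil_append, List.cons.injEq] at ht
      simp [ht.1, ht.2.1]
    · have := h.length_le
      simp at this
  | cons c l ih =>
    rw [List.cons_append, List.infix_cons_iff] at h
    rcases h with h | h
    · obtain ⟨t, ht⟩ := h
      simp only [List.cons_append, List.nil_append, List.cons.injEq] at ht
      simp [ht.1, ht.2.1]
    · obtain ⟨h1, h2⟩ := ih h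
      exact ⟨List.mem_cons_of_mem _ h1, List.mem_cons_of_mem _ h2⟩

theorem pair_infix_left_unique {l : List α} (hl : l.Nodup) {u u' v : α} (h : [u, v] <:+: l)
    (h' : [u', v] <:+: l) : u = u' := by
  induction l with
  | nil => simp at h
  | cons a l ih =>
    rw [List.nodup_cons] at hl
    have key : ∀ {x y : α}, [x, v] <+: a :: l → ¬ [y, v] <:+: l := by
      rintro x y ⟨t, ht⟩ hy
      simp only [List.cons_append, List.nil_append, List.cons.injEq] at ht
      obtain ⟨rfl, rfl⟩ := ht
      rw [List.infix_cons_iff] at hy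
      have hvt := (List.nodup_cons.1 hl.2).1
      rcases hy with ⟨s, hs⟩ | hy
      · simp only [List.cons_append, List.nil_append, List.cons.injEq] at hs
        exact hvt (by rw [← hs.2]; simp)
      · exact hvt (hy.subset (by simp))
    rw [List.infix_cons_iff] at h h'
    rcases h with h | h <;> rcases h' with h' | h'
    · obtain ⟨t, ht⟩ := h
      obtain ⟨t', ht'⟩ := h'
      simp only [List.cons_append, List.nil_append, List.cons.injEq] at ht ht'
      rw [ht.1, ht'.1]
    · exact absurd h' (key h)
    · exact absurd h (key h')
    · exact ih hl.2 h h'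

theorem rel_of_pair_infix {R : α → α → Prop} {l : List α} (hl : l.IsChain R) {u v : α}
    (h : [u, v] <:+: l) : R u v := by
  have := hl.infix h
  simpa using this

theorem exists_pair_infix {a v : α} {l : List α} (hv : v ∈ l) :
    ∃ u, [u, v] <:+: a :: l := by
  induction l generalizing a with
  | nil => simp at hv
  | cons b l ih =>
    rcases List.mem_cons.1 hv with rfl | hv
    · exact ⟨a, (show [a, v] <+: a :: v :: l from ⟨l, rfl⟩).isInfix⟩
    · obtain ⟨u, hu⟩ := ih (a := b) hv
      exact ⟨u, List.infix_cons hu⟩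

/-- Walking backwards from the last entry. It is used to climb a side of a cycle from its
hybrid-vertex. -/
theorem mem_of_pair_infix_closed {T : Set α} (l : List α) {b : α}
    (h : ∀ u v, [u, v] <:+: l ++ [b] → v ∈ T → u ∈ T) (hb : b ∈ T) : ∀ x ∈ l, x ∈ T := by
  induction l using List.reverseRecOn generalizing b with
  | nil => simp
  | append_singleton l a ih =>
    have ha : a ∈ T := h a b ⟨l, [], by simp⟩ hb
    intro x hx
    rcases List.mem_append.1 hx with hx | hx
    · exact ih (fun u v huv hv => h u v (huv.trans (List.prefix_append _ _).isInfix) hv) ha x hx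
    · rw [List.mem_singleton.1 hx]; exact ha

theorem eq_nil_of_pair_infix {a b : α} {l : List α} (hnd : (a :: (l ++ [b])).Nodup)
    (h : [a, b] <:+: a :: (l ++ [b])) : l = [] := by
  rw [List.infix_cons_iff] at h
  rcases h with ⟨t, ht⟩ | h
  · cases l with
    | nil => rfl
    | cons c l =>
      simp only [List.cons_append, List.nil_append, List.cons.injEq, true_and] at ht
      have := (List.nodup_cons.1 hnd).2
      rw [List.cons_append, List.nodup_cons, ← ht.1] at this
      exact absurd (by simp) this.1
  · exact absurd (h.subset (by simp)) (List.nodup_cons.1 hnd).1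

end Infix

/-! ### Elementary galled-trees -/

section Elementary

variable {W : Type*} {N : Digraph W}

theorem RootedCycle.mem_verts (C : RootedCycle N) {v : W} :
    v ∈ C.verts ↔ v = C.root ∨ v = C.hybrid ∨ v ∈ C.inner₁ ∨ v ∈ C.inner₂ := by
  simp [RootedCycle.verts, mem_ofPred_eq]

theorem RootedCycle.disjoint (C : RootedCycle N) {v : W} (h₁ : v ∈ C.inner₁)
    (h₂ : v ∈ C.inner₂) : False := by
  have := C.nodup
  simp only [List.nodup_cons, List.nodup_append] at this
  exact this.2.2.2.2 v h₁ v h₂ rfl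

theorem RootedCycle.root_ne_hybrid (C : RootedCycle N) : C.root ≠ C.hybrid := by
  have := C.nodup
  simp only [List.nodup_cons, List.mem_cons, not_or] at this
  exact this.1.1

theorem RootedCycle.root_notMem (C : RootedCycle N) : C.root ∉ C.inner₁ ∧ C.root ∉ C.inner₂ := by
  have := C.nodup
  simp only [List.nodup_cons, List.mem_cons, List.mem_append, not_or] at this
  exact this.1.2

theorem RootedCycle.hybrid_notMem (C : RootedCycle N) :
    C.hybrid ∉ C.inner₁ ∧ C.hybrid ∉ C.inner₂ := by
  have := C.nodup
  simp only [List.nodup_cons, List.mem_cons, List.mem_append, not_or] at this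
  exact this.2.1

theorem RootedCycle.nodup₁ (C : RootedCycle N) :
    (C.root :: (C.inner₁ ++ [C.hybrid])).Nodup := by
  have := C.nodup
  simp only [List.nodup_cons, List.mem_cons, List.mem_append, List.nodup_append, not_or] at this
  simp only [List.nodup_cons, List.nodup_append, List.mem_append, List.mem_singleton, not_or]
  refine ⟨⟨this.1.2.1, this.1.1⟩, this.2.2.1, by simp, ?_⟩
  rintro a ha b rfl rfl
  exact this.2.1.1 ha

theorem RootedCycle.nodup₂ (C : RootedCycle N) :
    (C.root :: (C.inner₂ ++ [C.hybrid])).Nodup := by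
  have := C.nodup
  simp only [List.nodup_cons, List.mem_cons, List.mem_append, List.nodup_append, not_or] at this
  simp only [List.nodup_cons, List.nodup_append, List.mem_append, List.mem_singleton, not_or]
  refine ⟨⟨this.1.2.2, this.1.1⟩, this.2.2.2.1, by simp, ?_⟩
  rintro a ha b rfl rfl
  exact this.2.1.2 ha

theorem RootedCycle.IsEdge.adj {C : RootedCycle N} {u v : W} (h : C.IsEdge u v) :
    N.Adj u v :=
  h.elim (rel_of_pair_infix C.path₁) (rel_of_pair_infix C.path₂)

theorem RootedCycle.IsEdge.mem_left {C : RootedCycle N} {u v : W} (h : C.IsEdge u v) :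
    u ∈ C.verts ∧ u ≠ C.hybrid := by
  rcases h with h | h
  · have h1 := (pair_infix_cons_concat h).1
    refine ⟨C.mem_verts.2 (by rcases List.mem_cons.1 h1 with h | h <;> simp [h]), ?_⟩
    rintro rfl
    rcases List.mem_cons.1 h1 with h | h
    · exact C.root_ne_hybrid h.symm
    · exact C.hybrid_notMem.1 h
  · have h1 := (pair_infix_cons_concat h).1
    refine ⟨C.mem_verts.2 (by rcases List.mem_cons.1 h1 with h | h <;> simp [h]), ?_⟩
    rintro rfl
    rcases List.mem_cons.1 h1 with h | h
    · exact C.root_ne_hybrid h.symm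
    · exact C.hybrid_notMem.2 h

theorem RootedCycle.IsEdge.mem_right {C : RootedCycle N} {u v : W} (h : C.IsEdge u v) :
    v ∈ C.verts := by
  rcases h with h | h
  · have h1 := (pair_infix_cons_concat h).2
    exact C.mem_verts.2 (by rcases List.mem_append.1 h1 with h | h <;> simp_all)
  · have h1 := (pair_infix_cons_concat h).2
    exact C.mem_verts.2 (by rcases List.mem_append.1 h1 with h | h <;> simp_all)

theorem RootedCycle.IsEdge.left_unique {C : RootedCycle N} {u u' v : W} (h : C.IsEdge u v)
    (h' : C.IsEdge u' v) (hv : v ≠ C.hybrid) : u = u' := by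
  have hboth : [u, v] <:+: C.root :: (C.inner₁ ++ [C.hybrid]) →
      [u', v] <:+: C.root :: (C.inner₂ ++ [C.hybrid]) → False := by
    intro h h'
    have h1 := (pair_infix_cons_concat h).2
    have h2 := (pair_infix_cons_concat h').2
    simp only [List.mem_append, List.mem_singleton, hv, or_false] at h1 h2
    exact C.disjoint h1 h2
  have hboth' : [u, v] <:+: C.root :: (C.inner₂ ++ [C.hybrid]) →
      [u', v] <:+: C.root :: (C.inner₁ ++ [C.hybrid]) → False := by
    intro h h'
    have h1 := (pair_infix_cons_concat h).2
    have h2 := (pair_infix_cons_concat h').2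
    simp only [List.mem_append, List.mem_singleton, hv, or_false] at h1 h2
    exact C.disjoint h2 h1
  rcases h with h | h <;> rcases h' with h' | h'
  · exact pair_infix_left_unique C.nodup₁ h h'
  · exact (hboth h h').elim
  · exact (hboth' h h').elim
  · exact pair_infix_left_unique C.nodup₂ h h'

theorem RootedCycle.exists_isEdge (C : RootedCycle N) {v : W} (hv : v ∈ C.verts)
    (hne : v ≠ C.root) : ∃ u, C.IsEdge u v := by
  rcases C.mem_verts.1 hv with h | h | h | h
  · exact absurd h hne
  · obtain ⟨u, hu⟩ := exists_pair_infix (a := C.root) (l := C.inner₁ ++ [C.hybrid]) (v := v)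
      (by simp [h])
    exact ⟨u, Or.inl hu⟩
  · obtain ⟨u, hu⟩ := exists_pair_infix (a := C.root) (l := C.inner₁ ++ [C.hybrid]) (v := v)
      (by simp [h])
    exact ⟨u, Or.inl hu⟩
  · obtain ⟨u, hu⟩ := exists_pair_infix (a := C.root) (l := C.inner₂ ++ [C.hybrid]) (v := v)
      (by simp [h])
    exact ⟨u, Or.inr hu⟩

/-- The predecessors of the hybrid-vertex on the two sides can coincide only in the root, since the
sides share no inner vertex. Then both sides would be single edges, against `nontrivial`. -/
theorem RootedCycle.exists_parents (C : RootedCycle N) :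
    ∃ p q, p ≠ q ∧ C.IsEdge p C.hybrid ∧ C.IsEdge q C.hybrid := by
  obtain ⟨p, hp⟩ := exists_pair_infix (a := C.root) (l := C.inner₁ ++ [C.hybrid])
    (v := C.hybrid) (by simp)
  obtain ⟨q, hq⟩ := exists_pair_infix (a := C.root) (l := C.inner₂ ++ [C.hybrid])
    (v := C.hybrid) (by simp)
  refine ⟨p, q, ?_, Or.inl hp, Or.inr hq⟩
  rintro rfl
  have h1 := (pair_infix_cons_concat hp).1
  have h2 := (pair_infix_cons_concat hq).1
  have hroot : p = C.root := by
    rcases List.mem_cons.1 h1 with h | h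
    · exact h
    rcases List.mem_cons.1 h2 with h' | h'
    · exact h'
    exact (C.disjoint h h').elim
  subst hroot
  rcases C.nontrivial with h | h
  · exact h (eq_nil_of_pair_infix C.nodup₁ hp)
  · exact h (eq_nil_of_pair_infix C.nodup₂ hq)

theorem RootedCycle.exists_child (C : RootedCycle N) {v : W} (hv : v ∈ C.verts)
    (hne : v ≠ C.hybrid) : ∃ u, N.Adj v u := by
  have key : ∀ (l : List W) (a : W), (a :: (l ++ [C.hybrid])).IsChain N.Adj → ∀ x ∈ a :: l,
      ∃ u, N.Adj x u := by
    intro l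
    induction l with
    | nil =>
      intro a h x hx
      simp only [List.nil_append, List.isChain_cons_cons] at h
      simp only [List.mem_singleton] at hx
      exact ⟨_, hx ▸ h.1⟩
    | cons b l ih =>
      intro a h x hx
      rw [List.cons_append, List.isChain_cons_cons] at h
      rcases List.mem_cons.1 hx with rfl | hx
      · exact ⟨b, h.1⟩
      · exact ih b h.2 x hx
  rcases C.mem_verts.1 hv with h | h | h | h
  · exact key _ _ C.path₁ v (by simp [h])
  · exact absurd h hne
  · exact key _ _ C.path₁ v (by simp [h])
  · exact key _ _ C.path₂ v (by simp [h])

theorem not_adj_of_indeg_eq_zero [Finite W] {v : W} (h : indeg N v = 0) (u : W) :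
    ¬ N.Adj u v := by
  rw [indeg, Set.ncard_eq_zero (Set.toFinite _)] at h
  intro hu
  have : u ∈ {u | N.Adj u v} := hu
  rw [h] at this
  exact this

theorem not_adj_of_outdeg_eq_zero [Finite W] {v : W} (h : outdeg N v = 0) (u : W) :
    ¬ N.Adj v u := by
  rw [outdeg, Set.ncard_eq_zero (Set.toFinite _)] at h
  intro hu
  have : u ∈ {u | N.Adj v u} := hu
  rw [h] at this
  exact this

theorem eq_of_indeg_eq_one {v : W} (h : indeg N v = 1) {p q : W} (hp : N.Adj p v)
    (hq : N.Adj q v) : p = q := by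
  obtain ⟨a, ha⟩ := Set.ncard_eq_one.1 h
  have h1 : p ∈ ({a} : Set W) := ha ▸ hp
  have h2 : q ∈ ({a} : Set W) := ha ▸ hq
  exact h1.trans h2.symm

/-- The adjacencies in an elementary galled-tree with cycle `C` and leaf set `X`. -/
structure IsElementaryWith (N : Digraph W) (X : Set W) (C : RootedCycle N) : Prop where
  dag : IsDAG N
  not_adj_root : ∀ u, ¬ N.Adj u C.root
  leaf_not_adj : ∀ x ∈ X, ∀ u, ¬ N.Adj x u
  leaf_parent : ∀ x ∈ X, ∀ u v, N.Adj u x → N.Adj v x → u = v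
  exists_parent : ∀ x ∈ X, ∃ u, N.Adj u x
  cover : ∀ v, v ∈ C.verts ∨ v ∈ X
  exists_leaf : ∀ v ∈ C.verts, v ≠ C.root → ∃ x ∈ X, N.Adj v x
  leaf_unique : ∀ v ∈ C.verts, v ≠ C.root → ∀ x ∈ X, ∀ y ∈ X, N.Adj v x → N.Adj v y → x = y
  edge : ∀ u v, N.Adj u v → C.IsEdge u v ∨ (u ∈ C.verts ∧ u ≠ C.root ∧ v ∈ X)

theorem IsElementary.exists_cycle [Finite W] {X : Set W} (h : IsElementary N X) :
    ∃ C : RootedCycle N, IsElementaryWith N X C := by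
  obtain ⟨⟨hdag, hN⟩, C, hroot, -, hcov, hpend, hedge⟩ := h
  rcases hN with ⟨x, hx, -⟩ | hN
  · exfalso
    have h1 : C.root ∈ ({x} : Set W) := hx ▸ mem_univ _
    have h2 : C.hybrid ∈ ({x} : Set W) := hx ▸ mem_univ _
    exact C.root_ne_hybrid (h1.trans h2.symm)
  refine ⟨C, hdag, not_adj_of_indeg_eq_zero hroot, fun x hx => ?_, fun x hx u v hu hv => ?_,
    fun x hx => ?_, fun v => ?_, fun v hv hne => ?_, ?_, hedge⟩
  · exact not_adj_of_outdeg_eq_zero ((hN.leaves x).1 hx).1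
  · exact eq_of_indeg_eq_one ((hN.leaves x).1 hx).2 hu hv
  · obtain ⟨u, hu⟩ := Set.ncard_eq_one.1 ((hN.leaves x).1 hx).2
    exact ⟨u, (hu ▸ rfl : u ∈ {u | N.Adj u x})⟩
  · exact (hcov ▸ mem_univ v : v ∈ C.verts ∪ X)
  · obtain ⟨x, hx, -⟩ := hpend v hv hne
    exact ⟨x, hx⟩
  · intro v hv hne x hx y hy hvx hvy
    exact (hpend v hv hne).unique ⟨hx, hvx⟩ ⟨hy, hvy⟩

theorem ancestor_antisymm (hdag : IsDAG N) {u v : W} (h : IsAncestor N u v)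
    (h' : IsAncestor N v u) : u = v := by
  rcases Relation.reflTransGen_iff_eq_or_transGen.1 h with e | h
  · exact e.symm
  · exact absurd (h.trans_left h') (hdag u)

/-! ### Uniqueness of the cycle of an elementary galled-tree. -/

namespace IsElementaryWith

variable {X : Set W} {C : RootedCycle N}

theorem notMem_leaves (h : IsElementaryWith N X C) {v : W} (hv : v ∈ C.verts) : v ∉ X := by
  intro hvX
  by_cases hne : v = C.hybrid
  · obtain ⟨x, -, hx⟩ := h.exists_leaf v hv (hne ▸ C.root_ne_hybrid.symm)
    exact h.leaf_not_adj v hvX x hx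
  · obtain ⟨u, hu⟩ := C.exists_child hv hne
    exact h.leaf_not_adj v hvX u hu

theorem isEdge (h : IsElementaryWith N X C) {u v : W} (huv : N.Adj u v) (hv : v ∈ C.verts) :
    C.IsEdge u v :=
  (h.edge u v huv).resolve_right fun h' => h.notMem_leaves hv h'.2.2

theorem parent_mem (h : IsElementaryWith N X C) {u x : W} (hx : x ∈ X) (hux : N.Adj u x) :
    u ∈ C.verts ∧ u ≠ C.root := by
  rcases h.edge u x hux with h' | h'
  · exact absurd hx (h.notMem_leaves h'.mem_right)
  · exact ⟨h'.1, h'.2.1⟩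

/-- The hybrid-vertex of a cycle has two parents, and `C.hybrid` is the only vertex that does. -/
theorem hybrid_eq (h : IsElementaryWith N X C) (C' : RootedCycle N) : C'.hybrid = C.hybrid := by
  obtain ⟨p, q, hne, hp, hq⟩ := C'.exists_parents
  by_contra hhyb
  rcases h.cover C'.hybrid with hv | hv
  · exact hne ((h.isEdge hp.adj hv).left_unique (h.isEdge hq.adj hv) hhyb)
  · exact hne (h.leaf_parent _ hv _ _ hp.adj hq.adj)

theorem parent_mem_cycle (h : IsElementaryWith N X C) (C' : RootedCycle N) {u v : W}
    (hne : v ≠ C.hybrid) (hroot : v ≠ C'.root) (huv : C.IsEdge u v) (hv : v ∈ C'.verts) :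
    u ∈ C'.verts := by
  obtain ⟨p, hp⟩ := C'.exists_isEdge hv hroot
  rw [huv.left_unique (h.isEdge hp.adj huv.mem_right) hne]
  exact hp.mem_left.1

theorem hybrid_mem_cycle (h : IsElementaryWith N X C) (C' : RootedCycle N) :
    C.hybrid ∈ C'.verts := C'.mem_verts.2 (by simp [h.hybrid_eq C'])

/-- Climbing from the hybrid-vertex, C' must follow the side of C because parents are unique there;
it could stop only at its own root. At the hybrid-vertex itself, the two parents in C' are the ends
of both sides of C. -/
theorem side_subset₁ (h : IsElementaryWith N X C) (C' : RootedCycle N)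
    (hroot : C'.root ∉ C.inner₁) : ∀ x ∈ C.root :: C.inner₁, x ∈ C'.verts := by
  have hhyb := h.hybrid_eq C'
  obtain ⟨p, q, hne, hp, hq⟩ := C'.exists_parents
  have hp' := h.isEdge (v := C.hybrid) (hhyb ▸ hp.adj) (C.mem_verts.2 (by simp))
  have hq' := h.isEdge (v := C.hybrid) (hhyb ▸ hq.adj) (C.mem_verts.2 (by simp))
  refine mem_of_pair_infix_closed (b := C.hybrid) _ ?_ (h.hybrid_mem_cycle C')
  intro u v huv hv
  by_cases hvh : v = C.hybrid
  · subst hvh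
    rcases hp' with hp' | hp'
    · rw [pair_infix_left_unique C.nodup₁ huv hp']; exact hp.mem_left.1
    rcases hq' with hq' | hq'
    · rw [pair_infix_left_unique C.nodup₁ huv hq']; exact hq.mem_left.1
    exact absurd (pair_infix_left_unique C.nodup₂ hp' hq') hne
  · refine h.parent_mem_cycle C' hvh ?_ (Or.inl huv) hv
    rintro rfl
    exact hroot (by simpa [hvh] using (pair_infix_cons_concat huv).2)

theorem side_subset₂ (h : IsElementaryWith N X C) (C' : RootedCycle N)
    (hroot : C'.root ∉ C.inner₂) : ∀ x ∈ C.root :: C.inner₂, x ∈ C'.verts := by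
  have hhyb := h.hybrid_eq C'
  obtain ⟨p, q, hne, hp, hq⟩ := C'.exists_parents
  have hp' := h.isEdge (v := C.hybrid) (hhyb ▸ hp.adj) (C.mem_verts.2 (by simp))
  have hq' := h.isEdge (v := C.hybrid) (hhyb ▸ hq.adj) (C.mem_verts.2 (by simp))
  refine mem_of_pair_infix_closed (b := C.hybrid) _ ?_ (h.hybrid_mem_cycle C')
  intro u v huv hv
  by_cases hvh : v = C.hybrid
  · subst hvh
    rcases hp' with hp' | hp'
    · rcases hq' with hq' | hq'
      · exact absurd (pair_infix_left_unique C.nodup₁ hp' hq') hne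
      rw [pair_infix_left_unique C.nodup₂ huv hq']; exact hq.mem_left.1
    rw [pair_infix_left_unique C.nodup₂ huv hp']; exact hp.mem_left.1
  · refine h.parent_mem_cycle C' hvh ?_ (Or.inr huv) hv
    rintro rfl
    exact hroot (by simpa [hvh] using (pair_infix_cons_concat huv).2)

/-- The root of C' is an inner vertex of at most one side of C, so the other side leads up to
`C.root` inside C'. Having no parent, `C.root` can only be the root of C'. -/
theorem root_eq (h : IsElementaryWith N X C) (C' : RootedCycle N) : C'.root = C.root := by
  have hmem : C.root ∈ C'.verts := by
    by_cases h₁ : C'.root ∈ C.inner₁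
    · exact h.side_subset₂ C' (fun h₂ => C.disjoint h₁ h₂) _ (by simp)
    · exact h.side_subset₁ C' h₁ _ (by simp)
  by_contra hne
  obtain ⟨u, hu⟩ := C'.exists_isEdge hmem (Ne.symm hne)
  exact h.not_adj_root u hu.adj

theorem verts_eq (h : IsElementaryWith N X C) (C' : RootedCycle N) : C'.verts = C.verts := by
  have hroot := h.root_eq C'
  apply subset_antisymm
  · intro v hv
    by_cases hvh : v = C'.hybrid
    · rw [hvh, h.hybrid_eq C']
      exact C.mem_verts.2 (by simp)
    · obtain ⟨u, hu⟩ := C'.exists_child hv hvh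
      exact (h.cover v).resolve_right fun hvX => h.leaf_not_adj v hvX u hu
  · have h₁ := h.side_subset₁ C' (hroot ▸ C.root_notMem.1)
    have h₂ := h.side_subset₂ C' (hroot ▸ C.root_notMem.2)
    intro v hv
    rcases C.mem_verts.1 hv with rfl | rfl | hv | hv
    · exact h₁ _ (by simp)
    · exact h.hybrid_mem_cycle C'
    · exact h₁ _ (by simp [hv])
    · exact h₂ _ (by simp [hv])

/-- Every cycle has the root, hybrid-vertex and vertex set of C. A side without inner vertices would
be an edge from root to hybrid-vertex, and two sides with one inner vertex each would give four
cycle vertices in all; C excludes both. -/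
theorem isStrong (h : IsElementaryWith N X C) (h₁ : C.inner₁ ≠ []) (h₂ : C.inner₂ ≠ [])
    (hlen : ¬ (C.inner₁.length = 1 ∧ C.inner₂.length = 1)) : IsStrong N := by
  have hno : ¬ N.Adj C.root C.hybrid := by
    intro hadj
    rcases h.isEdge hadj (C.mem_verts.2 (by simp)) with h' | h'
    · exact h₁ (eq_nil_of_pair_infix C.nodup₁ h')
    · exact h₂ (eq_nil_of_pair_infix C.nodup₂ h')
  have hcard : ∀ C' : RootedCycle N,
      C'.verts.ncard = C'.inner₁.length + C'.inner₂.length + 2 := by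
    classical
    intro C'
    have : C'.verts = ((C'.root :: C'.hybrid :: (C'.inner₁ ++ C'.inner₂)).toFinset : Set W) := by
      ext v
      simp [RootedCycle.mem_verts]
    rw [this, Set.ncard_coe_finset, List.toFinset_card_of_nodup C'.nodup]
    simp
  intro C'
  have hroot := h.root_eq C'
  have hhyb := h.hybrid_eq C'
  refine ⟨fun e => ?_, fun e => ?_, fun e => hlen ?_⟩
  · have := C'.path₁
    rw [e, hroot, hhyb] at this
    exact hno (by simpa using this)
  · have := C'.path₂
    rw [e, hroot, hhyb] at this
    exact hno (by simpa using this)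
  · have e1 := hcard C'
    rw [h.verts_eq C', hcard C] at e1
    have := List.length_pos_iff.2 h₁
    have := List.length_pos_iff.2 h₂
    omega

/-! ### Least common ancestors in elementary galled-trees -/

theorem ancestor_leaf (h : IsElementaryWith N X C) {u x w : W} (hx : x ∈ X) (hux : N.Adj u x)
    (hw : IsAncestor N w x) : w = x ∨ IsAncestor N w u := by
  rcases Relation.ReflTransGen.cases_tail hw with e | ⟨p, hp, hpx⟩
  · exact Or.inl e.symm
  · rw [h.leaf_parent x hx u p hux hpx]; exact Or.inr hp

theorem eq_of_leaf_ancestor (h : IsElementaryWith N X C) {x y : W} (hx : x ∈ X)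
    (hxy : IsAncestor N x y) : y = x := by
  rcases Relation.ReflTransGen.cases_head hxy with e | ⟨p, hp, -⟩
  · exact e.symm
  · exact absurd hp (h.leaf_not_adj x hx p)

/-- Any common ancestor of the leaf x and another vertex passes through the only parent u of x, so u
is the lowest one as soon as it lies above y. -/
theorem isLCA_iff_above (h : IsElementaryWith N X C) {u x y w : W} (hx : x ∈ X)
    (hux : N.Adj u x) (hyx : y ≠ x) (huy : IsAncestor N u y) :
    IsLCA N {x, y} w ↔ w = u := by
  have hcomm : ∀ v, IsAncestor N v x → IsAncestor N v y → IsAncestor N v u := by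
    intro v hvx hvy
    rcases h.ancestor_leaf hx hux hvx with rfl | h'
    · exact absurd (h.eq_of_leaf_ancestor hx hvy) hyx
    · exact h'
  have hu : ∀ a ∈ ({x, y} : Set W), IsAncestor N u a := by
    rintro a (rfl | rfl)
    · exact Relation.ReflTransGen.single hux
    · exact huy
  constructor
  · rintro ⟨hw, hmin⟩
    exact (hmin u hu (hcomm w (hw x (by simp)) (hw y (by simp)))).symm
  · rintro rfl
    exact ⟨hu, fun w' hw' hww' => ancestor_antisymm h.dag
      (hcomm w' (hw' x (by simp)) (hw' y (by simp))) hww'⟩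

theorem ancestor_inner₁ (h : IsElementaryWith N X C) {u w : W} (hu : u ∈ C.inner₁)
    (hw : IsAncestor N w u) : w ∈ C.root :: C.inner₁ := by
  induction hw using Relation.ReflTransGen.head_induction_on with
  | refl => exact List.mem_cons_of_mem _ hu
  | @head a b hab _ ih =>
    rcases List.mem_cons.1 ih with rfl | hb
    · exact absurd hab (h.not_adj_root a)
    · rcases h.isEdge hab (C.mem_verts.2 (by simp [hb])) with h' | h'
      · exact (pair_infix_cons_concat h').1
      · rcases List.mem_append.1 (pair_infix_cons_concat h').2 with h'' | h''
        · exact (C.disjoint hb h'').elim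
        · exact absurd (List.mem_singleton.1 h'' ▸ hb) C.hybrid_notMem.1

theorem ancestor_inner₂ (h : IsElementaryWith N X C) {u w : W} (hu : u ∈ C.inner₂)
    (hw : IsAncestor N w u) : w ∈ C.root :: C.inner₂ := by
  induction hw using Relation.ReflTransGen.head_induction_on with
  | refl => exact List.mem_cons_of_mem _ hu
  | @head a b hab _ ih =>
    rcases List.mem_cons.1 ih with rfl | hb
    · exact absurd hab (h.not_adj_root a)
    · rcases h.isEdge hab (C.mem_verts.2 (by simp [hb])) with h' | h'
      · rcases List.mem_append.1 (pair_infix_cons_concat h').2 with h'' | h''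
        · exact (C.disjoint h'' hb).elim
        · exact absurd (List.mem_singleton.1 h'' ▸ hb) C.hybrid_notMem.2
      · exact (pair_infix_cons_concat h').1

theorem pairwise₁ (C : RootedCycle N) :
    (C.root :: (C.inner₁ ++ [C.hybrid])).Pairwise (Relation.TransGen N.Adj) :=
  (C.path₁.imp fun _ _ h => Relation.TransGen.single h).pairwise

theorem pairwise₂ (C : RootedCycle N) :
    (C.root :: (C.inner₂ ++ [C.hybrid])).Pairwise (Relation.TransGen N.Adj) :=
  (C.path₂.imp fun _ _ h => Relation.TransGen.single h).pairwise

/-- Above an inner vertex of a side lie only that side and the root, and the two sides meet only in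
the root. -/
theorem isLCA_iff_opposite (h : IsElementaryWith N X C) {u v x y w : W} (hx : x ∈ X)
    (hy : y ∈ X) (hux : N.Adj u x) (hvy : N.Adj v y) (hu : u ∈ C.inner₁) (hv : v ∈ C.inner₂) :
    IsLCA N {x, y} w ↔ w = C.root := by
  have huv : u ≠ v := fun e => C.disjoint hu (e ▸ hv)
  have hxy : x ≠ y := fun e => huv (h.leaf_parent y hy u v (e ▸ hux) hvy)
  have hcomm : ∀ w', (∀ a ∈ ({x, y} : Set W), IsAncestor N w' a) → w' = C.root := by
    intro w' hw'
    have h1 := h.ancestor_leaf hx hux (hw' x (by simp))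
    have h2 := h.ancestor_leaf hy hvy (hw' y (by simp))
    rcases h1 with rfl | h1
    · exact absurd (h.eq_of_leaf_ancestor hx (hw' y (by simp))).symm hxy
    rcases h2 with rfl | h2
    · exact absurd (h.eq_of_leaf_ancestor hy (hw' x (by simp))) hxy
    rcases List.mem_cons.1 (h.ancestor_inner₁ hu h1) with e | h1
    · exact e
    rcases List.mem_cons.1 (h.ancestor_inner₂ hv h2) with e | h2
    · exact e
    exact (C.disjoint h1 h2).elim
  have hroot : ∀ a ∈ ({x, y} : Set W), IsAncestor N C.root a := by
    have h1 := (List.pairwise_cons.1 (pairwise₁ C)).1 u (by simp [hu])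
    have h2 := (List.pairwise_cons.1 (pairwise₂ C)).1 v (by simp [hv])
    rintro a (rfl | rfl)
    · exact h1.to_reflTransGen.tail hux
    · exact h2.to_reflTransGen.tail hvy
  constructor
  · exact fun hw => hcomm w hw.1
  · rintro rfl
    exact ⟨hroot, fun w' hw' _ => hcomm w' hw'⟩

end IsElementaryWith

theorem explainedGraph_adj {V : Type*} {t : W → VLabel} {ℓ : V → W} {x y : V} :
    (explainedGraph N t ℓ).Adj x y ↔
      x ≠ y ∧ ∃ w, IsLCA N {ℓ x, ℓ y} w ∧ t w = VLabel.one := by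
  simp only [explainedGraph, SimpleGraph.fromRel_adj, pair_comm (ℓ y) (ℓ x), or_self]

/-! ### Adjacency and induced paths in the graph explained by an elementary galled-tree. -/

namespace IsElementaryWith

variable {C : RootedCycle N} {V : Type*} {ℓ : V → W} {t : W → VLabel}

theorem adj_iff_above (h : IsElementaryWith N (range ℓ) C) (hℓ : Function.Injective ℓ)
    {x y : V} {u v : W} (hu : N.Adj u (ℓ x)) (hv : N.Adj v (ℓ y)) (hne : x ≠ y)
    (huv : Relation.TransGen N.Adj u v) :
    (explainedGraph N t ℓ).Adj x y ↔ t u = VLabel.one := by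
  rw [explainedGraph_adj]
  simp only [h.isLCA_iff_above (mem_range_self x) hu (hℓ.ne hne.symm)
    (huv.to_reflTransGen.tail hv), hne, ne_eq, not_false_eq_true, true_and, exists_eq_left]

theorem adj_iff_opposite (h : IsElementaryWith N (range ℓ) C)
    {x y : V} {u v : W} (hu : N.Adj u (ℓ x)) (hv : N.Adj v (ℓ y))
    (hu₁ : u ∈ C.inner₁) (hv₂ : v ∈ C.inner₂) :
    (explainedGraph N t ℓ).Adj x y ↔ t C.root = VLabel.one := by
  have hne : x ≠ y := by
    rintro rfl
    exact C.disjoint hu₁ (h.leaf_parent _ (mem_range_self x) u v hu hv ▸ hv₂)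
  rw [explainedGraph_adj]
  simp only [h.isLCA_iff_opposite (mem_range_self x) (mem_range_self y) hu hv hu₁ hv₂, hne, ne_eq,
    not_false_eq_true, true_and, exists_eq_left]

/-- One side of the cycle, together with the hybrid-vertex, supports no induced path on four
vertices. -/
theorem not_isP4_of_chain (h : IsElementaryWith N (range ℓ) C) (hℓ : Function.Injective ℓ)
    {P : List W} (hP : P.Pairwise (Relation.TransGen N.Adj)) {k : V → W}
    (hk : ∀ x, N.Adj (k x) (ℓ x)) {a b c d : V} (ha : k a ∈ P) (hb : k b ∈ P) (hc : k c ∈ P)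
    (hd : k d ∈ P) (hp4 : IsP4 (explainedGraph N t ℓ) a b c d)
    (hinj : Function.Injective k) : False := by
  -- The leaf below the uppermost of the four cycle vertices is adjacent to all three others or to
  -- none, depending on the label above it. No vertex of an induced path on four vertices has this
  -- property.
  obtain ⟨v, hv, -, hfirst⟩ := exists_first_mem P ({k a, k b, k c, k d} : Set W)
    ⟨k a, by simp, ha⟩
  have key : ∀ x y : V, v = k x → k y ∈ ({k a, k b, k c, k d} : Set W) → k y ∈ P → x ≠ y →
      ((explainedGraph N t ℓ).Adj x y ↔ t (k x) = VLabel.one) := by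
    intro x y hx hy hyP hne
    refine h.adj_iff_above hℓ (hk x) (hk y) hne ?_
    exact List.pairwise_iff_forall_sublist.1 hP
      (hx ▸ hfirst (k y) hy hyP fun e => hne (hinj (hx ▸ e.symm)))
  have hab := hp4.ab
  have hbc := hp4.bc
  have hcd := hp4.cd
  have hac' : a ≠ c := by rintro rfl; exact hp4.ad hcd
  have had' : a ≠ d := by rintro rfl; exact hp4.ac hcd.symm
  have hbd' : b ≠ d := by rintro rfl; exact hp4.ad hab
  rcases hv with hv | hv | hv | hv
  · exact hp4.ac ((key a c hv (by simp) hc hac').2 ((key a b hv (by simp) hb hab.ne).1 hab))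
  · exact hp4.bd ((key b d hv (by simp) hd hbd').2 ((key b a hv (by simp) ha hab.ne').1 hab.symm))
  · exact hp4.ac ((key c a hv (by simp) ha hac'.symm).2
      ((key c d hv (by simp) hd hcd.ne).1 hcd)).symm
  · exact hp4.ad ((key d a hv (by simp) ha had'.symm).2
      ((key d c hv (by simp) hc hcd.ne').1 hcd.symm)).symm

/-- In an induced path on four vertices, the leaf below the hybrid-vertex is an end of the path
if the label of the root is `1`, and an inner vertex of the path otherwise. -/
theorem hybrid_of_isP4 (h : IsElementaryWith N (range ℓ) C) (hℓ : Function.Injective ℓ)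
    {k : V → W} (hk : ∀ x, N.Adj (k x) (ℓ x)) {a b c d : V}
    (hp4 : IsP4 (explainedGraph N t ℓ) a b c d) :
    (t C.root = VLabel.one → k a = C.hybrid ∨ k d = C.hybrid) ∧
      (t C.root ≠ VLabel.one → k b = C.hybrid ∨ k c = C.hybrid) := by
  have hmem : ∀ x, k x ∈ C.verts ∧ k x ≠ C.root := fun x => h.parent_mem (mem_range_self x) (hk x)
  have hinj : Function.Injective k := fun x y e =>
    hℓ (h.leaf_unique _ (hmem x).1 (hmem x).2 _ (mem_range_self x) _ (mem_range_self y) (hk x)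
      (e ▸ hk y))
  have hcase : ∀ x, k x = C.hybrid ∨ k x ∈ C.inner₁ ∨ k x ∈ C.inner₂ := fun x =>
    (C.mem_verts.1 (hmem x).1).resolve_left (hmem x).2
  have hopp : ∀ {x y}, k x ∈ C.inner₁ → k y ∈ C.inner₂ →
      ((explainedGraph N t ℓ).Adj x y ↔ t C.root = VLabel.one) := fun {x y} hx hy =>
    h.adj_iff_opposite (hk x) (hk y) hx hy
  have hopp' : ∀ {x y}, k x ∈ C.inner₂ → k y ∈ C.inner₁ →
      ((explainedGraph N t ℓ).Adj x y ↔ t C.root = VLabel.one) := fun {x y} hx hy => by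
    rw [SimpleGraph.adj_comm]; exact hopp hy hx
  have hside₁ : ∀ x, k x = C.hybrid ∨ k x ∈ C.inner₁ → k x ∈ C.inner₁ ++ [C.hybrid] :=
    fun x hx => by rcases hx with hx | hx <;> simp [hx]
  have hside₂ : ∀ x, k x = C.hybrid ∨ k x ∈ C.inner₂ → k x ∈ C.inner₂ ++ [C.hybrid] :=
    fun x hx => by rcases hx with hx | hx <;> simp [hx]
  have hno₁ := fun ha hb hc hd => h.not_isP4_of_chain hℓ (List.pairwise_cons.1 (pairwise₁ C)).2 hk
    (hside₁ a ha) (hside₁ b hb) (hside₁ c hc) (hside₁ d hd) hp4 hinj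
  have hno₂ := fun ha hb hc hd => h.not_isP4_of_chain hℓ (List.pairwise_cons.1 (pairwise₂ C)).2 hk
    (hside₂ a ha) (hside₂ b hb) (hside₂ c hc) (hside₂ d hd) hp4 hinj
  have hab := hp4.ab
  have hbc := hp4.bc
  have hcd := hp4.cd
  have hac := hp4.ac
  have hbd := hp4.bd
  have had := hp4.ad
  constructor
  · intro hr
    by_contra! hcon
    -- With root label 1, nonadjacent leaves cannot lie on opposite sides. So a and d share a side,
    -- and b (nonadjacent to d) and c (nonadjacent to a) lie there too or below the hybrid-vertex.
    rcases (hcase a).resolve_left hcon.1 with ha | ha <;>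
      rcases (hcase d).resolve_left hcon.2 with hd | hd
    · refine hno₁ (Or.inr ha) ?_ ?_ (Or.inr hd)
      · exact or_assoc.2 (hcase b) |>.resolve_right fun hb => hbd ((hopp' hb hd).2 hr)
      · exact or_assoc.2 (hcase c) |>.resolve_right fun hc => hac ((hopp ha hc).2 hr)
    · exact had ((hopp ha hd).2 hr)
    · exact had ((hopp' ha hd).2 hr)
    · refine hno₂ (Or.inr ha) ?_ ?_ (Or.inr hd)
      · exact (or_assoc.2 (or_congr_right or_comm |>.1 (hcase b))).resolve_right
          fun hb => hbd ((hopp hb hd).2 hr)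
      · exact (or_assoc.2 (or_congr_right or_comm |>.1 (hcase c))).resolve_right
          fun hc => hac ((hopp' ha hc).2 hr)
  · intro hr
    by_contra! hcon
    -- Dually, adjacent leaves cannot lie on opposite sides: b and c share a side, which attracts a
    -- through b and d through c.
    rcases (hcase b).resolve_left hcon.1 with hb | hb <;>
      rcases (hcase c).resolve_left hcon.2 with hc | hc
    · refine hno₁ ?_ (Or.inr hb) (Or.inr hc) ?_
      · exact or_assoc.2 (hcase a) |>.resolve_right fun ha => hr ((hopp' ha hb).1 hab)
      · exact or_assoc.2 (hcase d) |>.resolve_right fun hd => hr ((hopp hc hd).1 hcd)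
    · exact hr ((hopp hb hc).1 hbc)
    · exact hr ((hopp' hb hc).1 hbc)
    · refine hno₂ ?_ (Or.inr hb) (Or.inr hc) ?_
      · exact (or_assoc.2 (or_congr_right or_comm |>.1 (hcase a))).resolve_right
          fun ha => hr ((hopp ha hb).1 hab)
      · exact (or_assoc.2 (or_congr_right or_comm |>.1 (hcase d))).resolve_right
          fun hd => hr ((hopp' hc hd).1 hcd)

end IsElementaryWith

end Elementary

end GaTEx

namespace GaTEx

open Set
open scoped List

/-! ### Transport of rooted cycles -/

section Transport

variable {A B : Type*} {N₁ : Digraph A} {N₂ : Digraph B}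

/-- The image of a rooted cycle under an injective homomorphism. -/
def RootedCycle.map (ψ : A → B) (hinj : Function.Injective ψ)
    (hadj : ∀ a b, N₁.Adj a b → N₂.Adj (ψ a) (ψ b)) (C : RootedCycle N₁) : RootedCycle N₂ where
  root := ψ C.root
  hybrid := ψ C.hybrid
  inner₁ := C.inner₁.map ψ
  inner₂ := C.inner₂.map ψ
  path₁ := by
    have := List.isChain_map_of_isChain ψ (fun a b h => hadj a b h) C.path₁
    simpa using this
  path₂ := by
    have := List.isChain_map_of_isChain ψ (fun a b h => hadj a b h) C.path₂
    simpa using this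
  nodup := by
    have := C.nodup.map hinj
    simpa using this
  nontrivial := by simpa using C.nontrivial

theorem RootedCycle.verts_map {ψ : A → B} {hinj : Function.Injective ψ}
    {hadj : ∀ a b, N₁.Adj a b → N₂.Adj (ψ a) (ψ b)} (C : RootedCycle N₁) :
    (C.map ψ hinj hadj).verts = ψ '' C.verts := by
  ext v
  simp only [RootedCycle.mem_verts, RootedCycle.map, List.mem_map, mem_image]
  constructor
  · rintro (h | h | ⟨a, ha, rfl⟩ | ⟨a, ha, rfl⟩)
    · exact ⟨C.root, by simp, h.symm⟩
    · exact ⟨C.hybrid, by simp, h.symm⟩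
    · exact ⟨a, by simp [ha], rfl⟩
    · exact ⟨a, by simp [ha], rfl⟩
  · rintro ⟨a, rfl | rfl | ha | ha, rfl⟩
    · simp
    · simp
    · exact Or.inr (Or.inr (Or.inl ⟨a, ha, rfl⟩))
    · exact Or.inr (Or.inr (Or.inr ⟨a, ha, rfl⟩))

theorem RootedCycle.exists_map_eq {ψ : A → B} (hinj : Function.Injective ψ)
    (hadj : ∀ a b, N₁.Adj a b ↔ N₂.Adj (ψ a) (ψ b)) (C : RootedCycle N₂)
    (hC : C.verts ⊆ range ψ) :
    ∃ C' : RootedCycle N₁, C'.map ψ hinj (fun a b => (hadj a b).1) = C := by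
  obtain ⟨root, hybrid, inner₁, inner₂, path₁, path₂, nodup, nontrivial⟩ := C
  have hmem : ∀ v, v ∈ root :: hybrid :: (inner₁ ++ inner₂) → v ∈ range ψ := fun v hv => hC hv
  obtain ⟨r, rfl⟩ := hmem root (by simp)
  obtain ⟨h, rfl⟩ := hmem hybrid (by simp)
  obtain ⟨l₁, rfl⟩ : inner₁ ∈ range (List.map ψ) := by
    rw [Set.range_list_map]
    exact fun x hx => hmem x (by simp [hx])
  obtain ⟨l₂, rfl⟩ : inner₂ ∈ range (List.map ψ) := by
    rw [Set.range_list_map]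
    exact fun x hx => hmem x (by simp [hx])
  have hchain : ∀ l : List A, List.IsChain N₂.Adj (ψ r :: (l.map ψ ++ [ψ h])) →
      List.IsChain N₁.Adj (r :: (l ++ [h])) := by
    intro l hl
    have : List.IsChain N₂.Adj ((r :: (l ++ [h])).map ψ) := by simpa using hl
    exact List.isChain_of_isChain_map ψ (fun a b => (hadj a b).2) this
  refine ⟨⟨r, h, l₁, l₂, hchain l₁ path₁, hchain l₂ path₂, ?_, ?_⟩, rfl⟩
  · have : ((r :: h :: (l₁ ++ l₂)).map ψ).Nodup := by simpa using nodup
    exact this.of_map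
  · simpa using nontrivial

end Transport

/-! ### Labels of the modular decomposition tree -/

section Labels

variable {X : Type*} {G : SimpleGraph X} {M : MDVertex G}

theorem mdLabel_eq_leaf (h : mdLabel G M = VLabel.leaf) : M.1.ncard = 1 := by
  unfold mdLabel at h
  split_ifs at h
  assumption

theorem mdLabel_eq_zero (h : mdLabel G M = VLabel.zero) :
    M.1.ncard ≠ 1 ∧ ¬ (G.induce M.1).Connected := by
  unfold mdLabel at h
  split_ifs at h
  constructor <;> assumption

theorem mdLabel_eq_one (h : mdLabel G M = VLabel.one) :
    M.1.ncard ≠ 1 ∧ ¬ (G.induce M.1)ᶜ.Connected := by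
  unfold mdLabel at h
  split_ifs at h
  constructor <;> assumption

theorem mdLabel_eq_prime (h : mdLabel G M = VLabel.prime) :
    M.1.ncard ≠ 1 ∧ (G.induce M.1).Connected ∧ (G.induce M.1)ᶜ.Connected := by
  unfold mdLabel at h
  split_ifs at h
  refine ⟨by assumption, ?_, ?_⟩ <;> (by_contra; contradiction)

/-- Between two disjoint modules either all pairs are adjacent or none, so any representatives
decide adjacency in the quotient. -/
theorem quotientGraph_adj {M : Set X} {S T : maxStrong G M} (hne : S ≠ T) {x y : X}
    (hx : x ∈ S.1) (hy : y ∈ T.1) : (quotientGraph G M).Adj S T ↔ G.Adj x y := by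
  have hne' : S.1 ≠ T.1 := fun e => hne (Subtype.ext e)
  have key : ∀ {U V : maxStrong G M}, U.1 ≠ V.1 → ∀ {a a' b b'}, a ∈ U.1 → a' ∈ U.1 → b ∈ V.1 →
      b' ∈ V.1 → G.Adj a b → G.Adj a' b' := by
    intro U V hUV a a' b b' ha ha' hb hb' hab
    have hbU : b ∉ U.1 := fun h => hUV (maxStrong_eq_of_mem U.2 V.2 h hb)
    have haV : a' ∉ V.1 := fun h => hUV (maxStrong_eq_of_mem U.2 V.2 ha' h)
    have h1 := ((maxStrong_module U.2).2 a ha a' ha' b (maxStrong_subset V.2 hb) hbU).1 hab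
    exact (((maxStrong_module V.2).2 b hb b' hb' a' (maxStrong_subset U.2 ha') haV).1 h1.symm).symm
  simp only [quotientGraph, SimpleGraph.fromRel_adj, ne_eq, hne, not_false_eq_true, true_and]
  constructor
  · rintro (⟨a, ha, b, hb, hab⟩ | ⟨b, hb, a, ha, hab⟩)
    · exact key hne' ha hx hb hy hab
    · exact key hne' ha hx hb hy hab.symm
  · exact fun h => Or.inl ⟨x, hx, y, hy, h⟩

end Labels

/-! ### Cycles of pvr-networks -/

section PvrCycles

variable {X : Type*} {G : SimpleGraph X} {R : PvrChoice G}

/-- The vertices of the replacement of `P` that are neither the root nor a leaf. -/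
abbrev InnerVertex (R : PvrChoice G) (P : PrimeVertex G) : Type :=
  {w : (R P).W // w ≠ (R P).root ∧ w ∉ range (R P).leaf}

/-- The non-leaf vertices of the replacement of `P`; `none` is the root. -/
def toReplacement (R : PvrChoice G) (P : PrimeVertex G) : Option (InnerVertex R P) → (R P).W
  | none => (R P).root
  | some w => w.1

/-- The non-leaf vertices of the replacement of `P` as vertices of the pvr-network. -/
def toPvr (R : PvrChoice G) (P : PrimeVertex G) : Option (InnerVertex R P) → PvrVertex R
  | none => Sum.inl P.1
  | some w => Sum.inr ⟨P, w⟩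

theorem toReplacement_injective (P : PrimeVertex G) :
    Function.Injective (toReplacement R P) := by
  rintro (_ | a) (_ | b) h
  · rfl
  · exact absurd h.symm b.2.1
  · exact absurd h a.2.1
  · exact congrArg some (Subtype.ext h)

theorem toPvr_injective (P : PrimeVertex G) : Function.Injective (toPvr R P) := by
  rintro (_ | a) (_ | b) h
  · rfl
  · exact absurd h (by simp [toPvr])
  · exact absurd h (by simp [toPvr])
  · simpa [toPvr] using h

theorem Glue.cases' {P : PrimeVertex G} {w : (R P).W} {a : PvrVertex R} (h : Glue R P w a) :
    (∃ o, w = toReplacement R P o ∧ a = toPvr R P o) ∨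
      ∃ S, w = (R P).leaf S ∧ a = Sum.inl (childVertex P.1 S) := by
  cases h with
  | root => exact Or.inl ⟨none, rfl, rfl⟩
  | leaf S => exact Or.inr ⟨S, rfl, rfl⟩
  | inner w => exact Or.inl ⟨some w, rfl, rfl⟩

theorem glue_toPvr (P : PrimeVertex G) (o : Option (InnerVertex R P)) :
    Glue R P (toReplacement R P o) (toPvr R P o) := by
  cases o with
  | none => exact Glue.root
  | some w => exact Glue.inner w

theorem toPvr_eq_iff {P P' : PrimeVertex G} {o : Option (InnerVertex R P)}
    {o' : Option (InnerVertex R P')} (h : toPvr R P o = toPvr R P' o') : P = P' := by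
  rcases o with _ | a <;> rcases o' with _ | b
  · exact Subtype.ext (Sum.inl.inj h)
  · simp [toPvr] at h
  · simp [toPvr] at h
  · simp only [toPvr, Sum.inr.injEq, Sigma.mk.injEq] at h
    exact h.1

theorem Replacement.exists_cycle {M : Set X} (r : Replacement G M) :
    ∃ C : RootedCycle r.N, IsElementaryWith r.N (range r.leaf) C ∧ C.root = r.root := by
  have := r.finite
  obtain ⟨C, hC⟩ := r.elementary.exists_cycle
  have hno := not_adj_of_indeg_eq_zero r.indeg_root
  refine ⟨C, hC, ?_⟩
  by_contra hne
  rcases hC.cover r.root with h | h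
  · obtain ⟨u, hu⟩ := C.exists_isEdge h (Ne.symm hne)
    exact hno u hu.adj
  · obtain ⟨u, hu⟩ := hC.exists_parent _ h
    exact hno u hu

/-- Edges of the pvr-network that leave a non-leaf vertex of the replacement of `P`. -/
theorem adj_toPvr {P : PrimeVertex G} {o : Option (InnerVertex R P)} {b : PvrVertex R} :
    (pvrNetwork R).Adj (toPvr R P o) b ↔
      ∃ w, (R P).N.Adj (toReplacement R P o) w ∧ Glue R P w b := by
  constructor
  · generalize ha : toPvr R P o = a
    rintro (⟨M, c, hM, hc⟩ | ⟨P', w, w', a, b, hadj, hg, hg'⟩)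
    · cases o with
      | none =>
        simp only [toPvr, Sum.inl.injEq] at ha
        exact absurd (ha ▸ P.2) hM
      | some w => simp [toPvr] at ha
    · obtain ⟨C, hC, -⟩ := (R P').exists_cycle
      rcases hg.cases' with ⟨o', rfl, ha'⟩ | ⟨S, rfl, -⟩
      · obtain rfl := toPvr_eq_iff (ha.trans ha')
        obtain rfl := toPvr_injective P (ha.trans ha')
        exact ⟨w', hadj, hg'⟩
      · exact absurd hadj (hC.leaf_not_adj _ (mem_range_self S) _)
  · rintro ⟨w, hadj, hg⟩
    exact PvrAdj.replaced P _ w _ b hadj (glue_toPvr P o) hg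

theorem adj_toPvr_toPvr {P : PrimeVertex G} {o o' : Option (InnerVertex R P)} :
    (pvrNetwork R).Adj (toPvr R P o) (toPvr R P o') ↔
      (R P).N.Adj (toReplacement R P o) (toReplacement R P o') := by
  rw [adj_toPvr]
  constructor
  · rintro ⟨w, hadj, hg⟩
    rcases hg.cases' with ⟨o'', rfl, h⟩ | ⟨S, rfl, h⟩
    · rwa [toPvr_injective P h]
    · cases o' with
      | some w => simp [toPvr] at h
      | none =>
        simp only [toPvr, Sum.inl.injEq] at h
        exact absurd (congrArg Subtype.val h).symm (maxStrong_ne S.2)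
  · exact fun h => ⟨_, h, glue_toPvr P o'⟩

/-- The module below which a vertex of the pvr-network lies. -/
def supp : PvrVertex R → Set X
  | Sum.inl M => M.1
  | Sum.inr ⟨P, _⟩ => P.1.1

theorem supp_toPvr (P : PrimeVertex G) (o : Option (InnerVertex R P)) :
    supp (toPvr R P o) = P.1.1 := by
  cases o <;> rfl

theorem supp_nonempty (a : PvrVertex R) : (supp a).Nonempty := by
  rcases a with M | ⟨P, w⟩
  · exact M.2.1
  · exact P.1.2.1

theorem supp_subset {a b : PvrVertex R} (h : (pvrNetwork R).Adj a b) : supp b ⊆ supp a := by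
  rcases h with ⟨M, c, hM, hc⟩ | ⟨P, w, w', a, b, hadj, hg, hg'⟩
  · exact hc.le
  · obtain ⟨C, hC, -⟩ := (R P).exists_cycle
    rcases hg.cases' with ⟨o, rfl, rfl⟩ | ⟨S, rfl, -⟩
    · rw [supp_toPvr]
      rcases hg'.cases' with ⟨o', rfl, rfl⟩ | ⟨S, rfl, rfl⟩
      · rw [supp_toPvr]
      · exact maxStrong_subset S.2
    · exact absurd hadj (hC.leaf_not_adj _ (mem_range_self S) _)

theorem supp_subset_of_chain {l : List (PvrVertex R)} {a b : PvrVertex R}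
    (h : List.IsChain (pvrNetwork R).Adj (a :: l)) (hb : b ∈ l) : supp b ⊆ supp a := by
  induction l generalizing a with
  | nil => simp at hb
  | cons c l ih =>
    rw [List.isChain_cons_cons] at h
    rcases List.mem_cons.1 hb with rfl | hb
    · exact supp_subset h.1
    · exact (ih h.2 hb).trans (supp_subset h.1)

/-- A path that starts in the replacement of `P` stays there or leaves it through a leaf. -/
theorem path_stays_or_leaves {P : PrimeVertex G} {η : PvrVertex R} (l : List (PvrVertex R))
    (o : Option (InnerVertex R P))
    (h : List.IsChain (pvrNetwork R).Adj (toPvr R P o :: (l ++ [η]))) :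
    (∀ v ∈ l ++ [η], v ∈ range (toPvr R P)) ∨
      ∃ (S : maxStrong G P.1.1) (o' : Option (InnerVertex R P)), toPvr R P o' ∈ toPvr R P o :: l ∧
        (R P).N.Adj (toReplacement R P o') ((R P).leaf S) ∧
        Sum.inl (childVertex P.1 S) ∈ l ++ [η] ∧ supp η ⊆ S.1 := by
  induction l generalizing o with
  | nil =>
    simp only [List.nil_append, List.isChain_cons_cons] at h
    obtain ⟨w, hadj, hg⟩ := adj_toPvr.1 h.1
    rcases hg.cases' with ⟨o', rfl, rfl⟩ | ⟨S, rfl, rfl⟩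
    · left; simp
    · exact Or.inr ⟨S, o, by simp, hadj, by simp, subset_rfl⟩
  | cons b l ih =>
    rw [List.cons_append, List.isChain_cons_cons] at h
    obtain ⟨w, hadj, hg⟩ := adj_toPvr.1 h.1
    rcases hg.cases' with ⟨o', rfl, rfl⟩ | ⟨S, rfl, rfl⟩
    · rcases ih o' h.2 with h' | ⟨S, o'', h1, h2, h3, h4⟩
      · left
        intro v hv
        rcases List.mem_cons.1 hv with rfl | hv
        · exact mem_range_self _
        · exact h' v hv
      · exact Or.inr ⟨S, o'', List.mem_cons_of_mem _ h1, h2, List.mem_cons_of_mem _ h3, h4⟩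
    · exact Or.inr ⟨S, o, by simp, hadj, by simp, supp_subset_of_chain h.2 (by simp)⟩

/-- A side can leave the replacement only through a leaf S, after which everything lies below S. If
both sides left, they would do so through the same leaf, hence through its only parent, which is a
forbidden common inner vertex. -/
theorem cycle_stays {P : PrimeVertex G} (C : RootedCycle (pvrNetwork R))
    (hroot : C.root = Sum.inl P.1) : C.verts ⊆ range (toPvr R P) := by
  obtain ⟨C₀, hC₀, hr₀⟩ := (R P).exists_cycle
  have hroot' : C.root = toPvr R P none := hroot
  have p₁ := C.path₁
  have p₂ := C.path₂
  rw [hroot'] at p₁ p₂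
  -- Excludes that exactly one side leaves: a hybrid-vertex inside the replacement has support P,
  -- which is not contained in a proper submodule.
  have hin : ∀ S : maxStrong G P.1.1, ¬ (supp C.hybrid ⊆ S.1 ∧ C.hybrid ∈ range (toPvr R P)) := by
    rintro S ⟨h, o, ho⟩
    rw [← ho, supp_toPvr] at h
    exact maxStrong_ne S.2 (subset_antisymm (maxStrong_subset S.2) h)
  rcases path_stays_or_leaves _ _ p₁ with h₁ | ⟨S, o, ho, hoS, hS, hηS⟩ <;>
    rcases path_stays_or_leaves _ _ p₂ with h₂ | ⟨S', o', ho', hoS', hS', hηS'⟩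
  · intro v hv
    rcases C.mem_verts.1 hv with rfl | rfl | hv | hv
    · exact ⟨none, hroot'.symm⟩
    · exact h₁ _ (by simp)
    · exact h₁ _ (by simp [hv])
    · exact h₂ _ (by simp [hv])
  · exact (hin S' ⟨hηS', h₁ _ (by simp)⟩).elim
  · exact (hin S ⟨hηS, h₂ _ (by simp)⟩).elim
  · obtain ⟨x, hx⟩ := supp_nonempty C.hybrid
    have hSS' : S = S' := Subtype.ext (maxStrong_eq_of_mem S.2 S'.2 (hηS hx) (hηS' hx))
    subst hSS'
    have hoo : o = o' := toReplacement_injective P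
      (hC₀.leaf_parent _ (mem_range_self S) _ _ hoS hoS')
    subst hoo
    have hne : toReplacement R P o ≠ C₀.root := (hC₀.parent_mem (mem_range_self S) hoS).2
    have hon : toPvr R P o ≠ toPvr R P none := fun e => hne (by
      rw [toPvr_injective P e, hr₀]; rfl)
    exact (C.disjoint ((List.mem_cons.1 ho).resolve_left hon)
      ((List.mem_cons.1 ho').resolve_left hon)).elim

/-- The non-leaf vertices of the replacement of `P`, as a directed graph. -/
def innerDigraph (R : PvrChoice G) (P : PrimeVertex G) : Digraph (Option (InnerVertex R P)) where
  Adj o o' := (R P).N.Adj (toReplacement R P o) (toReplacement R P o')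

/-- A cycle of the pvr-network with a prime vertex as root is the cycle of the replacement. -/
theorem pvr_cycle {P : PrimeVertex G} (C : RootedCycle (pvrNetwork R))
    (hroot : C.root = Sum.inl P.1) {C₀ : RootedCycle (R P).N}
    (hC₀ : IsElementaryWith (R P).N (range (R P).leaf) C₀) :
    (∃ η : InnerVertex R P, C.hybrid = Sum.inr ⟨P, η⟩ ∧ η.1 = C₀.hybrid) ∧
      ∀ v, (v ∈ C.verts ∧ v ≠ C.root) ↔ ∃ w : InnerVertex R P, v = Sum.inr ⟨P, w⟩ := by
  obtain ⟨C', rfl⟩ := RootedCycle.exists_map_eq (N₁ := innerDigraph R P) (toPvr_injective P)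
    (fun a b => adj_toPvr_toPvr.symm) C (cycle_stays C hroot)
  -- The cycle is pulled back to `innerDigraph` and pushed into the replacement, where the
  -- hybrid-vertex and the vertex set of a cycle are unique.
  set C'' := C'.map (toReplacement R P) (toReplacement_injective P) (fun a b h => h) with hC''
  have hroot' : C'.root = none := toPvr_injective P hroot
  have hhyb := hC₀.hybrid_eq C''
  have hverts : toReplacement R P '' C'.verts = C₀.verts :=
    (RootedCycle.verts_map C').symm.trans (hC₀.verts_eq C'')
  constructor
  · have hne := C'.root_ne_hybrid
    rw [hroot'] at hne
    obtain ⟨η, hη⟩ := Option.ne_none_iff_exists'.1 hne.symm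
    refine ⟨η, ?_, ?_⟩
    · simp [RootedCycle.map, hη, toPvr]
    · rw [← hhyb, hC'']
      simp [RootedCycle.map, hη, toReplacement]
  · intro v
    rw [RootedCycle.verts_map]
    constructor
    · rintro ⟨⟨o, ho, rfl⟩, hne⟩
      cases o with
      | none => exact absurd (by simp [RootedCycle.map, hroot']) hne
      | some w => exact ⟨w, rfl⟩
    · rintro ⟨w, rfl⟩
      refine ⟨?_, by rw [hroot]; simp⟩
      have hw : w.1 ∈ C₀.verts := (hC₀.cover w.1).resolve_right w.2.2
      rw [← hverts] at hw
      obtain ⟨o, ho, how⟩ := hw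
      have : o = some w := toReplacement_injective P how
      exact ⟨some w, this ▸ ho, rfl⟩

theorem exists_pvr_cycle (P : PrimeVertex G) :
    ∃ C : RootedCycle (pvrNetwork R), C.root = Sum.inl P.1 := by
  obtain ⟨C₀, hC₀, hr₀⟩ := (R P).exists_cycle
  obtain ⟨C', hC'⟩ := RootedCycle.exists_map_eq (N₁ := innerDigraph R P)
    (toReplacement_injective P) (fun a b => Iff.rfl) C₀ (by
      intro v hv
      by_cases hvr : v = (R P).root
      · exact ⟨none, hvr.symm⟩
      · exact ⟨some ⟨v, hvr, hC₀.notMem_leaves hv⟩, rfl⟩)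
  refine ⟨C'.map (toPvr R P) (toPvr_injective P) (fun a b h => adj_toPvr_toPvr.2 h), ?_⟩
  have h1 : toReplacement R P C'.root = toReplacement R P none := by
    rw [← hC'] at hr₀
    exact hr₀
  simp [RootedCycle.map, toReplacement_injective P h1, toPvr]

end PvrCycles

end GaTEx

namespace GaTEx

open Set
open scoped List

/-! ### Correctness of the algorithm -/

section Algorithm

variable {X : Type*} {G : SimpleGraph X} {R : PvrChoice G}

theorem isGoodOrder_singleton {x : X} {S : Set X} (hS : S = {x}) : IsGoodOrder G S [x] := by
  subst hS
  refine ⟨⟨by simp, by simp⟩, fun a b c d _ hab => ?_⟩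
  have := hab.length_le
  simp at this

/-- Different blocks are pairwise completely nonadjacent (label 0) or completely adjacent (label 1).
An induced path through four blocks has both an edge and a non-edge, so none exists and any order of
the blocks works. -/
theorem isGoodOrder_nonprime [Finite X] {M : MDVertex G} {ζ : AlgState R}
    {cs : List (MDVertex G)} (hM : mdLabel G M = VLabel.zero ∨ mdLabel G M = VLabel.one)
    (hcs : Enumerates cs {c | c ⋖ M})
    (hch : ∀ c, c ⋖ M → IsGoodOrder G c.1 (ζ (Sum.inl c))) :
    IsGoodOrder G M.1 (cs.flatMap fun c => ζ (Sum.inl c)) := by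
  have hcard : M.1.ncard ≠ 1 := hM.elim (fun h => (mdLabel_eq_zero h).1)
    fun h => (mdLabel_eq_one h).1
  have hmem : ∀ c, c ∈ cs ↔ c ⋖ M := hcs.2
  have hmax : ∀ c ∈ cs, c.1 ∈ maxStrong G M.1 := fun c hc =>
    (covBy_iff_mem_maxStrong c M).1 ((hmem c).1 hc)
  refine isGoodOrder_flatMap (S := Subtype.val) (hcs.1.map Subtype.val_injective)
    (fun T => ?_) (fun x hx => exists_maxStrong_mem hcard hx)
    (fun c hc => hch c ((hmem c).1 hc)) ?_
  · rw [List.mem_map]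
    constructor
    · rintro ⟨c, hc, rfl⟩
      exact hmax c hc
    · exact fun hT => ⟨childVertex M ⟨T, hT⟩,
        (hmem _).2 ((covBy_iff_mem_maxStrong _ _).2 hT), rfl⟩
  · intro i hi j hj k hk m hm hnd _ _ a ha b hb c hc d hd hP
    simp only [List.nodup_cons, List.mem_cons, not_or] at hnd
    rcases hM with h | h
    · exact not_adj_of_not_connected (mdLabel_eq_zero h).2 (hmax i hi) (hmax j hj) hnd.1.1 ha hb
        hP.ab
    · exact hP.ac (adj_of_not_compl_connected (mdLabel_eq_one h).2 (hmax i hi) (hmax k hk)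
        hnd.1.2.1 ha hc)

open Classical in
-- An obstruction through four blocks is an induced path in the quotient, so it uses the hybrid
-- block: as an end if the root has label 1, although an end must precede its neighbor and this
-- block is last; as an inner vertex if the label is 0, although it must follow an end and this
-- block is first.
theorem isGoodOrder_prime [Finite X] {P : PrimeVertex G} {ζ ζ₁ : AlgState R}
    {C : RootedCycle (pvrNetwork R)} {vs : List (PvrVertex R)} (hroot : C.root = Sum.inl P.1)
    (hcopy : ∀ w ∈ C.verts, w ≠ C.root →
      ∃ w', (pvrNetwork R).Adj w w' ∧ w' ∉ C.verts ∧ ζ₁ w = ζ w')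
    (hvs : Enumerates vs (C.verts \ {C.root, C.hybrid}))
    (hch : ∀ c, c ⋖ P.1 → IsGoodOrder G c.1 (ζ (Sum.inl c))) :
    IsGoodOrder G P.1.1
      (if pvrLabel R C.root = VLabel.zero then ζ₁ C.hybrid ++ vs.flatMap ζ₁
        else vs.flatMap ζ₁ ++ ζ₁ C.hybrid) := by
  obtain ⟨C₀, hC₀, hr₀⟩ := (R P).exists_cycle
  obtain ⟨⟨η, hη, hηC⟩, hverts⟩ := pvr_cycle C hroot hC₀
  -- S is the child module whose sequence was copied to v. All other children of a cycle vertex are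
  -- on the cycle, so the copied value can only come from its leaf; off the cycle the choice is
  -- irrelevant.
  have hblock : ∀ v, ∃ S : Set X, (v ∈ C.verts ∧ v ≠ C.root) →
      IsGoodOrder G S (ζ₁ v) ∧ ∃ (w : InnerVertex R P) (hS : S ∈ maxStrong G P.1.1),
        v = Sum.inr ⟨P, w⟩ ∧ (R P).N.Adj w.1 ((R P).leaf ⟨S, hS⟩) := by
    intro v
    by_cases hv : v ∈ C.verts ∧ v ≠ C.root
    · obtain ⟨w, rfl⟩ := (hverts v).1 hv
      obtain ⟨w', hadj, hnot, he⟩ := hcopy _ hv.1 hv.2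
      obtain ⟨u, hu, hg⟩ := adj_toPvr (o := some w).1 hadj
      rcases hg.cases' with ⟨o, rfl, rfl⟩ | ⟨S, rfl, rfl⟩
      · cases o with
        | none => exact absurd hu (by
            have := hC₀.not_adj_root w.1
            rw [hr₀] at this
            exact this)
        | some w' => exact absurd ((hverts _).2 ⟨w', rfl⟩).1 hnot
      · refine ⟨S.1, fun _ => ⟨?_, w, S.2, rfl, hu⟩⟩
        rw [he]
        exact hch (childVertex P.1 S) ((covBy_iff_mem_maxStrong _ _).2 S.2)
    · exact ⟨∅, fun h => absurd h hv⟩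
  choose T hT using hblock
  have hhyb : C.hybrid ∈ C.verts ∧ C.hybrid ≠ C.root := (hverts _).2 ⟨η, hη⟩
  have hks : ∀ v, v ∈ vs ↔ (v ∈ C.verts ∧ v ≠ C.root) ∧ v ≠ C.hybrid := by
    intro v
    rw [hvs.2 v]
    simp [and_assoc]
  have hparent : ∀ S : maxStrong G P.1.1, ∃ u, (R P).N.Adj u ((R P).leaf S) := fun S =>
    hC₀.exists_parent _ (mem_range_self S)
  choose k hk using hparent
  have hkT : ∀ v (hv : v ∈ C.verts ∧ v ≠ C.root) (hS : T v ∈ maxStrong G P.1.1),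
      k ⟨T v, hS⟩ = C₀.hybrid → v = C.hybrid := by
    intro v hv hS he
    obtain ⟨-, w, hS', rfl, hw⟩ := hT v hv
    have h1 := hC₀.leaf_parent _ (mem_range_self _) _ _ (hk ⟨_, hS⟩) hw
    rw [hη, show w = η from Subtype.ext (by rw [← h1, he, hηC])]
  -- Both cases of the algorithm at once: only the position of the hybrid-vertex matters, not the
  -- order of the other cycle vertices.
  have key : ∀ ks : List (PvrVertex R), ks.Nodup →
      (∀ v, v ∈ ks ↔ v ∈ C.verts ∧ v ≠ C.root) →
      ((R P).t C₀.root = VLabel.one → ∀ v, ¬ [C.hybrid, v] <+ ks) →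
      ((R P).t C₀.root ≠ VLabel.one → ∀ v, ¬ [v, C.hybrid] <+ ks) →
      IsGoodOrder G P.1.1 (ks.flatMap ζ₁) := by
    intro ks hnd hmem h1 h2
    have hmax : ∀ v ∈ ks, T v ∈ maxStrong G P.1.1 := fun v hv => by
      obtain ⟨-, w, hS, -⟩ := hT v ((hmem v).1 hv)
      exact hS
    refine isGoodOrder_flatMap (S := T) ?_ (fun S => ?_)
      (fun x hx => exists_maxStrong_mem (mdLabel_eq_prime P.2).1 hx)
      (fun v hv => (hT v ((hmem v).1 hv)).1) ?_
    · refine List.Nodup.map_on ?_ hnd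
      intro v hv v' hv' e
      obtain ⟨-, w, hS, hw, hadj⟩ := hT v ((hmem v).1 hv)
      obtain ⟨-, w', hS', hw', hadj'⟩ := hT v' ((hmem v').1 hv')
      have e' : (⟨T v', hS'⟩ : maxStrong G P.1.1) = ⟨T v, hS⟩ := Subtype.ext e.symm
      rw [e'] at hadj'
      rw [hw, hw', show w = w' from
        Subtype.ext (hC₀.leaf_parent _ (mem_range_self _) _ _ hadj hadj')]
    · rw [List.mem_map]
      constructor
      · rintro ⟨v, hv, rfl⟩
        exact hmax v hv
      · intro hS
        have h3 := hC₀.parent_mem (mem_range_self _) (hk ⟨S, hS⟩)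
        let w : InnerVertex R P := ⟨k ⟨S, hS⟩, hr₀ ▸ h3.2, hC₀.notMem_leaves h3.1⟩
        have hw := (hverts (Sum.inr ⟨P, w⟩)).2 ⟨w, rfl⟩
        refine ⟨Sum.inr ⟨P, w⟩, (hmem _).2 hw, ?_⟩
        obtain ⟨-, w', hS', hw', hadj'⟩ := hT _ hw
        have hww : w = w' := by simpa using hw'
        subst hww
        exact congrArg Subtype.val ((R P).leaf_injective
          (hC₀.leaf_unique _ h3.1 h3.2 _ (mem_range_self _) _ (mem_range_self _) hadj'
            (hk ⟨S, hS⟩)))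
    · intro i hi j hj l hl m hm hnd' hij hml a ha b hb c hc d hd hp4
      simp only [List.nodup_cons, List.mem_cons, not_or, List.not_mem_nil, or_false,
        not_false_eq_true] at hnd'
      obtain ⟨⟨n1, n2, n3⟩, ⟨n4, n5⟩, n6, -⟩ := hnd'
      have hq : IsP4 (explainedGraph (R P).N (R P).t (R P).leaf) ⟨T i, hmax i hi⟩
          ⟨T j, hmax j hj⟩ ⟨T l, hmax l hl⟩ ⟨T m, hmax m hm⟩ := by
        rw [(R P).explains]
        have hne : ∀ {U V : Set X} {hU : U ∈ maxStrong G P.1.1} {hV : V ∈ maxStrong G P.1.1},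
            U ≠ V → (⟨U, hU⟩ : maxStrong G P.1.1) ≠ ⟨V, hV⟩ := fun h e =>
          h (congrArg Subtype.val e)
        constructor
        · exact (quotientGraph_adj (hne n1) ha hb).2 hp4.ab
        · exact (quotientGraph_adj (hne n4) hb hc).2 hp4.bc
        · exact (quotientGraph_adj (hne n6) hc hd).2 hp4.cd
        · exact fun h => hp4.ac ((quotientGraph_adj (hne n2) ha hc).1 h)
        · exact fun h => hp4.bd ((quotientGraph_adj (hne n5) hb hd).1 h)
        · exact fun h => hp4.ad ((quotientGraph_adj (hne n3) ha hd).1 h)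
      have hhy := hC₀.hybrid_of_isP4 (R P).leaf_injective hk hq
      by_cases ht : (R P).t C₀.root = VLabel.one
      · rcases hhy.1 ht with h | h
        · exact h1 ht j (hkT i ((hmem i).1 hi) _ h ▸ hij)
        · exact h1 ht l (hkT m ((hmem m).1 hm) _ h ▸ hml)
      · rcases hhy.2 ht with h | h
        · exact h2 ht i (hkT j ((hmem j).1 hj) _ h ▸ hij)
        · exact h2 ht m (hkT l ((hmem l).1 hl) _ h ▸ hml)
  have hnot : C.hybrid ∉ vs := fun h => ((hks _).1 h).2 rfl
  have hlabel : pvrLabel R C.root = (R P).t C₀.root := by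
    rw [hroot, hr₀]
    simp [pvrLabel, P.2]
  have hall : ∀ v, (v = C.hybrid ∨ v ∈ vs) ↔ v ∈ C.verts ∧ v ≠ C.root := by
    intro v
    rw [hks]
    constructor
    · rintro (rfl | h)
      · exact hhyb
      · exact h.1
    · exact fun h => (_root_.em _).imp_right fun h' => ⟨h, h'⟩
  split_ifs with hz
  · have := key (C.hybrid :: vs) (List.nodup_cons.2 ⟨hnot, hvs.1⟩)
      (fun v => by rw [List.mem_cons, hall])
      (fun h => by rw [← hlabel, hz] at h; cases h) (fun _ v h => ?_)
    · simpa using this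
    · rw [List.sublist_cons_iff] at h
      rcases h with h | ⟨r, hr, h⟩
      · exact hnot (h.subset (by simp))
      · simp only [List.cons.injEq] at hr
        exact hnot (h.subset (by simp [← hr.2]))
  · have hone : (R P).t C₀.root = VLabel.one := by
      rw [hlabel] at hz
      have h1 := (R P).labeling.2 C₀.root
      have h2 : (R P).t C₀.root ≠ VLabel.leaf := fun e =>
        hC₀.notMem_leaves (C₀.mem_verts.2 (Or.inl rfl)) (((R P).labeling.1 _).1 e)
      cases h : (R P).t C₀.root with
      | zero => exact absurd h hz
      | one => rfl
      | leaf => exact absurd h h2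
      | prime => exact absurd h h1
    have := key (vs ++ [C.hybrid])
      (List.Nodup.append hvs.1 (by simp) (by simpa using hnot))
      (fun v => by rw [List.mem_append, List.mem_singleton, or_comm, hall])
      (fun _ v h => ?_) (fun h => absurd hone h)
    · simpa using this
    · rw [List.sublist_append_iff] at h
      obtain ⟨l₁, l₂, he, h1, h2⟩ := h
      match l₁, he with
      | [], he =>
        simp only [List.nil_append] at he
        subst he
        have := h2.length_le
        simp at this
      | x :: l₁, he =>
        simp only [List.cons_append, List.cons.injEq] at he
        exact hnot (he.1 ▸ h1.subset (by simp))

theorem Step.isGoodOrder [Finite X] {M : MDVertex G} {ζ ζ' : AlgState R} (h : Step R M ζ ζ')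
    (hch : ∀ c, c ⋖ M → IsGoodOrder G c.1 (ζ (Sum.inl c)))
    (hleaf : mdLabel G M = VLabel.leaf → IsGoodOrder G M.1 (ζ (Sum.inl M))) :
    IsGoodOrder G M.1 (ζ' (Sum.inl M)) ∧
      ∀ M', M' ≠ M → ζ' (Sum.inl M') = ζ (Sum.inl M') := by
  classical
  cases h with
  | leaf hl => exact ⟨hleaf hl, fun _ _ => rfl⟩
  | nonprime cs hM hcs =>
    refine ⟨?_, fun M' hne => Function.update_of_ne (by simpa using hne) _ _⟩
    rw [Function.update_self]
    exact isGoodOrder_nonprime hM hcs hch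
  | prime ζ₁ C vs hM hroot hcopy hkeep hvs =>
    have hgood := isGoodOrder_prime (P := ⟨M, hM⟩) hroot hcopy hvs hch
    refine ⟨by rw [Function.update_self]; exact hgood, fun M' hne => ?_⟩
    rw [Function.update_of_ne (by simpa using hne)]
    apply hkeep
    obtain ⟨C₀, hC₀, -⟩ := (R ⟨M, hM⟩).exists_cycle
    intro hv
    obtain ⟨w, hw⟩ := ((pvr_cycle (P := ⟨M, hM⟩) C hroot hC₀).2 _).1 hv
    cases hw

/-- All leaves and all elements of `D` have good orders in the state `ζ`. -/
def GoodState (R : PvrChoice G) (D : Set (MDVertex G)) (ζ : AlgState R) : Prop :=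
  ∀ M, mdLabel G M = VLabel.leaf ∨ M ∈ D → IsGoodOrder G M.1 (ζ (Sum.inl M))

theorem Step.goodState [Finite X] {M : MDVertex G} {ζ ζ' : AlgState R} (h : Step R M ζ ζ')
    {D : Set (MDVertex G)} (hζ : GoodState R D ζ) (hch : ∀ c, c ⋖ M → c ∈ D) :
    GoodState R (insert M D) ζ' := by
  obtain ⟨h1, h2⟩ := h.isGoodOrder (fun c hc => hζ c (Or.inr (hch c hc)))
    (fun hl => hζ M (Or.inl hl))
  intro M' hM'
  by_cases hne : M' = M
  · exact hne ▸ h1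
  · rw [h2 M' hne]
    exact hζ M' (hM'.imp_right fun h => (mem_insert_iff.1 h).resolve_left hne)

theorem Loop.of_append {l₁ l₂ : List (MDVertex G)} {ζ ζ' : AlgState R}
    (h : Loop R (l₁ ++ l₂) ζ ζ') : ∃ ζ₁, Loop R l₁ ζ ζ₁ ∧ Loop R l₂ ζ₁ ζ' := by
  induction l₁ generalizing ζ with
  | nil => exact ⟨ζ, Loop.nil ζ, h⟩
  | cons M l ih =>
    cases h with
    | cons _ _ _ ζ₂ _ hs hl =>
      obtain ⟨ζ₁, h1, h2⟩ := ih hl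
      exact ⟨ζ₁, Loop.cons _ _ _ _ _ hs h1, h2⟩

/-- In a postorder all children are finished before M. The set D of vertices already done is
arbitrary, so that the results for earlier siblings survive while a later subtree is processed. -/
theorem Postorder.goodState [Finite X] {M : MDVertex G} {l : List (MDVertex G)}
    (h : Postorder M l) : ∀ {D : Set (MDVertex G)} {ζ ζ' : AlgState R}, Loop R l ζ ζ' →
      GoodState R D ζ → GoodState R (insert M D) ζ' := by
  induction h with
  | mk M cs f hcs hf ih =>
    intro D ζ ζ' hloop hζ
    obtain ⟨ζ₁, hl₁, hl₂⟩ := hloop.of_append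
    have hcs' : ∀ cs' : List (MDVertex G), (∀ c ∈ cs', c ∈ cs) → ∀ {D ζ ζ'},
        Loop R (cs'.flatMap f) ζ ζ' → GoodState R D ζ →
        GoodState R (D ∪ {c | c ∈ cs'}) ζ' := by
      intro cs'
      induction cs' with
      | nil =>
        intro _ D ζ ζ' hl hD
        cases hl
        simpa using hD
      | cons c cs' ih' =>
        intro hsub D ζ ζ' hl hD
        rw [List.flatMap_cons] at hl
        obtain ⟨ζ₂, h1, h2⟩ := hl.of_append
        have h3 := ih' (fun c hc => hsub c (List.mem_cons_of_mem _ hc)) h2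
          (ih c (hsub c (by simp)) h1 hD)
        intro M' hM'
        refine h3 M' (hM'.imp_right fun h => ?_)
        rcases h with h | h
        · exact Or.inl (Or.inr h)
        · rcases List.mem_cons.1 h with rfl | h
          · exact Or.inl (Or.inl rfl)
          · exact Or.inr h
    have h1 := hcs' cs (fun _ h => h) hl₁ hζ
    cases hl₂ with
    | cons _ _ _ ζ₂ _ hs hnil =>
      cases hnil
      have h2 := hs.goodState h1 (fun c hc => Or.inr ((hcs.2 c).2 hc))
      intro M' hM'
      exact h2 M' (hM'.imp_right fun h => h.imp_right Or.inl)

theorem AlgReturns.isPerfectOrder [Finite X] {o : List X} (h : AlgReturns R o) :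
    IsPerfectOrder G o := by
  obtain ⟨root, l, ζ, ζ', hroot, hpost, hinit, hloop, rfl⟩ := h
  have h0 : GoodState R ∅ ζ := by
    rintro M (hM | hM)
    · obtain ⟨x, hx⟩ := Set.ncard_eq_one.1 (mdLabel_eq_leaf hM)
      rw [hinit x M hx]
      exact isGoodOrder_singleton hx
    · exact absurd hM (notMem_empty M)
  have := hpost.goodState hloop h0 root (Or.inr (mem_insert _ _))
  rw [hroot] at this
  exact this.isPerfectOrder

/-! ### The algorithm can be carried out -/

theorem exists_enumerates {α : Type*} [Finite α] (s : Set α) : ∃ l : List α, Enumerates l s :=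
  ⟨(Set.toFinite s).toFinset.toList, Finset.nodup_toList _, by simp⟩

/-- Only the prime case needs an argument: the cycle of the replacement is a cycle of the network,
and the leaf pendant at a cycle vertex supplies the child outside the cycle. -/
theorem exists_step [Finite X] (R : PvrChoice G) (M : MDVertex G) (ζ : AlgState R) :
    ∃ ζ', Step R M ζ ζ' := by
  classical
  cases hM : mdLabel G M with
  | leaf => exact ⟨ζ, Step.leaf M ζ hM⟩
  | zero =>
    obtain ⟨cs, hcs⟩ := exists_enumerates {c | c ⋖ M}
    exact ⟨_, Step.nonprime M ζ cs (Or.inl hM) hcs⟩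
  | one =>
    obtain ⟨cs, hcs⟩ := exists_enumerates {c | c ⋖ M}
    exact ⟨_, Step.nonprime M ζ cs (Or.inr hM) hcs⟩
  | prime =>
    obtain ⟨C, hroot⟩ := exists_pvr_cycle (R := R) ⟨M, hM⟩
    obtain ⟨C₀, hC₀, hr₀⟩ := (R ⟨M, hM⟩).exists_cycle
    have hverts := (pvr_cycle (P := ⟨M, hM⟩) C hroot hC₀).2
    have hex : ∀ w, ∃ w', (w ∈ C.verts ∧ w ≠ C.root) →
        (pvrNetwork R).Adj w w' ∧ w' ∉ C.verts := by
      intro w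
      by_cases hw : w ∈ C.verts ∧ w ≠ C.root
      · obtain ⟨v, rfl⟩ := (hverts w).1 hw
        obtain ⟨x, ⟨S, rfl⟩, hx⟩ := hC₀.exists_leaf v.1 ((hC₀.cover v.1).resolve_right v.2.2)
          (by rw [hr₀]; exact v.2.1)
        refine ⟨Sum.inl (childVertex M S), fun _ => ⟨?_, fun hmem => ?_⟩⟩
        · exact adj_toPvr (o := some v).2 ⟨_, hx, Glue.leaf S⟩
        · have hne : Sum.inl (childVertex M S) ≠ C.root := by
            rw [hroot]
            intro e
            exact maxStrong_ne S.2 (congrArg Subtype.val (Sum.inl.inj e))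
          obtain ⟨v', hv'⟩ := (hverts _).1 ⟨hmem, hne⟩
          cases hv'
      · exact ⟨w, fun h => absurd h hw⟩
    choose g hg using hex
    have hfin : (C.verts \ {C.root, C.hybrid}).Finite :=
      (List.finite_toSet (C.root :: C.hybrid :: (C.inner₁ ++ C.inner₂))).subset sdiff_subset
    refine ⟨_, Step.prime M ζ
      (fun w => if w ∈ C.verts ∧ w ≠ C.root then ζ (g w) else ζ w) C hfin.toFinset.toList hM hroot
      (fun w hw hne => ⟨g w, (hg w ⟨hw, hne⟩).1, (hg w ⟨hw, hne⟩).2, if_pos ⟨hw, hne⟩⟩)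
      (fun w hw => if_neg hw) ⟨Finset.nodup_toList _, by simp⟩⟩

theorem exists_loop [Finite X] (R : PvrChoice G) (l : List (MDVertex G)) (ζ : AlgState R) :
    ∃ ζ', Loop R l ζ ζ' := by
  induction l generalizing ζ with
  | nil => exact ⟨ζ, Loop.nil ζ⟩
  | cons M l ih =>
    obtain ⟨ζ₁, h₁⟩ := exists_step R M ζ
    obtain ⟨ζ₂, h₂⟩ := ih ζ₁
    exact ⟨ζ₂, Loop.cons _ _ _ _ _ h₁ h₂⟩

theorem exists_postorder [Finite X] (M : MDVertex G) : ∃ l, Postorder M l := by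
  induction M using WellFoundedLT.induction with
  | ind M ih =>
    obtain ⟨cs, hcs⟩ := exists_enumerates {c | c ⋖ M}
    have hex : ∀ c, ∃ l, c ∈ cs → Postorder c l := by
      intro c
      by_cases hc : c ∈ cs
      · obtain ⟨l, hl⟩ := ih c (CovBy.lt ((hcs.2 c).1 hc))
        exact ⟨l, fun _ => hl⟩
      · exact ⟨[], fun h => absurd h hc⟩
    choose f hf using hex
    exact ⟨_, Postorder.mk M cs f hcs hf⟩

theorem exists_algReturns [Finite X] [Nonempty X] (R : PvrChoice G) :
    ∃ o, AlgReturns R o := by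
  classical
  let root : MDVertex G := ⟨univ, univ_nonempty, isStrongModuleOn_self⟩
  obtain ⟨l, hl⟩ := exists_postorder root
  let ζ : AlgState R
    | Sum.inl M => [M.2.1.some]
    | Sum.inr _ => []
  obtain ⟨ζ', hζ'⟩ := exists_loop R l ζ
  refine ⟨_, root, l, ζ, ζ', rfl, hl, fun x M hM => ?_, hζ', rfl⟩
  have : M.2.1.some ∈ ({x} : Set X) := hM ▸ M.2.1.some_mem
  exact congrArg (fun y => [y]) this

end Algorithm

end GaTEx

namespace GaTEx

open Set

/-! ### Biconnected vertex sets -/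

section Biconnected

variable {W : Type*}

/-- There is a walk from `u` to `w` inside `A`, ignoring directions. -/
def Reach (N : Digraph W) (A : Set W) (u w : W) : Prop :=
  Relation.ReflTransGen (fun a b => (N.Adj a b ∨ N.Adj b a) ∧ a ∈ A ∧ b ∈ A) u w

variable {N : Digraph W} {A B S T P Q : Set W} {u v w x y z : W}

theorem Reach.refl (u : W) : Reach N A u u := Relation.ReflTransGen.refl

theorem Reach.trans (h : Reach N A u v) (h' : Reach N A v w) : Reach N A u w :=
  Relation.ReflTransGen.trans h h'

theorem Reach.symm (h : Reach N A u v) : Reach N A v u := by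
  induction h with
  | refl => exact Reach.refl u
  | tail _ h ih => exact Relation.ReflTransGen.head ⟨h.1.symm, h.2.2, h.2.1⟩ ih

theorem Reach.mono (h : Reach N A u v) (hAB : A ⊆ B) : Reach N B u v := by
  induction h with
  | refl => exact Reach.refl u
  | tail _ h ih => exact Relation.ReflTransGen.tail ih ⟨h.1, hAB h.2.1, hAB h.2.2⟩

theorem Reach.mono_remove (h : Reach N (A \ {v}) u w) (hAB : A ⊆ B) :
    Reach N (B \ {v}) u w :=
  h.mono (sdiff_subset_sdiff_left hAB)

theorem Reach.remove (h : Reach N A u w) (hAB : A ⊆ B) (hv : v ∉ A) :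
    Reach N (B \ {v}) u w :=
  h.mono fun _ ha => ⟨hAB ha, fun e => hv (e ▸ ha)⟩

theorem reachable_induce_iff (u w : A) :
    ((SimpleGraph.fromRel N.Adj).induce A).Reachable u w ↔ Reach N A u w := by
  rw [SimpleGraph.reachable_iff_reflTransGen]
  constructor
  · intro h
    induction h with
    | refl => exact Reach.refl _
    | @tail b c _ hbc ih =>
      refine Relation.ReflTransGen.tail ih ⟨?_, b.2, c.2⟩
      exact ((SimpleGraph.fromRel_adj _ _ _).1 hbc).2
  · intro h
    obtain ⟨w, hw⟩ := w
    simp only at h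
    induction h with
    | refl => exact Relation.ReflTransGen.refl
    | @tail b c _ hbc ih =>
      by_cases hne : b = c
      · subst hne; exact ih hw
      · exact Relation.ReflTransGen.tail (ih hbc.2.1)
          ((SimpleGraph.fromRel_adj _ _ _).2 ⟨hne, hbc.1⟩)

theorem isBiconnected_iff : IsBiconnected N S ↔
    S.Nonempty ∧ (∀ u ∈ S, ∀ w ∈ S, Reach N S u w) ∧
      ∀ v, ∀ u ∈ S, ∀ w ∈ S, u ≠ v → w ≠ v → Reach N (S \ {v}) u w := by
  constructor
  · rintro ⟨h1, h2⟩
    obtain ⟨⟨a, ha⟩⟩ := h1.nonempty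
    have h3 : ∀ u ∈ S, ∀ w ∈ S, Reach N S u w := fun u hu w hw =>
      (reachable_induce_iff ⟨u, hu⟩ ⟨w, hw⟩).1 (h1.preconnected _ _)
    refine ⟨⟨a, ha⟩, h3, fun v u hu w hw huv hwv => ?_⟩
    by_cases hv : v ∈ S
    · exact (reachable_induce_iff (A := S \ {v}) ⟨u, hu, huv⟩ ⟨w, hw, hwv⟩).1 (h2 v hv _ _)
    · exact (h3 u hu w hw).remove subset_rfl hv
  · rintro ⟨⟨a, ha⟩, h1, h2⟩
    have : Nonempty S := ⟨⟨a, ha⟩⟩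
    refine ⟨⟨fun u w => (reachable_induce_iff u w).2 (h1 u u.2 w w.2)⟩, fun v _ u w => ?_⟩
    exact (reachable_induce_iff u w).2 (h2 v u u.2.1 w w.2.1 u.2.2 w.2.2)

/-- Whichever vertex is removed, p or q survives and ties the two remainders together. -/
theorem isBiconnected_union (hS : IsBiconnected N S) (hT : IsBiconnected N T) {p q : W}
    (hpq : p ≠ q) (hpS : p ∈ S) (hpT : p ∈ T) (hqS : q ∈ S) (hqT : q ∈ T) :
    IsBiconnected N (S ∪ T) := by
  rw [isBiconnected_iff] at hS hT ⊢
  refine ⟨⟨p, Or.inl hpS⟩, ?_, ?_⟩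
  · have key : ∀ u ∈ S ∪ T, Reach N (S ∪ T) u p := by
      rintro u (hu | hu)
      · exact (hS.2.1 u hu p hpS).mono subset_union_left
      · exact (hT.2.1 u hu p hpT).mono subset_union_right
    exact fun u hu w hw => (key u hu).trans (key w hw).symm
  · intro v
    obtain ⟨c, hcS, hcT, hcv⟩ : ∃ c, c ∈ S ∧ c ∈ T ∧ c ≠ v := by
      by_cases h : p = v
      · exact ⟨q, hqS, hqT, fun e => hpq (h.trans e.symm)⟩
      · exact ⟨p, hpS, hpT, h⟩
    have key : ∀ u ∈ S ∪ T, u ≠ v → Reach N ((S ∪ T) \ {v}) u c := by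
      rintro u (hu | hu) huv
      · exact (hS.2.2 v u hu c hcS huv hcv).mono_remove subset_union_left
      · exact (hT.2.2 v u hu c hcT huv hcv).mono_remove subset_union_right
    exact fun u hu w hw huv hwv => (key u hu huv).trans (key w hw hwv).symm

/-- `P` behaves like the vertex set of a path from `x` to `y`: it connects `x` and `y`, and
after the removal of a vertex, every other vertex is still connected to `x` or `y`. -/
structure Linked (N : Digraph W) (x y : W) (P : Set W) : Prop where
  left_mem : x ∈ P
  right_mem : y ∈ P
  reach : Reach N P x y
  remove : ∀ v, ∀ u ∈ P, u ≠ v →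
    (x ≠ v ∧ Reach N (P \ {v}) u x) ∨ (y ≠ v ∧ Reach N (P \ {v}) u y)

theorem Linked.symm (h : Linked N x y P) : Linked N y x P :=
  ⟨h.right_mem, h.left_mem, h.reach.symm, fun v u hu huv => (h.remove v u hu huv).symm⟩

theorem Linked.refl (x : W) : Linked N x x {x} := by
  refine ⟨rfl, rfl, Reach.refl _, ?_⟩
  rintro v u rfl huv
  exact Or.inl ⟨huv, Reach.refl _⟩

theorem Linked.edge (h : N.Adj x y) : Linked N x y {x, y} := by
  refine ⟨by simp, by simp, Relation.ReflTransGen.single ⟨Or.inl h, by simp, by simp⟩, ?_⟩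
  rintro v u (rfl | rfl) huv
  · exact Or.inl ⟨huv, Reach.refl _⟩
  · exact Or.inr ⟨huv, Reach.refl _⟩

theorem Linked.trans (h : Linked N x y P) (h' : Linked N y z Q) (hPQ : ∀ v ∈ P, v ∈ Q → v = y) :
    Linked N x z (P ∪ Q) := by
  refine ⟨Or.inl h.left_mem, Or.inr h'.right_mem,
    (h.reach.mono subset_union_left).trans (h'.reach.mono subset_union_right), ?_⟩
  have key : ∀ v, y ≠ v → ∀ u, Reach N ((P ∪ Q) \ {v}) u y →
      (x ≠ v ∧ Reach N ((P ∪ Q) \ {v}) u x) ∨ (z ≠ v ∧ Reach N ((P ∪ Q) \ {v}) u z) := by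
    intro v hyv u hu
    by_cases hvP : v ∈ P
    · have hvQ : v ∉ Q := fun hvQ => hyv (hPQ v hvP hvQ).symm
      exact Or.inr ⟨fun e => hvQ (e ▸ h'.right_mem),
        hu.trans (h'.reach.remove subset_union_right hvQ)⟩
    · exact Or.inl ⟨fun e => hvP (e ▸ h.left_mem),
        hu.trans (h.reach.remove subset_union_left hvP).symm⟩
  rintro v u (hu | hu) huv
  · rcases h.remove v u hu huv with ⟨h1, h2⟩ | ⟨h1, h2⟩
    · exact Or.inl ⟨h1, h2.mono_remove subset_union_left⟩
    · exact key v h1 u (h2.mono_remove subset_union_left)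
  · rcases h'.remove v u hu huv with ⟨h1, h2⟩ | ⟨h1, h2⟩
    · exact key v h1 u (h2.mono_remove subset_union_right)
    · exact Or.inr ⟨h1, h2.mono_remove subset_union_right⟩

/-- Two paths that share only their ends form a cycle. After a removal every vertex still reaches a
surviving end, and if both ends survive, the path that avoids the removed vertex joins them. -/
theorem isBiconnected_of_linked (hP : Linked N x y P) (hQ : Linked N x y Q)
    (hPQ : ∀ v ∈ P, v ∈ Q → v = x ∨ v = y) : IsBiconnected N (P ∪ Q) := by
  rw [isBiconnected_iff]
  have hend : ∀ v, ∀ u ∈ P ∪ Q, u ≠ v →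
      (x ≠ v ∧ Reach N ((P ∪ Q) \ {v}) u x) ∨ (y ≠ v ∧ Reach N ((P ∪ Q) \ {v}) u y) := by
    rintro v u (hu | hu) huv
    · exact (hP.remove v u hu huv).imp (And.imp_right fun h => h.mono_remove subset_union_left)
        (And.imp_right fun h => h.mono_remove subset_union_left)
    · exact (hQ.remove v u hu huv).imp (And.imp_right fun h => h.mono_remove subset_union_right)
        (And.imp_right fun h => h.mono_remove subset_union_right)
  have hxy' : ∀ v, x ≠ v → y ≠ v → Reach N ((P ∪ Q) \ {v}) x y := by
    intro v hx hy
    by_cases hvP : v ∈ P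
    · have hvQ : v ∉ Q := fun hvQ => (hPQ v hvP hvQ).elim (fun e => hx e.symm) fun e => hy e.symm
      exact hQ.reach.remove subset_union_right hvQ
    · exact hP.reach.remove subset_union_left hvP
  have key : ∀ v, ∃ c ∈ P ∪ Q, ∀ u ∈ P ∪ Q, u ≠ v → Reach N ((P ∪ Q) \ {v}) u c := by
    intro v
    by_cases hx : x = v
    · refine ⟨y, Or.inl hP.right_mem, fun u hu huv => ?_⟩
      exact ((hend v u hu huv).resolve_left fun h => h.1 hx).2
    · refine ⟨x, Or.inl hP.left_mem, fun u hu huv => ?_⟩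
      rcases hend v u hu huv with h | h
      · exact h.2
      · exact h.2.trans (hxy' v hx h.1).symm
  refine ⟨⟨x, Or.inl hP.left_mem⟩, ?_, ?_⟩
  · have hx : ∀ u ∈ P ∪ Q, Reach N (P ∪ Q) u x := by
      intro u hu
      by_cases huy : u = y
      · rw [huy]; exact (hP.reach.mono subset_union_left).symm
      · have := ((hend y u hu huy).resolve_right fun h => h.1 rfl).2
        exact this.mono sdiff_subset
    exact fun u hu w hw => (hx u hu).trans (hx w hw).symm
  · intro v u hu w hw huv hwv
    obtain ⟨c, -, hc⟩ := key v
    exact (hc u hu huv).trans (hc w hw hwv).symm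

end Biconnected

/-! ### The ancestor order of a galled-tree -/

section AncestorOrder

variable {W : Type*} {N : Digraph W}

theorem not_ancestor_of_adj (hdag : IsDAG N) {u v : W} (h : N.Adj u v) : ¬ IsAncestor N v u :=
  fun h' => hdag u (Relation.TransGen.head' h h')

/-- `u` and `v` are not comparable in the ancestor order. -/
def Incomp (N : Digraph W) (u v : W) : Prop := ¬ IsAncestor N u v ∧ ¬ IsAncestor N v u

theorem Incomp.symm {u v : W} (h : Incomp N u v) : Incomp N v u := ⟨h.2, h.1⟩

theorem exists_linked (hdag : IsDAG N) {a b : W} (h : IsAncestor N a b) :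
    ∃ P, Linked N a b P ∧ (∀ v ∈ P, IsAncestor N a v ∧ IsAncestor N v b) ∧
      (a ≠ b → ∃ p ∈ P, N.Adj p b) := by
  induction h with
  | refl =>
    refine ⟨{a}, Linked.refl a, ?_, fun h => absurd rfl h⟩
    rintro v rfl
    exact ⟨Relation.ReflTransGen.refl, Relation.ReflTransGen.refl⟩
  | @tail c b hac hcb ih =>
    obtain ⟨P, hP, hbet, -⟩ := ih
    refine ⟨P ∪ {c, b}, hP.trans (Linked.edge hcb) ?_, ?_, fun _ => ⟨c, by simp, hcb⟩⟩
    · rintro v hv (rfl | rfl)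
      · rfl
      · exact absurd (hbet v hv).2 (not_ancestor_of_adj hdag hcb)
    · rintro v (hv | rfl | rfl)
      · exact ⟨(hbet v hv).1, (hbet v hv).2.tail hcb⟩
      · exact ⟨hac, Relation.ReflTransGen.single hcb⟩
      · exact ⟨Relation.ReflTransGen.tail hac hcb, Relation.ReflTransGen.refl⟩

/-- `h` is a maximal common descendant of `a` and `b`. -/
structure IsMaxDesc (N : Digraph W) (a b h : W) : Prop where
  left : IsAncestor N a h
  right : IsAncestor N b h
  max : ∀ h', IsAncestor N a h' → IsAncestor N b h' → IsAncestor N h' h → h' = h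

theorem IsMaxDesc.symm {a b h : W} (hh : IsMaxDesc N a b h) : IsMaxDesc N b a h :=
  ⟨hh.right, hh.left, fun h' h1 h2 => hh.max h' h2 h1⟩

variable [Finite W]

theorem wellFounded_adj (hdag : IsDAG N) : WellFounded (Relation.TransGen N.Adj) := by
  have : Std.Irrefl (Relation.TransGen N.Adj) := ⟨hdag⟩
  exact Finite.wellFounded_of_trans_of_irrefl _

theorem wellFounded_adj_swap (hdag : IsDAG N) :
    WellFounded (Function.swap (Relation.TransGen N.Adj)) := by
  have : Std.Irrefl (Function.swap (Relation.TransGen N.Adj)) := ⟨hdag⟩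
  have : IsTrans W (Function.swap (Relation.TransGen N.Adj)) := ⟨fun _ _ _ h h' => h'.trans h⟩
  exact Finite.wellFounded_of_trans_of_irrefl _

theorem exists_isMaxDesc (hdag : IsDAG N) {a b z : W} (ha : IsAncestor N a z)
    (hb : IsAncestor N b z) : ∃ h, IsMaxDesc N a b h ∧ IsAncestor N h z := by
  obtain ⟨h, ⟨h1, h2, h3⟩, hmin⟩ := (wellFounded_adj hdag).has_min
    {h | IsAncestor N a h ∧ IsAncestor N b h ∧ IsAncestor N h z}
    ⟨z, ha, hb, Relation.ReflTransGen.refl⟩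
  refine ⟨h, ⟨h1, h2, fun h' h1' h2' h' => ?_⟩, h3⟩
  rcases Relation.reflTransGen_iff_eq_or_transGen.1 h' with e | h''
  · exact e.symm
  · exact absurd h'' (hmin _ ⟨h1', h2', h'.trans h3⟩)

theorem exists_isLCA_below (hdag : IsDAG N) {A : Set W} {c : W}
    (hc : ∀ a ∈ A, IsAncestor N c a) : ∃ w, IsLCA N A w ∧ IsAncestor N c w := by
  obtain ⟨w, ⟨h1, h2⟩, hmin⟩ := (wellFounded_adj_swap hdag).has_min
    {w | (∀ a ∈ A, IsAncestor N w a) ∧ IsAncestor N c w} ⟨c, hc, Relation.ReflTransGen.refl⟩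
  refine ⟨w, ⟨h1, fun w' hw' hww' => ?_⟩, h2⟩
  rcases Relation.reflTransGen_iff_eq_or_transGen.1 hww' with e | h
  · exact e
  · exact absurd h (hmin w' ⟨hw', h2.trans hww'⟩)

end AncestorOrder

/-! ### Consequences of (N4): unique least common ancestors and restricted overlaps. -/

section GalledTree

variable {W : Type*} [Finite W] {N : Digraph W} {L : Set W}

theorem exists_root (hdag : IsDAG N) (hN : IsProperGalledTree N L) :
    ∃ ρ, ∀ v, IsAncestor N ρ v := by
  obtain ⟨ρ, -, -, hρ⟩ := hN.root
  refine ⟨ρ, fun v => ?_⟩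
  induction v using (wellFounded_adj hdag).induction with
  | _ v ih =>
    by_cases h : indeg N v = 0
    · rw [hρ v h]; exact Relation.ReflTransGen.refl
    · obtain ⟨u, hu⟩ := Set.nonempty_of_ncard_ne_zero h
      exact Relation.ReflTransGen.tail (ih u (Relation.TransGen.single hu)) hu

theorem isHybrid_of_parents (hN : IsProperGalledTree N L) {p q h : W} (hpq : p ≠ q)
    (hp : N.Adj p h) (hq : N.Adj q h) :
    IsHybrid N h ∧ ∀ u, N.Adj u h → u = p ∨ u = q := by
  have hne1 : indeg N h ≠ 1 := fun e => hpq (eq_of_indeg_eq_one e hp hq)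
  have hne0 : indeg N h ≠ 0 := fun e => not_adj_of_indeg_eq_zero e p hp
  have hhyb : IsHybrid N h := (hN.inner h (fun hL => hne1 ((hN.leaves h).1 hL).2) hne0).resolve_left
    fun ht => hne1 ht.1
  refine ⟨hhyb, fun u hu => ?_⟩
  by_contra! hcon
  have hsub : ({u, p, q} : Set W) ⊆ {x | N.Adj x h} := by
    rintro x (rfl | rfl | rfl) <;> assumption
  have h3 := Set.ncard_le_ncard hsub (Set.toFinite _)
  have hcard : ({u, p, q} : Set W).ncard = 3 :=
    Set.ncard_eq_three.2 ⟨u, p, q, hcon.1, hcon.2, hpq, rfl⟩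
  have : indeg N h = 2 := hhyb.1
  rw [indeg] at this
  omega

/-- The form in which (N4) is applied: extend S to a biconnected component. Two distinct parents
already are all parents, because the indegree is at most 2. -/
theorem eq_of_mem_biconnected (hN : IsProperGalledTree N L) {S : Set W}
    (hS : IsBiconnected N S) {h h' p q p' q' : W} (hh : h ∈ S) (hh' : h' ∈ S) (hpq : p ≠ q)
    (hpS : p ∈ S) (hqS : q ∈ S) (hp : N.Adj p h) (hq : N.Adj q h) (hpq' : p' ≠ q')
    (hpS' : p' ∈ S) (hqS' : q' ∈ S) (hp' : N.Adj p' h') (hq' : N.Adj q' h') : h = h' := by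
  obtain ⟨T, hST, hT⟩ := (Set.toFinite {S | IsBiconnected N S}).exists_le_maximal hS
  obtain ⟨h1, h2⟩ := isHybrid_of_parents hN hpq hp hq
  obtain ⟨h1', h2'⟩ := isHybrid_of_parents hN hpq' hp' hq'
  refine hN.level_one T hT h (hST hh) h' (hST hh') h1 h1' (fun u hu => ?_) (fun u hu => ?_)
  · rcases h2 u hu with rfl | rfl
    · exact hST hpS
    · exact hST hqS
  · rcases h2' u hu with rfl | rfl
    · exact hST hpS'
    · exact hST hqS'

/-- Let h₁ and h₂ be maximal common descendants of w and w' above x and above y. The connections of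
w and w' through h₁ and through h₂ meet only in w and w', so they lie in one biconnected set, and
(N4) gives h₁ = h₂. This is a common ancestor of x and y strictly below w, a contradiction. -/
theorem isLCA_unique (hdag : IsDAG N) (hN : IsProperGalledTree N L) {x y w w' : W}
    (hw : IsLCA N {x, y} w) (hw' : IsLCA N {x, y} w') : w = w' := by
  by_contra hne
  have hinc : Incomp N w w' :=
    ⟨fun h => hne (hw.2 w' hw'.1 h).symm, fun h => hne (hw'.2 w hw.1 h)⟩
  have hcomm : ∀ v, IsAncestor N v x → IsAncestor N v y → ∀ a ∈ ({x, y} : Set W),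
      IsAncestor N v a := by
    rintro v hx hy a (rfl | rfl) <;> assumption
  have hlow : ∀ v, IsAncestor N v x → IsAncestor N v y → IsAncestor N w v → v = w :=
    fun v hx hy h => hw.2 v (hcomm v hx hy) h
  have hlow' : ∀ v, IsAncestor N v x → IsAncestor N v y → IsAncestor N w' v → v = w' :=
    fun v hx hy h => hw'.2 v (hcomm v hx hy) h
  obtain ⟨h₁, hm₁, hx⟩ := exists_isMaxDesc hdag (hw.1 x (by simp)) (hw'.1 x (by simp))
  obtain ⟨h₂, hm₂, hy⟩ := exists_isMaxDesc hdag (hw.1 y (by simp)) (hw'.1 y (by simp))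
  have hwh : ∀ {h}, IsMaxDesc N w w' h → w ≠ h := fun hm e => hinc.2 (e ▸ hm.right)
  have hwh' : ∀ {h}, IsMaxDesc N w w' h → w' ≠ h := fun hm e => hinc.1 (e ▸ hm.left)
  obtain ⟨P₁, hP₁, hb₁, hp₁⟩ := exists_linked hdag hm₁.left
  obtain ⟨P₁', hP₁', hb₁', hp₁'⟩ := exists_linked hdag hm₁.right
  obtain ⟨P₂, hP₂, hb₂, hp₂⟩ := exists_linked hdag hm₂.left
  obtain ⟨P₂', hP₂', hb₂', hp₂'⟩ := exists_linked hdag hm₂.right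
  obtain ⟨p₁, hp₁, ha₁⟩ := hp₁ (hwh hm₁)
  obtain ⟨p₁', hp₁', ha₁'⟩ := hp₁' (hwh' hm₁)
  obtain ⟨p₂, hp₂, ha₂⟩ := hp₂ (hwh hm₂)
  obtain ⟨p₂', hp₂', ha₂'⟩ := hp₂' (hwh' hm₂)
  -- A common parent would be a higher common descendant of w and w'.
  have hpar : ∀ {h p p'}, IsMaxDesc N w w' h → N.Adj p h → IsAncestor N w p →
      IsAncestor N w' p' → p ≠ p' := by
    rintro h p p' hm ha hwp hwp' rfl
    have := hm.max p hwp hwp' (Relation.ReflTransGen.single ha)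
    exact hdag h (Relation.TransGen.single (this ▸ ha))
  have hL₁ := hP₁.trans hP₁'.symm
    (fun v hv hv' => hm₁.max v (hb₁ v hv).1 (hb₁' v hv').1 (hb₁ v hv).2)
  have hL₂ := hP₂.trans hP₂'.symm
    (fun v hv hv' => hm₂.max v (hb₂ v hv).1 (hb₂' v hv').1 (hb₂ v hv).2)
  have hbi := isBiconnected_of_linked hL₁ hL₂ (by
    rintro v (hv | hv) (hv' | hv')
    · exact Or.inl (hlow v ((hb₁ v hv).2.trans hx) ((hb₂ v hv').2.trans hy) (hb₁ v hv).1)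
    · have := hlow v ((hb₁ v hv).2.trans hx) ((hb₂' v hv').2.trans hy) (hb₁ v hv).1
      exact Or.inl this
    · have := hlow v ((hb₁' v hv).2.trans hx) ((hb₂ v hv').2.trans hy) (hb₂ v hv').1
      exact Or.inl this
    · exact Or.inr (hlow' v ((hb₁' v hv).2.trans hx) ((hb₂' v hv').2.trans hy) (hb₁' v hv).1))
  have heq : h₁ = h₂ := eq_of_mem_biconnected hN hbi (Or.inl (Or.inl hP₁.right_mem))
    (Or.inr (Or.inl hP₂.right_mem)) (hpar hm₁ ha₁ (hb₁ _ hp₁).1 (hb₁' _ hp₁').1)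
    (Or.inl (Or.inl hp₁)) (Or.inl (Or.inr hp₁')) ha₁ ha₁'
    (hpar hm₂ ha₂ (hb₂ _ hp₂).1 (hb₂' _ hp₂').1)
    (Or.inr (Or.inl hp₂)) (Or.inr (Or.inr hp₂')) ha₂ ha₂'
  exact hwh hm₁ (hlow h₁ hx (heq ▸ hy) hm₁.left).symm

/-- The set is the union of paths from a least common ancestor of a and b through a and through b
down to h. The parent s of a is recorded so that two such sets with a in common can be glued. -/
theorem exists_biconnected_of_incomp (hdag : IsDAG N) (hN : IsProperGalledTree N L) {a b h : W}
    (hab : Incomp N a b) (hh : IsMaxDesc N a b h) :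
    ∃ S p q s, IsBiconnected N S ∧ a ∈ S ∧ h ∈ S ∧ p ∈ S ∧ q ∈ S ∧ s ∈ S ∧
      N.Adj p h ∧ N.Adj q h ∧ N.Adj s a ∧ p ≠ q ∧
      IsAncestor N a p ∧ ¬ IsAncestor N b p ∧ IsAncestor N b q ∧ ¬ IsAncestor N a q := by
  obtain ⟨ρ, hρ⟩ := exists_root hdag hN
  obtain ⟨r, hr, -⟩ := exists_isLCA_below hdag (A := {a, b}) (c := ρ) (fun v _ => hρ v)
  have hra := hr.1 a (by simp)
  have hrb := hr.1 b (by simp)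
  have hcomm : ∀ v, IsAncestor N v a → IsAncestor N v b → IsAncestor N r v → v = r := by
    intro v ha hb h
    refine hr.2 v ?_ h
    rintro c (rfl | rfl) <;> assumption
  have hne_ra : r ≠ a := fun e => hab.1 (e ▸ hrb)
  have hah : a ≠ h := fun e => hab.2 (e ▸ hh.right)
  have hbh : b ≠ h := fun e => hab.1 (e ▸ hh.left)
  obtain ⟨P₁, hP₁, hb₁, hs⟩ := exists_linked hdag hra
  obtain ⟨P₂, hP₂, hb₂, hp⟩ := exists_linked hdag hh.left
  obtain ⟨P₃, hP₃, hb₃, -⟩ := exists_linked hdag hrb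
  obtain ⟨P₄, hP₄, hb₄, hq⟩ := exists_linked hdag hh.right
  obtain ⟨s, hsP, hs⟩ := hs hne_ra
  obtain ⟨p, hpP, hp⟩ := hp hah
  obtain ⟨q, hqP, hq⟩ := hq hbh
  have hnp : ¬ IsAncestor N b p := fun hbp => by
    have := hh.max p (hb₂ p hpP).1 hbp (Relation.ReflTransGen.single hp)
    exact hdag h (Relation.TransGen.single (this ▸ hp))
  have hnq : ¬ IsAncestor N a q := fun haq => by
    have := hh.max q haq (hb₄ q hqP).1 (Relation.ReflTransGen.single hq)
    exact hdag h (Relation.TransGen.single (this ▸ hq))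
  have hL₁ := hP₁.trans hP₂ fun v hv hv' => ancestor_antisymm hdag (hb₁ v hv).2 (hb₂ v hv').1
  have hL₂ := hP₃.trans hP₄ fun v hv hv' => ancestor_antisymm hdag (hb₃ v hv).2 (hb₄ v hv').1
  have hbi := isBiconnected_of_linked hL₁ hL₂ (by
    rintro v (hv | hv) (hv' | hv')
    · exact Or.inl (hcomm v (hb₁ v hv).2 (hb₃ v hv').2 (hb₁ v hv).1)
    · exact (hab.2 ((hb₄ v hv').1.trans (hb₁ v hv).2)).elim
    · exact (hab.1 ((hb₂ v hv).1.trans (hb₃ v hv').2)).elim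
    · exact Or.inr (hh.max v (hb₂ v hv).1 (hb₄ v hv').1 (hb₂ v hv).2))
  exact ⟨_, p, q, s, hbi, Or.inl (Or.inl hP₁.right_mem), Or.inl (Or.inr hP₂.right_mem),
    Or.inl (Or.inr hpP), Or.inr (Or.inr hqP), Or.inl (Or.inl hsP), hp, hq, hs,
    fun e => hnp (e ▸ (hb₄ q hqP).1), (hb₂ p hpP).1, hnp, (hb₄ q hqP).1, hnq⟩

theorem exists_biconnected_of_parents (hdag : IsDAG N) (hN : IsProperGalledTree N L) {h p q : W}
    (hpq : p ≠ q) (hp : N.Adj p h) (hq : N.Adj q h) :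
    ∃ S, IsBiconnected N S ∧ h ∈ S ∧ p ∈ S ∧ q ∈ S := by
  have hpath : ∀ {a s P}, N.Adj s h → Linked N a s P →
      (∀ v ∈ P, IsAncestor N a v ∧ IsAncestor N v s) → Linked N a h (P ∪ {s, h}) := by
    intro a s P hs hP hb
    refine hP.trans (Linked.edge hs) ?_
    rintro v hv (rfl | rfl)
    · rfl
    · exact absurd (hb v hv).2 (not_ancestor_of_adj hdag hs)
  have hcomp : ∀ {p q}, p ≠ q → N.Adj p h → N.Adj q h → IsAncestor N p q →
      ∃ S, IsBiconnected N S ∧ h ∈ S ∧ p ∈ S ∧ q ∈ S := by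
    intro p q hpq hp hq hanc
    obtain ⟨P, hP, hb, -⟩ := exists_linked hdag hanc
    exact ⟨_, isBiconnected_of_linked (hpath hq hP hb) (Linked.edge hp)
      (fun v _ hv => hv), by simp, by simp, by simp⟩
  by_cases h1 : IsAncestor N p q
  · exact hcomp hpq hp hq h1
  by_cases h2 : IsAncestor N q p
  · obtain ⟨S, hS, h3, h4, h5⟩ := hcomp hpq.symm hq hp h2
    exact ⟨S, hS, h3, h5, h4⟩
  obtain ⟨ρ, hρ⟩ := exists_root hdag hN
  obtain ⟨r, hr, -⟩ := exists_isLCA_below hdag (A := {p, q}) (c := ρ) (fun v _ => hρ v)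
  have hrp := hr.1 p (by simp)
  have hrq := hr.1 q (by simp)
  obtain ⟨P, hP, hb, -⟩ := exists_linked hdag hrp
  obtain ⟨Q, hQ, hb', -⟩ := exists_linked hdag hrq
  refine ⟨_, isBiconnected_of_linked (hpath hp hP hb) (hpath hq hQ hb') ?_, by simp, by simp,
    by simp⟩
  rintro v (hv | rfl | rfl) (hv' | hv' | hv')
  · refine Or.inl (hr.2 v ?_ (hb v hv).1)
    rintro c (rfl | rfl)
    · exact (hb v hv).2
    · exact (hb' v hv').2
  · exact absurd (hv' ▸ (hb v hv).2) h2
  · exact Or.inr hv'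
  · exact absurd (hb' _ hv').2 h1
  · exact absurd hv' hpq
  · exact Or.inr hv'
  · exact Or.inr rfl
  · exact Or.inr rfl
  · exact Or.inr rfl

/-- Both cycles pass through a. If they enter it by the same parent, they share two vertices, and
their union contains h and h', so (N4) applies. -/
theorem maxDesc_unique (hdag : IsDAG N) (hN : IsProperGalledTree N L) {a b c h h' : W}
    (hab : Incomp N a b) (hac : Incomp N a c) (hh : IsMaxDesc N a b h)
    (hh' : IsMaxDesc N a c h') : h = h' := by
  obtain ⟨S, p, q, s, hS, haS, hhS, hpS, hqS, hsS, hp, hq, hs, hpq, -⟩ :=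
    exists_biconnected_of_incomp hdag hN hab hh
  obtain ⟨S', p', q', s', hS', haS', hhS', hpS', hqS', hsS', hp', hq', hs', hpq', -⟩ :=
    exists_biconnected_of_incomp hdag hN hac hh'
  have hsa : s ≠ a := fun e => hdag a (Relation.TransGen.single (e ▸ hs))
  by_cases hss : s = s'
  · have hU := isBiconnected_union hS hS' hsa hsS (hss ▸ hsS') haS haS'
    exact eq_of_mem_biconnected hN hU (Or.inl hhS) (Or.inr hhS') hpq (Or.inl hpS) (Or.inl hqS) hp hq
      hpq' (Or.inr hpS') (Or.inr hqS') hp' hq'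
  -- Otherwise a is itself a hybrid-vertex. A biconnected set through a and both its parents can be
  -- glued to S, and (N4) gives a = h, which would put b above a.
  · obtain ⟨T, hT, haT, hsT, hsT'⟩ := exists_biconnected_of_parents hdag hN hss hs hs'
    have hU := isBiconnected_union hS hT hsa hsS hsT haS haT
    have : a = h := eq_of_mem_biconnected hN hU (Or.inl haS) (Or.inl hhS) hss (Or.inl hsS)
      (Or.inr hsT') hs hs' hpq (Or.inl hpS) (Or.inl hqS) hp hq
    exact absurd (this ▸ hh.right) hab.2

theorem ancestor_of_overlap (hdag : IsDAG N) (hN : IsProperGalledTree N L) {a b c z z' : W}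
    (hab : Incomp N a b) (hac : Incomp N a c) (haz : IsAncestor N a z) (hbz : IsAncestor N b z)
    (haz' : IsAncestor N a z') (hcz' : IsAncestor N c z') : IsAncestor N c z := by
  obtain ⟨h, hm, hz⟩ := exists_isMaxDesc hdag haz hbz
  obtain ⟨h', hm', -⟩ := exists_isMaxDesc hdag haz' hcz'
  rw [maxDesc_unique hdag hN hab hac hm hm'] at hz
  exact hm'.right.trans hz

/-- All three pairs have the same maximal common descendant h, which has only two parents p and q,
with p below a but not b, and q below b but not a. The pair a, c puts q below c, so no parent is
left that is below b but not c. -/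
theorem not_three_overlap (hdag : IsDAG N) (hN : IsProperGalledTree N L) {a b c z z' z'' : W}
    (hab : Incomp N a b) (hac : Incomp N a c) (hbc : Incomp N b c) (haz : IsAncestor N a z)
    (hbz : IsAncestor N b z) (haz' : IsAncestor N a z') (hcz' : IsAncestor N c z')
    (hbz'' : IsAncestor N b z'') (hcz'' : IsAncestor N c z'') : False := by
  obtain ⟨h, hm, -⟩ := exists_isMaxDesc hdag haz hbz
  obtain ⟨h', hm', -⟩ := exists_isMaxDesc hdag haz' hcz'
  obtain ⟨h'', hm'', -⟩ := exists_isMaxDesc hdag hbz'' hcz''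
  obtain rfl := maxDesc_unique hdag hN hab hac hm hm'
  obtain rfl := maxDesc_unique hdag hN hab.symm hbc hm.symm hm''
  obtain ⟨-, p, q, -, -, -, -, -, -, -, hp, hq, -, hpq, hap, hbp, hbq, haq⟩ :=
    exists_biconnected_of_incomp hdag hN hab hm
  obtain ⟨-, p', q', -, -, -, -, -, -, -, hp', hq', -, -, hap', hcp', hcq', haq'⟩ :=
    exists_biconnected_of_incomp hdag hN hac hm'
  obtain ⟨-, p'', -, -, -, -, -, -, -, -, hp'', -, -, -, hbp'', hcp'', -, -⟩ :=
    exists_biconnected_of_incomp hdag hN hbc hm''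
  have h2 := (isHybrid_of_parents hN hpq hp hq).2
  have hcq : IsAncestor N c q := by
    rcases h2 q' hq' with rfl | rfl
    · exact absurd hap haq'
    · exact hcq'
  rcases h2 p'' hp'' with rfl | rfl
  · exact hbp hbp''
  · exact hcp'' hcq

end GalledTree

end GaTEx

namespace GaTEx

open Set
open scoped List

/-! ### Prime graphs explained by an order with few overlaps -/

/-- The properties of the ancestor order of a galled-tree that are used below: overlapping
elements have the same common lower bounds, and no three elements overlap pairwise. -/
structure IsGalledOrder (L : Type*) [SemilatticeSup L] : Prop where
  overlap : ∀ {a b c z z' : L}, IncompRel (· ≤ ·) a b → IncompRel (· ≤ ·) a c →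
    z ≤ a → z ≤ b → z' ≤ a → z' ≤ c → z ≤ c
  not_three : ∀ {a b c z z' z'' : L}, IncompRel (· ≤ ·) a b → IncompRel (· ≤ ·) a c →
    IncompRel (· ≤ ·) b c → z ≤ a → z ≤ b → z' ≤ a → z' ≤ c → z'' ≤ b → z'' ≤ c → False

/-! ### Suprema along one of two overlapping elements. -/

namespace IsGalledOrder

variable {L : Type*} [SemilatticeSup L] {a b x y z z₀ : L}

/-- Both a and x ⊔ z overlap b, so the common lower bound z₀ of a and b also lies below x ⊔ z.
Consequently x ⊔ z does not depend on the common lower bound z. -/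
theorem sup_common_le (hL : IsGalledOrder L) (hab : IncompRel (· ≤ ·) a b) (hz₀a : z₀ ≤ a) (hz₀b : z₀ ≤ b)
    (hza : z ≤ a) (hzb : z ≤ b) (hxa : x ≤ a) (hxb : ¬ x ≤ b) : z₀ ≤ x ⊔ z := by
  refine hL.overlap (a := b) (b := a) (z' := z) ⟨hab.2, hab.1⟩ ⟨fun h => ?_, fun h => ?_⟩
    hz₀b hz₀a hzb le_sup_right
  · exact hab.2 (h.trans (sup_le hxa hza))
  · exact hxb (le_sup_left.trans h)

theorem sup_common_eq (hL : IsGalledOrder L) (hab : IncompRel (· ≤ ·) a b) (hz₀a : z₀ ≤ a) (hz₀b : z₀ ≤ b)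
    (hza : z ≤ a) (hzb : z ≤ b) (hxa : x ≤ a) (hxb : ¬ x ≤ b) : x ⊔ z = x ⊔ z₀ :=
  le_antisymm (sup_le le_sup_left (hL.sup_common_le hab hza hzb hz₀a hz₀b hxa hxb))
    (sup_le le_sup_left (hL.sup_common_le hab hz₀a hz₀b hza hzb hxa hxb))

theorem incomp_sup (hab : IncompRel (· ≤ ·) a b) (hz₀a : z₀ ≤ a) (hxa : x ≤ a) (hxb : ¬ x ≤ b) :
    IncompRel (· ≤ ·) (x ⊔ z₀) b :=
  ⟨fun h => hxb (le_sup_left.trans h), fun h => hab.2 (h.trans (sup_le hxa hz₀a))⟩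

/-- Otherwise x ⊔ z₀, y ⊔ z₀ and b would overlap pairwise in z₀. -/
theorem sup_comparable (hL : IsGalledOrder L) (hab : IncompRel (· ≤ ·) a b) (hz₀a : z₀ ≤ a) (hz₀b : z₀ ≤ b)
    (hxa : x ≤ a) (hxb : ¬ x ≤ b) (hya : y ≤ a) (hyb : ¬ y ≤ b) :
    x ⊔ z₀ ≤ y ⊔ z₀ ∨ y ⊔ z₀ ≤ x ⊔ z₀ := by
  by_contra! h
  exact hL.not_three (a := x ⊔ z₀) (b := y ⊔ z₀) (c := b) (z := z₀) (z' := z₀) (z'' := z₀) h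
    (incomp_sup hab hz₀a hxa hxb) (incomp_sup hab hz₀a hya hyb) le_sup_right le_sup_right
    le_sup_right hz₀b le_sup_right hz₀b

/-- If z₀ were not below x ⊔ y, then y ⊔ z₀ would overlap x ⊔ y in y and b in z₀, forcing y ≤ b. -/
theorem sup_eq_of_lt (hL : IsGalledOrder L) (hab : IncompRel (· ≤ ·) a b) (hz₀a : z₀ ≤ a) (hz₀b : z₀ ≤ b)
    (hya : y ≤ a) (hyb : ¬ y ≤ b) (hlt : y ⊔ z₀ < x ⊔ z₀) :
    x ⊔ y = x ⊔ z₀ := by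
  refine le_antisymm (sup_le le_sup_left (le_sup_left.trans hlt.le)) (sup_le le_sup_left ?_)
  by_contra hz
  refine hyb (hL.overlap (a := y ⊔ z₀) (b := x ⊔ y) (z' := z₀) ⟨fun h => ?_, fun h => ?_⟩
    (incomp_sup hab hz₀a hya hyb) le_sup_left le_sup_right le_sup_right hz₀b)
  · exact hz (le_sup_right.trans h)
  · exact hlt.not_ge (sup_le (le_sup_left.trans h) le_sup_right)

end IsGalledOrder

/-- The vertices of `H` other than `z` form two sequences `A` and `B`. The adjacency of two
vertices in `A ++ [z]` or in `B ++ [z]` depends on the earlier one, and all vertices in `A` are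
related in the same way to all vertices in `B`. -/
structure IsTwoCaterpillar {V : Type*} (H : SimpleGraph V) (z : V) (A B : List V) (s : V → Prop)
    (r : Prop) : Prop where
  nodup : (z :: (A ++ B)).Nodup
  cover : ∀ v, v ∈ z :: (A ++ B)
  left_ne_nil : A ≠ []
  right_ne_nil : B ≠ []
  left : (A ++ [z]).Pairwise fun x y => (H.Adj x y ↔ s x)
  right : (B ++ [z]).Pairwise fun x y => (H.Adj x y ↔ s x)
  cross : ∀ x ∈ A, ∀ y ∈ B, (H.Adj x y ↔ r)

theorem exists_sorted_list {V L : Type*} [PartialOrder L] (u : V → L) (n : ℕ) :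
    ∀ s : Finset V, s.card = n → (∀ x ∈ s, ∀ y ∈ s, u x ≤ u y ∨ u y ≤ u x) →
      (∀ x ∈ s, ∀ y ∈ s, u x = u y → x = y) →
      ∃ l : List V, (∀ v, v ∈ l ↔ v ∈ s) ∧ l.Pairwise fun x y => u y < u x := by
  classical
  induction n with
  | zero =>
    intro s hs _ _
    exact ⟨[], by simp [Finset.card_eq_zero.1 hs], List.Pairwise.nil⟩
  | succ n ih =>
    intro s hs htot hinj
    have hne : s.Nonempty := by rw [← Finset.card_pos]; omega
    obtain ⟨x, hx, hmax⟩ : ∃ x ∈ s, ∀ y ∈ s, u y ≤ u x := by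
      obtain ⟨m, hm⟩ := (s.image u).exists_maximal (hne.image u)
      obtain ⟨x, hx, rfl⟩ := Finset.mem_image.1 hm.1
      refine ⟨x, hx, fun y hy => (htot y hy x hx).elim id fun h => ?_⟩
      exact hm.2 (Finset.mem_image_of_mem u hy) h
    obtain ⟨l, hl, hp⟩ := ih (s.erase x) (by rw [Finset.card_erase_of_mem hx, hs]; rfl)
      (fun y hy z hz => htot y (Finset.mem_of_mem_erase hy) z (Finset.mem_of_mem_erase hz))
      (fun y hy z hz => hinj y (Finset.mem_of_mem_erase hy) z (Finset.mem_of_mem_erase hz))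
    refine ⟨x :: l, fun v => ?_, List.pairwise_cons.2 ⟨fun y hy => ?_, hp⟩⟩
    · rw [List.mem_cons, hl, Finset.mem_erase]
      constructor
      · rintro (rfl | h)
        · exact hx
        · exact h.2
      · exact fun h => (em (v = x)).imp_right fun h' => ⟨h', h⟩
    · have hy' := Finset.mem_erase.1 ((hl y).1 hy)
      exact lt_of_le_of_ne (hmax y hy'.2) fun e => hy'.1 (hinj y hy'.2 x hx e)

/-! ### Prime graphs on a galled order are two caterpillars. -/

section Prime

variable {V L : Type*} [Finite V] [Nontrivial V] [SemilatticeSup L]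

/-- The maximal suprema of pairs below the overall supremum w play the role of the two sides. Two of
them, a and b, overlap and cover everything; z₀ is the only vertex below both. The remaining
vertices below a, ordered by their supremum with z₀, form one side, and those below b the other. -/
theorem exists_isTwoCaterpillar (hL : IsGalledOrder L) (H : SimpleGraph V)
    (hmod : ∀ U : Set V, IsModuleOn H univ U → U.Subsingleton ∨ U = univ)
    (hcross : ∀ T : Set V, T.Nonempty → T ≠ univ →
      (∃ x ∈ T, ∃ y ∉ T, H.Adj x y) ∧ ∃ x ∈ T, ∃ y ∉ T, ¬ H.Adj x y)
    (φ : V → L) (τ : L → Prop) (hadj : ∀ x y, x ≠ y → (H.Adj x y ↔ τ (φ x ⊔ φ y))) :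
    ∃ z A B s r, IsTwoCaterpillar H z A B s r := by
  classical
  have := Fintype.ofFinite V
  set w := Finset.univ.sup' Finset.univ_nonempty φ with hw
  have hle : ∀ x, φ x ≤ w := fun x => Finset.le_sup' φ (Finset.mem_univ x)
  have hlub : ∀ c, (∀ x, φ x ≤ c) → w ≤ c := fun c h => Finset.sup'_le _ _ fun x _ => h x
  have hlew : ∀ x y, φ x ⊔ φ y ≤ w := fun x y => sup_le (hle x) (hle y)
  -- If all suprema across a cut were w, adjacency across it would be constant, against `hcross`.
  have hcut : ∀ T : Set V, T.Nonempty → T ≠ univ → ∃ x ∈ T, ∃ y ∉ T, φ x ⊔ φ y < w := by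
    intro T hT hT'
    by_contra! hcon
    have heq : ∀ x ∈ T, ∀ y ∉ T, (H.Adj x y ↔ τ w) := by
      intro x hx y hy
      rw [hadj x y (fun e => hy (e ▸ hx)),
        (hlew x y).eq_of_not_lt (hcon x hx y hy)]
    obtain ⟨⟨x, hx, y, hy, h⟩, x', hx', y', hy', h'⟩ := hcross T hT hT'
    exact h' ((heq x' hx' y' hy').2 ((heq x hx y hy).1 h))
  let S : Set L := {m | (∃ x y, m = φ x ⊔ φ y) ∧ m < w}
  have hSfin : S.Finite := by
    refine (Set.finite_range fun p : V × V => φ p.1 ⊔ φ p.2).subset ?_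
    rintro m ⟨⟨x, y, rfl⟩, -⟩
    exact ⟨(x, y), rfl⟩
  have hmaxinc : ∀ {m m'}, Maximal (· ∈ S) m → Maximal (· ∈ S) m' → m ≠ m' →
      IncompRel (· ≤ ·) m m' := fun {m m'} hm hm' hne =>
    ⟨fun h => hne (le_antisymm h (hm.2 hm'.1 h)), fun h => hne (le_antisymm (hm'.2 hm.1 h) h)⟩
  have habove : ∀ {x y}, φ x ⊔ φ y < w → ∃ m, Maximal (· ∈ S) m ∧ φ x ≤ m ∧ φ y ≤ m := by
    intro x y hxy
    obtain ⟨m, hm, hmax⟩ := hSfin.exists_le_maximal (a := φ x ⊔ φ y) ⟨⟨x, y, rfl⟩, hxy⟩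
    exact ⟨m, hmax, le_sup_left.trans hm, le_sup_right.trans hm⟩
  obtain ⟨x₀⟩ := (inferInstance : Nonempty V)
  obtain ⟨x₁, -, y₁, -, h₁⟩ := hcut {x₀} (singleton_nonempty _) (by
    intro h
    obtain ⟨y, hy⟩ := exists_ne x₀
    exact hy (h.ge (mem_univ y)))
  obtain ⟨a, ha, hx₁a, -⟩ := habove h₁
  have hnot : ∀ {m}, Maximal (· ∈ S) m → ∃ x, ¬ φ x ≤ m := by
    intro m hm
    by_contra! h
    exact hm.1.2.not_ge (hlub m h)
  obtain ⟨xb, hxb⟩ := hnot ha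
  -- A pair across the cut around a lies below another maximal element b, so its end z₀ lies below
  -- both.
  obtain ⟨z₀, hz₀a, y₂, hy₂, h₂⟩ := hcut {x | φ x ≤ a} ⟨x₁, hx₁a⟩
    (fun h => hxb (h.ge (mem_univ xb)))
  obtain ⟨b, hb, hz₀b, hy₂b⟩ := habove h₂
  have hne : a ≠ b := fun e => hy₂ (by rw [e]; exact hy₂b)
  have hab := hmaxinc ha hb hne
  replace hz₀a : φ z₀ ≤ a := hz₀a
  -- Otherwise the cut around a and b produces a third maximal element c that meets one of them; by
  -- `overlap` z₀ is then below c, and a, b, c overlap pairwise.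
  have hcov : ∀ x, φ x ≤ a ∨ φ x ≤ b := by
    by_contra! hcon
    obtain ⟨v, hv⟩ := hcon
    obtain ⟨x, hx, y, hy, hxy⟩ := hcut {x | φ x ≤ a ∨ φ x ≤ b} ⟨z₀, Or.inl hz₀a⟩
      (fun h => (h.ge (mem_univ v) : φ v ≤ a ∨ φ v ≤ b).elim hv.1 hv.2)
    obtain ⟨c, hc, hxc, hyc⟩ := habove hxy
    have hac : a ≠ c := fun e => hy (Or.inl (by rw [e]; exact hyc))
    have hbc : b ≠ c := fun e => hy (Or.inr (by rw [e]; exact hyc))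
    rcases hx with hx | hx
    · have := hL.overlap hab (hmaxinc ha hc hac) hz₀a hz₀b hx hxc
      exact hL.not_three hab (hmaxinc ha hc hac) (hmaxinc hb hc hbc) hz₀a hz₀b hx hxc hz₀b this
    · have := hL.overlap ⟨hab.2, hab.1⟩ (hmaxinc hb hc hbc) hz₀b hz₀a hx hxc
      exact hL.not_three hab (hmaxinc ha hc hac) (hmaxinc hb hc hbc) hz₀a hz₀b hz₀a this hx hxc
  have hopp : ∀ x y, φ x ≤ a → ¬ φ x ≤ b → φ y ≤ b → ¬ φ y ≤ a → φ x ⊔ φ y = w := by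
    intro x y hxa hxb hyb hya
    refine (hlew x y).eq_of_not_lt fun hlt => ?_
    obtain ⟨c, hc, hxc, hyc⟩ := habove hlt
    have hac : a ≠ c := fun e => hya (by rw [e]; exact hyc)
    have hbc : b ≠ c := fun e => hxb (by rw [e]; exact hxc)
    exact hL.not_three hab (hmaxinc ha hc hac) (hmaxinc hb hc hbc) hz₀a hz₀b hxa hxc hyb hyc
  -- one side of the cycle
  have hside : ∀ {a b : L}, IncompRel (· ≤ ·) a b → φ z₀ ≤ a → φ z₀ ≤ b →
      (∀ x, φ x ≤ a ∨ φ x ≤ b) →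
      (∀ x y, φ x ≤ a → ¬ φ x ≤ b → φ y ≤ b → ¬ φ y ≤ a → φ x ⊔ φ y = w) →
      ∀ x y, φ x ≤ a → ¬ φ x ≤ b → φ y ≤ a → ¬ φ y ≤ b →
        φ x ⊔ φ z₀ = φ y ⊔ φ z₀ → x = y := by
    intro a b hab hz₀a hz₀b hcov hopp x y hxa hxb hya hyb hxy
    -- Vertices of one side with the same supremum with z₀ have the same suprema with all other
    -- vertices, so they form a module. It misses z₀ and is therefore a singleton, which makes the
    -- order along the side strict.
    have hE : IsModuleOn H univ {v | φ v ≤ a ∧ ¬ φ v ≤ b ∧ φ v ⊔ φ z₀ = φ x ⊔ φ z₀} := by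
      have key : ∀ v, φ v ≤ a → ¬ φ v ≤ b → φ v ⊔ φ z₀ = φ x ⊔ φ z₀ →
          ∀ q, ¬ (φ q ≤ a ∧ ¬ φ q ≤ b ∧ φ q ⊔ φ z₀ = φ x ⊔ φ z₀) →
            φ v ⊔ φ q = φ x ⊔ φ q := by
        intro v hva hvb hv q hq
        by_cases hqa : φ q ≤ a
        · by_cases hqb : φ q ≤ b
          · rw [hL.sup_common_eq hab hz₀a hz₀b hqa hqb hva hvb, hv,
              hL.sup_common_eq hab hz₀a hz₀b hqa hqb hxa hxb]
          · have hqx : φ q ⊔ φ z₀ ≠ φ x ⊔ φ z₀ := fun e => hq ⟨hqa, hqb, e⟩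
            rcases hL.sup_comparable hab hz₀a hz₀b hqa hqb hxa hxb with h | h
            · have hlt := lt_of_le_of_ne h hqx
              rw [hL.sup_eq_of_lt hab hz₀a hz₀b hqa hqb hlt,
                hL.sup_eq_of_lt hab hz₀a hz₀b hqa hqb (hv ▸ hlt), hv]
            · have hlt := lt_of_le_of_ne h hqx.symm
              rw [sup_comm (φ v), sup_comm (φ x),
                hL.sup_eq_of_lt hab hz₀a hz₀b hxa hxb hlt,
                hL.sup_eq_of_lt hab hz₀a hz₀b hva hvb (hv ▸ hlt)]
        · have hqb := (hcov q).resolve_left hqa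
          rw [hopp v q hva hvb hqb hqa, hopp x q hxa hxb hqb hqa]
      refine ⟨subset_univ _, ?_⟩
      rintro v ⟨hva, hvb, hv⟩ v' ⟨hva', hvb', hv'⟩ q - hq
      rw [hadj v q (fun e => hq (e ▸ ⟨hva, hvb, hv⟩)),
        hadj v' q (fun e => hq (e ▸ ⟨hva', hvb', hv'⟩)), key v hva hvb hv q hq,
        key v' hva' hvb' hv' q hq]
    rcases hmod _ hE with h | h
    · exact h ⟨hxa, hxb, rfl⟩ ⟨hya, hyb, hxy.symm⟩
    · exact absurd hz₀b (h.ge (mem_univ z₀)).2.1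
  have hba : IncompRel (· ≤ ·) b a := ⟨hab.2, hab.1⟩
  have hcov' : ∀ x, φ x ≤ b ∨ φ x ≤ a := fun x => (hcov x).symm
  have hopp' : ∀ x y, φ x ≤ b → ¬ φ x ≤ a → φ y ≤ a → ¬ φ y ≤ b → φ x ⊔ φ y = w :=
    fun x y h1 h2 h3 h4 => by rw [sup_comm]; exact hopp y x h3 h4 h1 h2
  have hZ : ∀ z, φ z ≤ a → φ z ≤ b → z = z₀ := by
    have hmodZ : IsModuleOn H univ {z | φ z ≤ a ∧ φ z ≤ b} := by
      have key : ∀ z, φ z ≤ a → φ z ≤ b → ∀ q, ¬ (φ q ≤ a ∧ φ q ≤ b) →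
          φ z ⊔ φ q = φ z₀ ⊔ φ q := by
        intro z hza hzb q hq
        rw [sup_comm, sup_comm (φ z₀)]
        by_cases hqa : φ q ≤ a
        · exact hL.sup_common_eq hab hz₀a hz₀b hza hzb hqa fun h => hq ⟨hqa, h⟩
        · exact hL.sup_common_eq hba hz₀b hz₀a hzb hza ((hcov q).resolve_left hqa) hqa
      refine ⟨subset_univ _, ?_⟩
      rintro z ⟨hza, hzb⟩ z' ⟨hza', hzb'⟩ q - hq
      rw [hadj z q (fun e => hq (e ▸ ⟨hza, hzb⟩)), hadj z' q (fun e => hq (e ▸ ⟨hza', hzb'⟩)),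
        key z hza hzb q hq, key z' hza' hzb' q hq]
    intro z hza hzb
    rcases hmod _ hmodZ with h | h
    · exact h ⟨hza, hzb⟩ ⟨hz₀a, hz₀b⟩
    · exact absurd (h.ge (mem_univ y₂)).1 hy₂
  have hlist : ∀ {a b : L}, IncompRel (· ≤ ·) a b → φ z₀ ≤ a → φ z₀ ≤ b →
      (∀ x, φ x ≤ a ∨ φ x ≤ b) →
      (∀ x y, φ x ≤ a → ¬ φ x ≤ b → φ y ≤ b → ¬ φ y ≤ a → φ x ⊔ φ y = w) →
      ∃ l : List V, (∀ v, v ∈ l ↔ φ v ≤ a ∧ ¬ φ v ≤ b) ∧ l.Nodup ∧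
        (l ++ [z₀]).Pairwise fun x y => (H.Adj x y ↔ τ (φ x ⊔ φ z₀)) := by
    intro a b hab hz₀a hz₀b hcov hopp
    obtain ⟨l, hl, hp⟩ := exists_sorted_list (fun x => φ x ⊔ φ z₀) _
      (Finset.univ.filter fun v => φ v ≤ a ∧ ¬ φ v ≤ b) rfl
      (fun x hx y hy => by
        simp only [Finset.mem_filter, Finset.mem_univ, true_and] at hx hy
        exact hL.sup_comparable hab hz₀a hz₀b hx.1 hx.2 hy.1 hy.2)
      (fun x hx y hy => by
        simp only [Finset.mem_filter, Finset.mem_univ, true_and] at hx hy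
        exact hside hab hz₀a hz₀b hcov hopp x y hx.1 hx.2 hy.1 hy.2)
    have hl' : ∀ v, v ∈ l ↔ φ v ≤ a ∧ ¬ φ v ≤ b := fun v => by rw [hl]; simp
    refine ⟨l, hl', hp.imp (fun h e => by rw [e] at h; exact lt_irrefl _ h), ?_⟩
    rw [List.pairwise_append]
    refine ⟨hp.imp_of_mem fun {x y} _ hy hlt => ?_, List.pairwise_singleton _ _,
      fun x hx y hy => ?_⟩
    · rw [hadj x y (fun e => by rw [e] at hlt; exact lt_irrefl _ hlt),
        hL.sup_eq_of_lt hab hz₀a hz₀b ((hl' y).1 hy).1 ((hl' y).1 hy).2 hlt]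
    · rw [List.mem_singleton] at hy
      subst hy
      exact hadj x y fun e => ((hl' x).1 hx).2 (e ▸ hz₀b)
  obtain ⟨A, hA, hAnd, hAp⟩ := hlist hab hz₀a hz₀b hcov hopp
  obtain ⟨B, hB, hBnd, hBp⟩ := hlist hba hz₀b hz₀a hcov' hopp'
  -- The supremum of two vertices on a side is that of the upper one with z₀, and vertices on
  -- opposite sides have supremum w; this dictates the labels.
  refine ⟨z₀, A, B, fun x => τ (φ x ⊔ φ z₀), τ w, ?_, ?_, ?_, ?_, hAp, hBp, ?_⟩
  · rw [List.nodup_cons, List.mem_append, hA, hB]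
    refine ⟨?_, hAnd.append hBnd fun x hx hx' => ?_⟩
    · rintro (h | h)
      · exact h.2 hz₀b
      · exact h.2 hz₀a
    · exact ((hB x).1 hx').2 ((hA x).1 hx).1
  · intro v
    rw [List.mem_cons, List.mem_append, hA, hB]
    by_cases hva : φ v ≤ a
    · by_cases hvb : φ v ≤ b
      · exact Or.inl (hZ v hva hvb)
      · exact Or.inr (Or.inl ⟨hva, hvb⟩)
    · exact Or.inr (Or.inr ⟨(hcov v).resolve_left hva, hva⟩)
  · obtain ⟨x, hx⟩ := hnot hb
    exact List.ne_nil_of_mem ((hA x).2 ⟨(hcov x).resolve_right hx, hx⟩)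
  · obtain ⟨x, hx⟩ := hnot ha
    exact List.ne_nil_of_mem ((hB x).2 ⟨(hcov x).resolve_left hx, hx⟩)
  · intro x hx y hy
    have hx' := (hA x).1 hx
    have hy' := (hB y).1 hy
    rw [hadj x y (fun e => hy'.2 (e ▸ hx'.1)), hopp x y hx'.1 hx'.2 hy'.1 hy'.2]

end Prime

/-! ### Label alternation and side lengths from the absence of nontrivial modules. -/

namespace IsTwoCaterpillar

variable {V : Type*} {H : SimpleGraph V} {z : V} {A B : List V} {s : V → Prop} {r : Prop}

theorem swap (h : IsTwoCaterpillar H z A B s r) : IsTwoCaterpillar H z B A s r where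
  nodup := by
    have := h.nodup
    rwa [List.Perm.nodup_iff (List.Perm.cons z List.perm_append_comm)] at this
  cover v := by
    have := h.cover v
    rwa [List.Perm.mem_iff (List.Perm.cons z List.perm_append_comm)] at this
  left_ne_nil := h.right_ne_nil
  right_ne_nil := h.left_ne_nil
  left := h.right
  right := h.left
  cross x hx y hy := by rw [H.adj_comm]; exact h.cross y hy x hx

theorem notMem (h : IsTwoCaterpillar H z A B s r) : z ∉ A ∧ z ∉ B := by
  have := (List.nodup_cons.1 h.nodup).1
  rwa [List.mem_append, not_or] at this

/-- Labels alternate along each side if the graph has no nontrivial modules. -/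
theorem alternating (h : IsTwoCaterpillar H z A B s r)
    (hmod : ∀ U : Set V, IsModuleOn H univ U → U.Subsingleton ∨ U = univ) :
    (∀ x y, [x, y] <:+: A → ¬ (s x ↔ s y)) ∧ ∀ x, A.head? = some x → ¬ (s x ↔ r) := by
  have hzA := h.notMem.1
  have hzB := h.notMem.2
  have hAnd : A.Nodup := ((List.nodup_append.1 (List.nodup_cons.1 h.nodup).2)).1
  constructor
  · rintro x y ⟨l₁, l₂, rfl⟩ hxy
    have hnd := hAnd
    simp only [List.append_assoc, List.cons_append, List.nil_append] at hnd hzA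
    have hleft := h.left
    simp only [List.append_assoc, List.cons_append, List.nil_append] at hleft
    rw [List.pairwise_append] at hleft
    obtain ⟨-, h1, h2⟩ := hleft
    rw [List.pairwise_cons, List.pairwise_cons] at h1
    have hne : x ≠ y := by
      rintro rfl
      rw [List.nodup_append] at hnd
      simp at hnd
    -- Two consecutive vertices with equal labels are twins: earlier vertices treat them alike, and
    -- so do later ones and the other side.
    have hE : IsModuleOn H univ {x, y} := by
      have key : ∀ q, q ∉ ({x, y} : Set V) → (H.Adj x q ↔ H.Adj y q) := by
        intro q hq
        have hqx : q ≠ x := fun e => hq (Or.inl e)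
        have hqy : q ≠ y := fun e => hq (Or.inr e)
        have hq' := h.cover q
        simp only [List.append_assoc, List.cons_append, List.nil_append, List.mem_cons,
          List.mem_append, hqx, hqy, false_or] at hq'
        have hlater : q ∈ l₂ ++ [z] → (H.Adj x q ↔ H.Adj y q) := fun hq => by
          rw [h1.1 q (by simp only [List.mem_cons]; exact Or.inr hq), h1.2.1 q hq, hxy]
        rcases hq' with rfl | hq' | hq' | hq'
        · exact hlater (by simp)
        · rw [H.adj_comm x, H.adj_comm y, h2 q hq' x (by simp), h2 q hq' y (by simp)]
        · exact hlater (by simp [hq'])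
        · rw [h.cross x (by simp) q hq', h.cross y (by simp) q hq']
      refine ⟨subset_univ _, ?_⟩
      rintro a (rfl | rfl) b (rfl | rfl) q - hq
      · exact Iff.rfl
      · exact key q hq
      · exact (key q hq).symm
      · exact Iff.rfl
    rcases hmod _ hE with h' | h'
    · exact hne (h' (by simp) (by simp))
    · have : z ∈ ({x, y} : Set V) := h'.ge (mem_univ z)
      simp only [List.mem_append, List.mem_cons, not_or] at hzA
      rcases this with e | e
      · exact hzA.2.1 e
      · exact hzA.2.2.1 e
  · intro x hx hxr
    obtain ⟨l, rfl⟩ : ∃ l, A = x :: l := by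
      cases A with
      | nil => simp at hx
      | cons a l => simp only [List.head?_cons, Option.some.injEq] at hx; exact ⟨l, by rw [hx]⟩
    have hleft := h.left
    rw [List.cons_append, List.pairwise_cons] at hleft
    -- If the first vertex x has the same label as the root, it relates to every other vertex in the
    -- same way, so its complement is a module.
    have hE : IsModuleOn H univ {v | v ≠ x} := by
      have key : ∀ q, q ≠ x → (H.Adj q x ↔ r) := by
        intro q hqx
        rw [H.adj_comm]
        have hq' := h.cover q
        simp only [List.cons_append, List.mem_cons, List.mem_append, hqx, false_or] at hq'
        rcases hq' with rfl | hq' | hq'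
        · rw [hleft.1 q (by simp), hxr]
        · rw [hleft.1 q (by simp [hq']), hxr]
        · exact h.cross x (by simp) q hq'
      refine ⟨subset_univ _, fun a ha b hb q _ hq => ?_⟩
      have hqx : q = x := by_contra fun hne => hq hne
      subst hqx
      rw [key a ha, key b hb]
    rcases hmod _ hE with h' | h'
    · obtain ⟨b, hb⟩ := List.exists_mem_of_ne_nil _ h.right_ne_nil
      have hzb : z = b := h' (fun e => hzA (by simp [← e]))
        (fun e => by
          have hnd := (List.nodup_append.1 (List.nodup_cons.1 h.nodup).2).2.2
          exact hnd x (by simp) b hb e.symm)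
      exact hzB (hzb ▸ hb)
    · exact (h'.ge (mem_univ x)) rfl

/-- Both labels differ from that of the root, hence agree, and then {x, y} is a module of the
three-vertex graph. -/
theorem not_both_length_one (h : IsTwoCaterpillar H z A B s r)
    (hmod : ∀ U : Set V, IsModuleOn H univ U → U.Subsingleton ∨ U = univ) :
    ¬ (A.length = 1 ∧ B.length = 1) := by
  rintro ⟨h1, h2⟩
  obtain ⟨x, rfl⟩ := List.length_eq_one_iff.1 h1
  obtain ⟨y, rfl⟩ := List.length_eq_one_iff.1 h2
  have hx := (h.alternating hmod).2 x rfl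
  have hy := (h.swap.alternating hmod).2 y rfl
  have hsx := h.left
  have hsy := h.right
  simp only [List.cons_append, List.nil_append, List.pairwise_cons, List.mem_singleton,
    forall_eq] at hsx hsy
  have hxy : s x ↔ s y := by
    by_cases h1 : s x <;> by_cases h2 : s y <;> by_cases h3 : r <;> simp_all
  have hnd := h.nodup
  simp only [List.cons_append, List.nil_append, List.nodup_cons, List.mem_cons,
    List.not_mem_nil, or_false, not_or] at hnd
  have hE : IsModuleOn H univ {x, y} := by
    refine ⟨subset_univ _, ?_⟩
    have key : ∀ a ∈ ({x, y} : Set V), H.Adj a z ↔ s x := by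
      rintro a (rfl | rfl)
      · exact hsx.1
      · rw [hsy.1, hxy]
    intro a ha b hb q _ hq
    have hqz : q = z := by
      have := h.cover q
      simp only [List.cons_append, List.nil_append, List.mem_cons, List.not_mem_nil,
        or_false] at this
      exact this.resolve_right hq
    rw [hqz, key a ha, key b hb]
  rcases hmod _ hE with h' | h'
  · exact hnd.2.1 (h' (by simp) (by simp))
  · rcases (h'.ge (mem_univ z) : z ∈ ({x, y} : Set V)) with e | e
    · exact hnd.1.1 e
    · exact hnd.1.2 e

end IsTwoCaterpillar

end GaTEx

namespace GaTEx

open Set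
open scoped List

/-! ### The elementary galled-tree of two caterpillars -/

/-- Vertices of an elementary galled-tree: the root, the other vertices of the cycle, and the
leaves below them. -/
inductive CatVertex (V : Type*)
  | root
  | cyc (v : V)
  | leaf (v : V)

namespace CatVertex

variable {V : Type*}

theorem cyc_injective : Function.Injective (cyc : V → CatVertex V) := fun _ _ h => by
  cases h; rfl

theorem leaf_injective : Function.Injective (leaf : V → CatVertex V) := fun _ _ h => by
  cases h; rfl

instance [Finite V] : Finite (CatVertex V) := by
  refine Finite.of_injective (β := Option (V ⊕ V))
    (fun | root => none | cyc v => some (Sum.inl v) | leaf v => some (Sum.inr v)) ?_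
  rintro (_ | _ | _) (_ | _ | _) h <;> simp_all

/-- One side of the cycle, from the root to the hybrid-vertex. -/
def side (z : V) (A : List V) : List (CatVertex V) := root :: (A.map cyc ++ [cyc z])

end CatVertex

open CatVertex

section Cat

variable {V : Type*}

/-- The elementary galled-tree whose cycle has the sides `A` and `B` and the hybrid-vertex
`z`. -/
def catDigraph (z : V) (A B : List V) : Digraph (CatVertex V) where
  Adj a b := [a, b] <:+: side z A ∨ [a, b] <:+: side z B ∨ ∃ v, a = cyc v ∧ b = leaf v

open Classical in
/-- The labeling of the elementary galled-tree. -/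
noncomputable def catLabel (s : V → Prop) (r : Prop) : CatVertex V → VLabel
  | root => if r then VLabel.one else VLabel.zero
  | cyc v => if s v then VLabel.one else VLabel.zero
  | leaf _ => VLabel.leaf

theorem isChain_of_pair_infix {α : Type*} {R : α → α → Prop} {l : List α}
    (h : ∀ a b, [a, b] <:+: l → R a b) : l.IsChain R := by
  induction l with
  | nil => exact List.isChain_nil
  | cons a l ih =>
    cases l with
    | nil => exact List.isChain_singleton a
    | cons b l =>
      rw [List.isChain_cons_cons]
      exact ⟨h a b (show [a, b] <+: a :: b :: l from ⟨l, rfl⟩).isInfix,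
        ih fun x y hxy => h x y (List.infix_cons hxy)⟩

theorem side_pair {z : V} {A : List V} {a b : CatVertex V} (h : [a, b] <:+: side z A) :
    (a = root ∨ ∃ v ∈ A, a = cyc v) ∧ ∃ v ∈ A ++ [z], b = cyc v := by
  obtain ⟨h1, h2⟩ := pair_infix_cons_concat h
  constructor
  · rcases List.mem_cons.1 h1 with h | h
    · exact Or.inl h
    · obtain ⟨v, hv, rfl⟩ := List.mem_map.1 h
      exact Or.inr ⟨v, hv, rfl⟩
  · have : b ∈ (A ++ [z]).map cyc := by simpa using h2
    obtain ⟨v, hv, rfl⟩ := List.mem_map.1 this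
    exact ⟨v, hv, rfl⟩

/-- Separates the edge at the root from those inside the side; these are the two places where
quasi-discrimination has to be checked. -/
theorem side_pair_ne {z y : V} {A : List V} {a : CatVertex V} (h : [a, cyc y] <:+: side z A)
    (hy : y ≠ z) : (a = root ∧ A.head? = some y) ∨ ∃ x, a = cyc x ∧ [x, y] <:+: A := by
  rw [side, List.infix_cons_iff] at h
  rcases h with ⟨t, ht⟩ | h
  · simp only [List.cons_append, List.nil_append, List.cons.injEq] at ht
    refine Or.inl ⟨ht.1, ?_⟩
    cases A with
    | nil =>
      simp only [List.map_nil, List.nil_append, List.cons.injEq, cyc.injEq] at ht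
      exact absurd ht.2.1 hy
    | cons x A =>
      simp only [List.map_cons, List.cons_append, List.cons.injEq, cyc.injEq] at ht
      simp [ht.2.1]
  · right
    rw [List.infix_concat_iff] at h
    rcases h with ⟨t, ht⟩ | h
    · have := congrArg List.getLast? ht
      simp only [List.getLast?_append, List.getLast?_cons_cons,
        List.getLast?_singleton, Option.some_or, Option.some.injEq, cyc.injEq] at this
      exact absurd this hy
    · rw [List.infix_map_iff] at h
      obtain ⟨l, hl, he⟩ := h
      match l, he with
      | [x, y'], he =>
        simp only [List.map_cons, List.map_nil, List.cons.injEq, cyc.injEq, and_true] at he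
        obtain ⟨rfl, rfl⟩ := he
        exact ⟨x, rfl, hl⟩

variable {H : SimpleGraph V} {z : V} {A B : List V} {s : V → Prop} {r : Prop}

/-- The cycle of the elementary galled-tree. -/
def catCycle (h : IsTwoCaterpillar H z A B s r) : RootedCycle (catDigraph z A B) where
  root := root
  hybrid := cyc z
  inner₁ := A.map cyc
  inner₂ := B.map cyc
  path₁ := isChain_of_pair_infix fun _ _ h => Or.inl h
  path₂ := isChain_of_pair_infix fun _ _ h => Or.inr (Or.inl h)
  nodup := by
    have : ((z :: (A ++ B)).map cyc).Nodup := h.nodup.map cyc_injective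
    rw [List.nodup_cons]
    refine ⟨by simp, by simpa using this⟩
  nontrivial := Or.inl (by simpa using h.left_ne_nil)

theorem catCycle_mem_verts (h : IsTwoCaterpillar H z A B s r) (a : CatVertex V) :
    a ∈ (catCycle h).verts ↔ ∀ v, a ≠ leaf v := by
  rw [RootedCycle.mem_verts]
  cases a with
  | root => simp [catCycle]
  | leaf v => simp [catCycle]
  | cyc v =>
    have := h.cover v
    simpa [catCycle] using this

theorem exists_rank {α : Type*} {l : List α} (hl : l.Nodup) :
    ∃ f : α → ℕ, (∀ x ∈ l, f x < l.length) ∧ l.Pairwise fun x y => f x < f y := by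
  classical
  refine ⟨l.idxOf, fun x hx => List.idxOf_lt_length_of_mem hx, ?_⟩
  rw [List.pairwise_iff_getElem]
  intro i j hi hj hij
  simpa only [hl.idxOf_getElem] using hij

theorem catDigraph_isDAG (h : IsTwoCaterpillar H z A B s r) : IsDAG (catDigraph z A B) := by
  classical
  have hnd := h.nodup
  rw [List.nodup_cons, List.nodup_append] at hnd
  obtain ⟨hz, hAnd, hBnd, hdis⟩ := hnd
  obtain ⟨f, hf, hfp⟩ := exists_rank hAnd
  obtain ⟨g, hg, hgp⟩ := exists_rank hBnd
  -- A height that increases along all edges: positions on each side shifted by one to stay above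
  -- the root, the hybrid-vertex beyond both sides, the leaves last.
  let rank : CatVertex V → ℕ
    | root => 0
    | cyc v => if v ∈ A then f v + 1 else if v ∈ B then g v + 1 else A.length + B.length + 1
    | leaf _ => A.length + B.length + 2
  have hzA := h.notMem.1
  have hzB := h.notMem.2
  have hrA : ∀ v ∈ A, rank (cyc v) = f v + 1 := fun v hv => by simp [rank, hv]
  have hrB : ∀ v ∈ B, rank (cyc v) = g v + 1 := fun v hv => by
    have : v ∉ A := fun hA => hdis v hA v hv rfl
    simp [rank, hv, this]
  have hrz : rank (cyc z) = A.length + B.length + 1 := by simp [rank, hzA, hzB]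
  have hle : ∀ v, rank (cyc v) < A.length + B.length + 2 := by
    intro v
    have hv := h.cover v
    rw [List.mem_cons, List.mem_append] at hv
    rcases hv with rfl | hv | hv
    · rw [hrz]; omega
    · rw [hrA v hv]; have := hf v hv; omega
    · rw [hrB v hv]; have := hg v hv; omega
  have hside : ∀ (D : List V) (k : V → ℕ), (∀ v ∈ D, rank (cyc v) = k v + 1) →
      (∀ v ∈ D, k v < A.length + B.length) → (D.Pairwise fun x y => k x < k y) →
      ∀ a b, [a, b] <:+: side z D → rank a < rank b := by
    intro D k hk hlt hp a b hab
    have : (side z D).Pairwise fun x y => rank x < rank y := by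
      rw [side, List.pairwise_cons, List.pairwise_append]
      refine ⟨fun b hb => ?_, ?_, List.pairwise_singleton _ _, fun a ha b hb => ?_⟩
      · have hb' : b ∈ (D ++ [z]).map cyc := by simpa using hb
        obtain ⟨v, hv, rfl⟩ := List.mem_map.1 hb'
        rcases List.mem_append.1 hv with hv | hv
        · rw [hk v hv]; exact Nat.succ_pos _
        · rw [List.mem_singleton.1 hv, hrz]; exact Nat.succ_pos _
      · rw [List.pairwise_map]
        refine hp.imp_of_mem fun {x y} hx hy hxy => ?_
        rw [hk x hx, hk y hy]
        omega
      · obtain ⟨v, hv, rfl⟩ := List.mem_map.1 ha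
        rw [List.mem_singleton.1 hb, hrz, hk v hv]
        have := hlt v hv
        omega
    exact List.pairwise_iff_forall_sublist.1 this hab.sublist
  have hrank : ∀ a b, (catDigraph z A B).Adj a b → rank a < rank b := by
    rintro a b (hab | hab | ⟨v, rfl, rfl⟩)
    · exact hside A f hrA (fun v hv => by have := hf v hv; omega) hfp a b hab
    · exact hside B g hrB (fun v hv => by have := hg v hv; omega) hgp a b hab
    · exact hle v
  have htrans : ∀ a b, Relation.TransGen (catDigraph z A B).Adj a b → rank a < rank b := by
    intro a b hab
    induction hab with
    | single h => exact hrank _ _ h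
    | tail _ h ih => exact ih.trans (hrank _ _ h)
  exact fun v hv => lt_irrefl _ (htrans v v hv)

theorem catDigraph_adj_leaf {a : CatVertex V} {v : V} :
    (catDigraph z A B).Adj a (leaf v) ↔ a = cyc v := by
  constructor
  · rintro (h | h | ⟨u, rfl, h⟩)
    · obtain ⟨u, -, h⟩ := (side_pair h).2
      cases h
    · obtain ⟨u, -, h⟩ := (side_pair h).2
      cases h
    · cases h; rfl
  · rintro rfl
    exact Or.inr (Or.inr ⟨v, rfl, rfl⟩)

theorem catDigraph_isElementaryWith (h : IsTwoCaterpillar H z A B s r) :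
    IsElementaryWith (catDigraph z A B) (range leaf) (catCycle h) where
  dag := catDigraph_isDAG h
  not_adj_root := by
    rintro u (hu | hu | ⟨v, -, hu⟩)
    · obtain ⟨v, -, hv⟩ := (side_pair hu).2
      cases hv
    · obtain ⟨v, -, hv⟩ := (side_pair hu).2
      cases hv
    · cases hu
  leaf_not_adj := by
    rintro _ ⟨x, rfl⟩ u (hu | hu | ⟨v, hu, -⟩)
    · rcases (side_pair hu).1 with h | ⟨v, -, h⟩ <;> cases h
    · rcases (side_pair hu).1 with h | ⟨v, -, h⟩ <;> cases h
    · cases hu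
  leaf_parent := by
    rintro _ ⟨x, rfl⟩ u v hu hv
    rw [catDigraph_adj_leaf] at hu hv
    rw [hu, hv]
  exists_parent := by
    rintro _ ⟨x, rfl⟩
    exact ⟨cyc x, catDigraph_adj_leaf.2 rfl⟩
  cover v := by
    by_cases hv : v ∈ range leaf
    · exact Or.inr hv
    · exact Or.inl ((catCycle_mem_verts h v).2 fun u e => hv ⟨u, e.symm⟩)
  exists_leaf := by
    intro v hv hne
    cases v with
    | root => exact absurd rfl hne
    | leaf v => exact absurd rfl ((catCycle_mem_verts h _).1 hv v)
    | cyc v => exact ⟨leaf v, mem_range_self v, catDigraph_adj_leaf.2 rfl⟩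
  leaf_unique := by
    rintro v - - _ ⟨x, rfl⟩ _ ⟨y, rfl⟩ hx hy
    rw [catDigraph_adj_leaf] at hx hy
    rw [cyc_injective (hx.symm.trans hy)]
  edge := by
    rintro u v (huv | huv | ⟨w, rfl, rfl⟩)
    · exact Or.inl (Or.inl huv)
    · exact Or.inl (Or.inr huv)
    · exact Or.inr ⟨(catCycle_mem_verts h _).2 (by simp), by simp [catCycle], mem_range_self w⟩

theorem two_le_ncard {α : Type*} {S : Set α} [Finite α] {a b : α} (hab : a ≠ b) (ha : a ∈ S)
    (hb : b ∈ S) : 2 ≤ S.ncard := by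
  rw [← Set.ncard_pair hab]
  exact Set.ncard_le_ncard (by rintro x (rfl | rfl) <;> assumption) (Set.toFinite _)

theorem catDigraph_isTreeVertex [Finite V] (h : IsTwoCaterpillar H z A B s r) {v : V}
    (hv : v ≠ z) : IsTreeVertex (catDigraph z A B) (cyc v) := by
  have hE := catDigraph_isElementaryWith h
  have hmem : cyc v ∈ (catCycle h).verts := (catCycle_mem_verts h _).2 (by simp)
  have hvh : cyc v ≠ (catCycle h).hybrid := fun e => hv (cyc_injective e)
  constructor
  · obtain ⟨p, hp⟩ := (catCycle h).exists_isEdge hmem (by simp [catCycle])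
    rw [indeg, Set.ncard_eq_one]
    refine ⟨p, Set.ext fun u => ⟨fun hu => ?_, ?_⟩⟩
    · exact (hE.isEdge hu hmem).left_unique hp hvh
    · rintro rfl
      exact hp.adj
  · have hnext : ∃ y, (catDigraph z A B).Adj (cyc v) (cyc y) := by
      have key : ∀ D : List V, v ∈ D → ∃ y, [cyc v, cyc y] <:+: side z D := by
        intro D hD
        obtain ⟨l₁, l₂, rfl⟩ := List.append_of_mem hD
        cases l₂ with
        | nil => exact ⟨z, root :: l₁.map cyc, [], by simp [side]⟩
        | cons y l₂ => exact ⟨y, root :: l₁.map cyc, l₂.map cyc ++ [cyc z], by simp [side]⟩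
      have hv' := h.cover v
      rw [List.mem_cons, List.mem_append] at hv'
      rcases hv'.resolve_left hv with hA | hB
      · obtain ⟨y, hy⟩ := key A hA
        exact ⟨y, Or.inl hy⟩
      · obtain ⟨y, hy⟩ := key B hB
        exact ⟨y, Or.inr (Or.inl hy)⟩
    obtain ⟨y, hy⟩ := hnext
    exact two_le_ncard (a := leaf v) (b := cyc y) (by simp) (catDigraph_adj_leaf.2 rfl) hy

theorem catDigraph_isHybrid [Finite V] (h : IsTwoCaterpillar H z A B s r) :
    IsHybrid (catDigraph z A B) (cyc z) := by
  have hE := catDigraph_isElementaryWith h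
  have hmem : cyc z ∈ (catCycle h).verts := (catCycle_mem_verts h _).2 (by simp)
  obtain ⟨p, q, hpq, hp, hq⟩ := (catCycle h).exists_parents
  constructor
  · rw [indeg, Set.ncard_eq_two]
    refine ⟨p, q, hpq, Set.ext fun u => ⟨fun hu => ?_, ?_⟩⟩
    · have hu' := hE.isEdge hu hmem
      have e₁ := fun {a b} (ha : [a, cyc z] <:+: side z A) (hb : [b, cyc z] <:+: side z A) =>
        pair_infix_left_unique (catCycle h).nodup₁ ha hb
      have e₂ := fun {a b} (ha : [a, cyc z] <:+: side z B) (hb : [b, cyc z] <:+: side z B) =>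
        pair_infix_left_unique (catCycle h).nodup₂ ha hb
      rcases hp with hp | hp <;> rcases hq with hq | hq
      · exact absurd (e₁ hp hq) hpq
      · rcases hu' with hu' | hu'
        · exact Or.inl (e₁ hu' hp)
        · exact Or.inr (e₂ hu' hq)
      · rcases hu' with hu' | hu'
        · exact Or.inr (e₁ hu' hq)
        · exact Or.inl (e₂ hu' hp)
      · exact absurd (e₂ hp hq) hpq
    · rintro (rfl | rfl)
      · exact hp.adj
      · exact hq.adj
  · rw [Nat.one_le_iff_ne_zero]
    intro h0
    exact not_adj_of_outdeg_eq_zero h0 (leaf z) (catDigraph_adj_leaf.2 rfl)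

theorem catDigraph_root [Finite V] (h : IsTwoCaterpillar H z A B s r) :
    indeg (catDigraph z A B) root = 0 ∧ 2 ≤ outdeg (catDigraph z A B) root := by
  constructor
  · rw [indeg, Set.ncard_eq_zero (Set.toFinite _)]
    exact Set.eq_empty_of_forall_notMem fun u hu =>
      (catDigraph_isElementaryWith h).not_adj_root u hu
  · obtain ⟨a, A', rfl⟩ := List.exists_cons_of_ne_nil h.left_ne_nil
    obtain ⟨b, B', rfl⟩ := List.exists_cons_of_ne_nil h.right_ne_nil
    have hab : a ≠ b := by
      have hnd := h.nodup
      rw [List.nodup_cons, List.nodup_append] at hnd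
      exact hnd.2.2.2 a (by simp) b (by simp)
    exact two_le_ncard (a := cyc a) (b := cyc b) (fun e => hab (cyc_injective e))
      (Or.inl ⟨[], A'.map cyc ++ [cyc z], by simp [side]⟩)
      (Or.inr (Or.inl ⟨[], B'.map cyc ++ [cyc z], by simp [side]⟩))

/-- Condition (N4) is immediate because `cyc z` is the only hybrid-vertex. -/
theorem catDigraph_isGalledTree [Finite V] (h : IsTwoCaterpillar H z A B s r) :
    IsGalledTree (catDigraph z A B) (range leaf) := by
  have hE := catDigraph_isElementaryWith h
  have hroot := catDigraph_root h
  have hhyb := catDigraph_isHybrid h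
  have htree := fun {v} (hv : v ≠ z) => catDigraph_isTreeVertex h hv
  have hleaf : ∀ v, outdeg (catDigraph z A B) (leaf v) = 0 ∧
      indeg (catDigraph z A B) (leaf v) = 1 := by
    intro v
    constructor
    · rw [outdeg, Set.ncard_eq_zero (Set.toFinite _)]
      exact Set.eq_empty_of_forall_notMem fun u hu => hE.leaf_not_adj _ (mem_range_self v) u hu
    · rw [indeg, Set.ncard_eq_one]
      exact ⟨cyc v, Set.ext fun u => catDigraph_adj_leaf⟩
  have hcyc : ∀ v, outdeg (catDigraph z A B) (cyc v) ≠ 0 := fun v h0 =>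
    not_adj_of_outdeg_eq_zero h0 (leaf v) (catDigraph_adj_leaf.2 rfl)
  have honly : ∀ a, IsHybrid (catDigraph z A B) a → a = cyc z := by
    rintro (_ | v | v) ha
    · have := ha.1
      rw [hroot.1] at this
      omega
    · by_contra hne
      have := (htree (v := v) fun e => hne (by rw [e])).1
      have := ha.1
      omega
    · have := ha.1
      rw [(hleaf v).2] at this
      omega
  refine ⟨hE.dag, Or.inr ⟨⟨root, hroot.1, hroot.2, ?_⟩, ?_, ?_, ?_⟩⟩
  · rintro (_ | v | v) hv
    · rfl
    · by_cases hvz : v = z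
      · rw [hvz, hhyb.1] at hv; omega
      · rw [(htree hvz).1] at hv; omega
    · rw [(hleaf v).2] at hv; omega
  · rintro (_ | v | v)
    · refine ⟨fun ⟨u, hu⟩ => (by cases hu), fun hx => ?_⟩
      have := hroot.2
      omega
    · exact ⟨fun ⟨u, hu⟩ => (by cases hu), fun hx => absurd hx.1 (hcyc v)⟩
    · exact ⟨fun _ => hleaf v, fun _ => mem_range_self v⟩
  · rintro (_ | v | v) hv hin
    · exact absurd hroot.1 hin
    · by_cases hvz : v = z
      · exact Or.inr (hvz ▸ hhyb)
      · exact Or.inl (htree hvz)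
    · exact absurd (mem_range_self v) hv
  · intro S _ v _ v' _ hv hv' _ _
    rw [honly v hv, honly v' hv']

theorem catDigraph_isElementary [Finite V] (h : IsTwoCaterpillar H z A B s r) :
    IsElementary (catDigraph z A B) (range leaf) := by
  have hE := catDigraph_isElementaryWith h
  refine ⟨catDigraph_isGalledTree h, catCycle h, (catDigraph_root h).1, ?_, ?_, ?_, hE.edge⟩
  · have hverts : (catCycle h).verts = insert root (range cyc) := by
      ext a
      rw [catCycle_mem_verts]
      cases a <;> simp
    have hcard : ∀ f : V → CatVertex V, Function.Injective f → (range f).ncard = Nat.card V :=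
      fun f hf => by
        rw [← image_univ, Set.ncard_image_of_injective _ hf, Set.ncard_univ]
    rw [hverts, Set.ncard_insert_of_notMem (by simp) (Set.toFinite _), hcard _ cyc_injective,
      hcard _ leaf_injective]
  · exact Set.eq_univ_of_forall hE.cover
  · intro v hv hne
    obtain ⟨x, hx, hvx⟩ := hE.exists_leaf v hv hne
    exact ⟨x, ⟨hx, hvx⟩, fun y hy => hE.leaf_unique v hv hne y hy.1 x hx hy.2 hvx⟩

theorem catLabel_isLabeling : IsLabeling (range (leaf : V → CatVertex V)) (catLabel s r) := by
  constructor
  · rintro (_ | v | v)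
    · by_cases h : r <;> simp [catLabel, h]
    · by_cases h : s v <;> simp [catLabel, h]
    · simp [catLabel]
  · rintro (_ | v | v)
    · by_cases h : r <;> simp [catLabel, h]
    · by_cases h : s v <;> simp [catLabel, h]
    · simp [catLabel]

theorem catLabel_isQuasiDiscriminating [Finite V] (h : IsTwoCaterpillar H z A B s r)
    (hmod : ∀ U : Set V, IsModuleOn H univ U → U.Subsingleton ∨ U = univ) :
    IsQuasiDiscriminating (catDigraph z A B) (catLabel s r) := by
  have key : ∀ {D}, (∀ x y, [x, y] <:+: D → ¬ (s x ↔ s y)) →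
      (∀ x, D.head? = some x → ¬ (s x ↔ r)) → ∀ a y, y ≠ z → [a, cyc y] <:+: side z D →
      catLabel s r a ≠ catLabel s r (cyc y) := by
    intro D h1 h2 a y hy hay
    rcases side_pair_ne hay hy with ⟨rfl, hD⟩ | ⟨x, rfl, hx⟩
    · have := h2 y hD
      by_cases hr : r <;> by_cases hs : s y <;> simp_all [catLabel]
    · have := h1 x y hx
      by_cases hr : s x <;> by_cases hs : s y <;> simp_all [catLabel]
  have hA := h.alternating hmod
  have hB := h.swap.alternating hmod
  intro a b hab hb
  cases b with
  | root => exact absurd hab ((catDigraph_isElementaryWith h).not_adj_root a)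
  | leaf v =>
    rw [catDigraph_adj_leaf] at hab
    subst hab
    by_cases hs : s v <;> simp [catLabel, hs]
  | cyc y =>
    have hy : y ≠ z := by
      rintro rfl
      exact hb (catDigraph_isHybrid h)
    rcases hab with hab | hab | ⟨v, -, hv⟩
    · exact key hA.1 hA.2 a y hy hab
    · exact key hB.1 hB.2 a y hy hab
    · cases hv

/-- The fields `left`, `right` and `cross` are exactly the adjacency rules read off from least
common ancestors in this galled-tree. -/
theorem catDigraph_explains (h : IsTwoCaterpillar H z A B s r) :
    explainedGraph (catDigraph z A B) (catLabel s r) leaf = H := by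
  have hE := catDigraph_isElementaryWith h
  set K := explainedGraph (catDigraph z A B) (catLabel s r) leaf with hK
  have hcyc : ∀ x, catLabel s r (cyc x) = VLabel.one ↔ s x := by
    intro x
    by_cases hs : s x <;> simp [catLabel, hs]
  have hadj : ∀ x, (catDigraph z A B).Adj (cyc x) (leaf x) := fun x => catDigraph_adj_leaf.2 rfl
  have hside : ∀ D : List V, (D ++ [z]).Nodup →
      ((D ++ [z]).map cyc).Pairwise (Relation.TransGen (catDigraph z A B).Adj) →
      ((D ++ [z]).Pairwise fun x y => (H.Adj x y ↔ s x)) →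
      ∀ x ∈ D ++ [z], ∀ y ∈ D ++ [z], x ≠ y → (K.Adj x y ↔ H.Adj x y) := by
    intro D hnd h1 h2 x hx y hy hne
    rw [List.pairwise_map] at h1
    have h3 : (D ++ [z]).Pairwise fun x y => (K.Adj x y ↔ H.Adj x y) := by
      refine ((h1.and h2).and hnd).imp ?_
      rintro x y ⟨⟨ht, hH⟩, hxy⟩
      rw [hH, hK, hE.adj_iff_above leaf_injective (hadj x) (hadj y) hxy ht, hcyc]
    exact h3.forall_of_forall_of_flip (fun _ _ => by simp)
      (h3.imp fun {a b} hab => by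
        simp only [flip]
        rw [K.adj_comm, H.adj_comm]
        exact hab) hx hy
  have hnd := h.nodup
  rw [List.nodup_cons, List.nodup_append] at hnd
  have hndA : (A ++ [z]).Nodup := hnd.2.1.append (by simp) (by simpa using h.notMem.1)
  have hndB : (B ++ [z]).Nodup := hnd.2.2.1.append (by simp) (by simpa using h.notMem.2)
  have hA := hside A hndA
    (by simpa [catCycle] using
      (List.pairwise_cons.1 (IsElementaryWith.pairwise₁ (catCycle h))).2) h.left
  have hB := hside B hndB
    (by simpa [catCycle] using
      (List.pairwise_cons.1 (IsElementaryWith.pairwise₂ (catCycle h))).2) h.right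
  have hopp : ∀ x ∈ A, ∀ y ∈ B, (K.Adj x y ↔ H.Adj x y) := by
    intro x hx y hy
    rw [h.cross x hx y hy, hK, hE.adj_iff_opposite (hadj x) (hadj y)
      (List.mem_map_of_mem hx) (List.mem_map_of_mem hy)]
    by_cases hr : r <;> simp [catCycle, catLabel, hr]
  have hall : ∀ x y, x ≠ y → (K.Adj x y ↔ H.Adj x y) := by
    intro x y hne
    have hx := h.cover x
    have hy := h.cover y
    rw [List.mem_cons, List.mem_append] at hx hy
    rcases hx with rfl | hx | hx <;> rcases hy with rfl | hy | hy
    · exact absurd rfl hne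
    · exact hA x (by simp) y (by simp [hy]) hne
    · exact hB x (by simp) y (by simp [hy]) hne
    · exact hA x (by simp [hx]) y (by simp) hne
    · exact hA x (by simp [hx]) y (by simp [hy]) hne
    · exact hopp x hx y hy
    · exact hB x (by simp [hx]) y (by simp) hne
    · rw [K.adj_comm, H.adj_comm]; exact hopp y hy x hx
    · exact hB x (by simp [hx]) y (by simp [hy]) hne
  ext x y
  by_cases hne : x = y
  · subst hne
    simp
  · exact hall x y hne

end Cat

end GaTEx

namespace GaTEx

open Set

/-! ### Existence of pvr-networks -/

section Existence

theorem exists_isLCA_pair {W : Type*} [Finite W] {N : Digraph W} {L : Set W} (hdag : IsDAG N)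
    (hN : IsProperGalledTree N L) (x y : W) : ∃ w, IsLCA N {x, y} w := by
  obtain ⟨ρ, hρ⟩ := exists_root hdag hN
  obtain ⟨w, hw, -⟩ := exists_isLCA_below hdag (A := {x, y}) (c := ρ) (fun v _ => hρ v)
  exact ⟨w, hw⟩

/-- The ancestor order of a galled-tree; suprema are least common ancestors. -/
noncomputable abbrev ancestorSemilattice {W : Type*} [Finite W] {N : Digraph W} {L : Set W}
    (hdag : IsDAG N) (hN : IsProperGalledTree N L) : SemilatticeSup W where
  le u v := IsAncestor N v u
  le_refl _ := Relation.ReflTransGen.refl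
  le_trans _ _ _ h h' := h'.trans h
  le_antisymm _ _ h h' := ancestor_antisymm hdag h' h
  sup x y := (exists_isLCA_pair hdag hN x y).choose
  le_sup_left x y := (exists_isLCA_pair hdag hN x y).choose_spec.1 x (by simp)
  le_sup_right x y := (exists_isLCA_pair hdag hN x y).choose_spec.1 y (by simp)
  sup_le x y c hx hy := by
    obtain ⟨w, hw, hcw⟩ := exists_isLCA_below hdag (A := {x, y}) (c := c) (by
      rintro a (rfl | rfl) <;> assumption)
    rw [isLCA_unique hdag hN (exists_isLCA_pair hdag hN x y).choose_spec hw]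
    exact hcw

/-- A finite acyclic digraph has a sink, and in a galled-tree every sink is a leaf. -/
theorem nonempty_of_isGaTEx {X : Type*} {G : SimpleGraph X} (hG : IsGaTEx G) : Nonempty X := by
  obtain ⟨W, _, N, t, ℓ, -, ⟨hdag, hN⟩, -, -⟩ := hG
  rcases hN with ⟨x, -, hx⟩ | hN
  · obtain ⟨y, -⟩ := (hx ▸ rfl : x ∈ range ℓ)
    exact ⟨y⟩
  · obtain ⟨ρ, -, hρ2, hρ⟩ := hN.root
    obtain ⟨v, -, hv⟩ := (wellFounded_adj_swap hdag).has_min univ ⟨ρ, mem_univ ρ⟩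
    have hout : outdeg N v = 0 := by
      rw [outdeg, Set.ncard_eq_zero (Set.toFinite _)]
      exact Set.eq_empty_of_forall_notMem fun u hu =>
        hv u (mem_univ u) (Relation.TransGen.single hu)
    by_cases hvX : v ∈ range ℓ
    · obtain ⟨y, -⟩ := hvX
      exact ⟨y⟩
    · exfalso
      by_cases hin : indeg N v = 0
      · rw [hρ v hin] at hout
        omega
      · rcases hN.inner v hvX hin with h | h
        · have := h.2; omega
        · have := h.2; omega

/-- Quotients at prime vertices have only trivial modules, and neither they nor their
complements have an edgeless cut. -/
theorem quotient_prime {X : Type*} [Finite X] {G : SimpleGraph X} (P : PrimeVertex G)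
    {V : Type*} (e : maxStrong G P.1.1 ≃ V) {H : SimpleGraph V}
    (hH : ∀ S T, H.Adj (e S) (e T) ↔ (quotientGraph G P.1.1).Adj S T) :
    (∀ U : Set V, IsModuleOn H univ U → U.Subsingleton ∨ U = univ) ∧
      (∀ T : Set V, T.Nonempty → T ≠ univ →
        (∃ x ∈ T, ∃ y ∉ T, H.Adj x y) ∧ ∃ x ∈ T, ∃ y ∉ T, ¬ H.Adj x y) ∧ Nontrivial V := by
  obtain ⟨hcard, hcon, hco⟩ := mdLabel_eq_prime P.2
  have hblock : ∀ x ∈ P.1.1, ∃ S : maxStrong G P.1.1, x ∈ S.1 := fun x hx => by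
    obtain ⟨S, hS, hxS⟩ := exists_maxStrong_mem (G := G) hcard hx
    exact ⟨⟨S, hS⟩, hxS⟩
  have huniq : ∀ {S T : maxStrong G P.1.1} {x : X}, x ∈ S.1 → x ∈ T.1 → S = T :=
    fun {S T x} hS hT => Subtype.ext (maxStrong_eq_of_mem S.2 T.2 hS hT)
  have hadj : ∀ {S T : maxStrong G P.1.1} {x y : X}, e S ≠ e T → x ∈ S.1 → y ∈ T.1 →
      (H.Adj (e S) (e T) ↔ G.Adj x y) := fun {S T x y} hne hx hy => by
    rw [hH, quotientGraph_adj (fun h => hne (by rw [h])) hx hy]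
  let lift : Set V → Set X := fun U => {x | ∃ S : maxStrong G P.1.1, x ∈ S.1 ∧ e S ∈ U}
  have hlift : ∀ {U : Set V} {S : maxStrong G P.1.1} {x : X}, x ∈ S.1 →
      (x ∈ lift U ↔ e S ∈ U) := by
    intro U S x hx
    constructor
    · rintro ⟨T, hT, hTU⟩
      rwa [huniq hx hT]
    · exact fun h => ⟨S, hx, h⟩
  refine ⟨fun U hU => ?_, fun T hT hT' => ?_, ?_⟩
  · by_cases hne : U.Nonempty
    · by_cases huniv : U = univ
      · exact Or.inr huniv
      left
      have hmod : IsModuleOn G P.1.1 (lift U) := by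
        refine ⟨?_, ?_⟩
        · rintro x ⟨S, hx, -⟩
          exact maxStrong_subset S.2 hx
        · rintro x ⟨S, hx, hS⟩ y ⟨T, hy, hT⟩ w hw hwU
          obtain ⟨Q, hQ⟩ := hblock w hw
          have hQU : e Q ∉ U := fun h => hwU ((hlift hQ).2 h)
          rw [← hadj (fun h => hQU (h ▸ hS)) hx hQ, ← hadj (fun h => hQU (h ▸ hT)) hy hQ]
          exact hU.2 _ hS _ hT _ (mem_univ _) hQU
      obtain ⟨u, hu⟩ := hne
      obtain ⟨x, hx⟩ := maxStrong_nonempty (e.symm u).2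
      obtain ⟨v, hv⟩ := (Set.ne_univ_iff_exists_notMem U).1 huniv
      obtain ⟨y, hy⟩ := maxStrong_nonempty (e.symm v).2
      obtain ⟨S, hS, hUS⟩ := exists_maxStrong_superset_of_module hcon hco (U := lift U)
        ⟨x, (hlift hx).2 (by simpa using hu)⟩ hmod (fun h => hv (by
          have : y ∈ lift U := h.ge (maxStrong_subset (e.symm v).2 hy)
          simpa using (hlift hy).1 this))
      have hall : ∀ a ∈ U, a = e ⟨S, hS⟩ := by
        intro a ha
        obtain ⟨b, hb⟩ := maxStrong_nonempty (e.symm a).2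
        have : b ∈ S := hUS ((hlift hb).2 (by simpa using ha))
        rw [← huniq hb (T := ⟨S, hS⟩) this]
        simp
      intro a ha b hb
      rw [hall a ha, hall b hb]
    · rw [not_nonempty_iff_eq_empty] at hne
      rw [hne]
      exact Or.inl subsingleton_empty
  · obtain ⟨u, hu⟩ := hT
    obtain ⟨v, hv⟩ := (Set.ne_univ_iff_exists_notMem T).1 hT'
    obtain ⟨x, hx⟩ := maxStrong_nonempty (e.symm u).2
    obtain ⟨y, hy⟩ := maxStrong_nonempty (e.symm v).2
    have hxT : x ∈ lift T := (hlift hx).2 (by simpa using hu)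
    have hyT : y ∉ lift T := fun h => hv (by simpa using (hlift hy).1 h)
    have key : ∀ K : SimpleGraph P.1.1, K.Connected → ∃ S S' : maxStrong G P.1.1,
        e S ∈ T ∧ e S' ∉ T ∧ ∃ a b : P.1.1, a.1 ∈ S.1 ∧ b.1 ∈ S'.1 ∧ K.Adj a b := by
      intro K hK
      obtain ⟨a, b, ha, hb, -, hab⟩ := exists_adj_across K
        (hK.preconnected ⟨x, maxStrong_subset (e.symm u).2 hx⟩
          ⟨y, maxStrong_subset (e.symm v).2 hy⟩) (T := lift T) hxT hyT
      obtain ⟨S, hS⟩ := hblock a a.2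
      obtain ⟨S', hS'⟩ := hblock b b.2
      exact ⟨S, S', (hlift hS).1 ha, fun h => hb ((hlift hS').2 h), a, b, hS, hS', hab⟩
    constructor
    · obtain ⟨S, S', hS, hS', a, b, ha, hb, hab⟩ := key _ hcon
      exact ⟨e S, hS, e S', hS', (hadj (fun h => hS' (h ▸ hS)) ha hb).2 hab⟩
    · obtain ⟨S, S', hS, hS', a, b, ha, hb, hab⟩ := key _ hco
      refine ⟨e S, hS, e S', hS', fun h => ?_⟩
      rw [SimpleGraph.compl_adj] at hab
      exact hab.2 ((hadj (fun h => hS' (h ▸ hS)) ha hb).1 h)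
  · obtain ⟨x, hx⟩ := P.1.2.1
    obtain ⟨S, hS⟩ := hblock x hx
    obtain ⟨y, hy, hyS⟩ : ∃ y ∈ P.1.1, y ∉ S.1 := not_subset.1 fun h =>
      maxStrong_ne S.2 (subset_antisymm (maxStrong_subset S.2) h)
    obtain ⟨T, hT⟩ := hblock y hy
    exact ⟨e S, e T, fun h => hyS (by rw [e.injective h]; exact hT)⟩

theorem exists_twoCaterpillar {X : Type*} [Finite X] {G : SimpleGraph X} (hG : IsGaTEx G)
    (P : PrimeVertex G) {V : Type*} [Finite V] (e : maxStrong G P.1.1 ≃ V) {H : SimpleGraph V}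
    (hH : ∀ S T, H.Adj (e S) (e T) ↔ (quotientGraph G P.1.1).Adj S T) :
    ∃ z A B s r, IsTwoCaterpillar H z A B s r := by
  obtain ⟨hmod, hcross, hnt⟩ := quotient_prime P e hH
  obtain ⟨W, _, N, t, ℓ, hℓ, ⟨hdag, hN⟩, -, hexp⟩ := hG
  -- The quotient is realized in G by one representative per module, so its adjacency is read off
  -- from least common ancestors in the galled-tree explaining G.
  choose rep hrep using fun S : maxStrong G P.1.1 => maxStrong_nonempty S.2
  have hrepinj : ∀ {S T : maxStrong G P.1.1}, rep S = rep T → S = T := fun {S T} h =>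
    Subtype.ext (maxStrong_eq_of_mem S.2 T.2 (hrep S) (h ▸ hrep T))
  rcases hN with ⟨w, hw, -⟩ | hN
  · exfalso
    obtain ⟨a, b, hab⟩ := hnt
    refine hab (e.symm.injective (hrepinj (hℓ ?_)))
    have h1 : ∀ v : W, v = w := fun v => (hw ▸ mem_univ v : v ∈ ({w} : Set W))
    rw [h1 (ℓ _), h1 (ℓ (rep (e.symm b)))]
  let _ : SemilatticeSup W := ancestorSemilattice hdag hN
  have hL : IsGalledOrder W :=
    ⟨fun hab hac haz hbz haz' hcz' => ancestor_of_overlap hdag hN ⟨hab.2, hab.1⟩ ⟨hac.2, hac.1⟩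
      haz hbz haz' hcz',
    fun hab hac hbc h1 h2 h3 h4 h5 h6 => not_three_overlap hdag hN ⟨hab.2, hab.1⟩
      ⟨hac.2, hac.1⟩ ⟨hbc.2, hbc.1⟩ h1 h2 h3 h4 h5 h6⟩
  refine exists_isTwoCaterpillar hL H hmod hcross (fun v => ℓ (rep (e.symm v)))
    (fun w => t w = VLabel.one) fun x y hxy => ?_
  obtain ⟨S, rfl⟩ := e.surjective x
  obtain ⟨T, rfl⟩ := e.surjective y
  have hST : S ≠ T := fun h => hxy (by rw [h])
  have hne : rep S ≠ rep T := fun h => hST (hrepinj h)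
  simp only [Equiv.symm_apply_apply]
  rw [hH, quotientGraph_adj hST (hrep S) (hrep T), ← hexp, explainedGraph_adj]
  have hspec : IsLCA N {ℓ (rep S), ℓ (rep T)} (ℓ (rep S) ⊔ ℓ (rep T)) :=
    (exists_isLCA_pair hdag hN (ℓ (rep S)) (ℓ (rep T))).choose_spec
  constructor
  · rintro ⟨-, w, hw, hwt⟩
    rwa [isLCA_unique hdag hN hw hspec] at hwt
  · exact fun h => ⟨hne, _, hspec, h⟩

theorem exists_replacement {X : Type*} [Finite X] {G : SimpleGraph X} (hG : IsGaTEx G)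
    (P : PrimeVertex G) : Nonempty (Replacement G P.1.1) := by
  -- The quotient is moved to `Fin n`, because a replacement needs its vertices in `Type` while X
  -- may live in a higher universe.
  obtain ⟨n, ⟨e⟩⟩ := Finite.exists_equiv_fin (maxStrong G P.1.1)
  let H : SimpleGraph (Fin n) := (quotientGraph G P.1.1).comap e.symm
  have hH : ∀ S T, H.Adj (e S) (e T) ↔ (quotientGraph G P.1.1).Adj S T := by
    intro S T
    simp [H]
  obtain ⟨z, A, B, s, r, h⟩ := exists_twoCaterpillar hG P e hH
  have hmod := (quotient_prime P e hH).1
  have hrange : range (fun S => CatVertex.leaf (e S)) = range CatVertex.leaf :=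
    e.surjective.range_comp CatVertex.leaf
  refine ⟨{
    W := CatVertex (Fin n)
    finite := inferInstance
    N := catDigraph z A B
    t := catLabel s r
    root := CatVertex.root
    leaf := fun S => CatVertex.leaf (e S)
    leaf_injective := CatVertex.leaf_injective.comp e.injective
    indeg_root := (catDigraph_root h).1
    elementary := by rw [hrange]; exact catDigraph_isElementary h
    strong := (catDigraph_isElementaryWith h).isStrong
      (by simpa [catCycle] using h.left_ne_nil) (by simpa [catCycle] using h.right_ne_nil)
      (by simpa [catCycle] using h.not_both_length_one hmod)
    labeling := by rw [hrange]; exact catLabel_isLabeling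
    quasiDiscriminating := catLabel_isQuasiDiscriminating h hmod
    explains := ?_ }⟩
  ext S T
  have := catDigraph_explains h
  rw [← hH, ← this, explainedGraph_adj, explainedGraph_adj, e.injective.ne_iff]

end Existence

end GaTEx

theorem mainTheorem2 {X : Type*} [Finite X] (G : SimpleGraph X) (hG : GaTEx.IsGaTEx G) :
    Nonempty (GaTEx.PvrChoice G) ∧
      ∀ R : GaTEx.PvrChoice G,
        (∃ o : List X, GaTEx.AlgReturns R o) ∧
          ∀ o : List X, GaTEx.AlgReturns R o → GaTEx.IsPerfectOrder G o := by
  have := GaTEx.nonempty_of_isGaTEx hG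
  exact ⟨⟨fun P => (GaTEx.exists_replacement hG P).some⟩,
    fun R => ⟨GaTEx.exists_algReturns R, fun _ ho => ho.isPerfectOrder⟩⟩
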